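/- Setting. Let $d\ge1$, $N\ge2$ and $\mathcal X=\{1,\dots,N\}^d$. A model consists of a measurable space $\mathsf Y$, measurable functions $F(x,\cdot):\mathsf Y\to\mathbb R$ and laws of random objects $\xi_x$ on $\mathsf Y$ ($x\in\mathcal X$); its objective is $f(x)=\mathbb E[F(x,\xi_x)]$. A simulation algorithm adaptively chooses systems $x\in\mathcal X$, observes for each choice a fresh independent copy of $F(x,\xi_x)$, stops at a stopping time $\tau$ (the number of simulations) and returns a point of $\mathcal X$; its sampling, stopping and recommendation rules are measurable functions of the history. For $\sigma>0$, $L\ge0$, $c>0$ let $\mathcal{MC}_c$ be the class of models such that * $f$ is $L^\natural$-convex: $f(x)+f(y)\ge f(\lceil\frac{x+y}2\rceil)+f(\lfloor\frac{x+y}2\rfloor)$ for all $x,y\in\mathcal X$; * $F(x,\xi_x)-f(x)$ is sub-Gaussian with parameter $\sigma^2$ for every $x\in\mathcal X$; * $|f(x)-f(y)|\le L$ whenever $\|x-y\|_\infty\le1$; * the indifference zone parameter is $c$: there is $x^*\in\mathcal X$ with $f(x)\ge f(x^*)+c$ for all $x\ne x^*$. An algorithm has the $(c,\delta)$-PCS-IZ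 guarantee for a model if it stops almost surely and returns $x^*$ with probability at least $1-\delta$. Let $$T(\delta,\mathcal{MC}_c)=\inf_{A}\ \sup_{\mathcal{M}\in\mathcal{MC}_c}\mathbb E[\tau],$$ the infimum being over the algorithms $A$ with this guarantee for every model in $\mathcal{MC}_c$. Stochastic subgradient. For $x\in[1,N]^d$ let $y\in\{1,\dots,N-1\}^d$, $y_i=\min(\lfloor x_i\rfloor,N-1)$, let $\alpha$ be a permutation that lists the coordinates of $x-y$ in decreasing order, and $S^{x,k}=y+\sum_{j\le k}e_{\alpha(j)}$ for $0\le k\le d$. Then $\hat g_{\alpha(i)}=F(S^{x,i},\xi^1_i)-F(S^{x,i-1},\xi^2_{i-1})$ for $i=1,\dots,d$, from $2d$ independent simulations. Adaptive SSGD algorithm. Let $E=\lceil\log_2N\rceil+1$. For $e=0,\dots,E-1$ put $W_e=2^{-e}N$ and $\epsilon_e=2^{-e}cN/4$. Epoch $e$ works in the search box $\mathcal Y_e$, where $\mathcal Y_0=[1,N]^d$ and $\mathcal Y_{e+1}=\{y\in[1,N]^d:\|y-x_e\|_\infty\le2^{-e-2}N\}$. It starts at $x^0=(N/2,\dots,N/2)$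 if $e=0$ and at $x^0=x_{e-1}$ if $e\ge1$, performs $T_e$ steps $$x^{t+1}=\mathcal P_{\mathcal Y_e}\big(x^t-\eta_e\,\mathcal T_{M_e}(\hat g^t)\big),\qquad \eta_e=\frac{W_e}{M_e\sqrt{T_e}},$$ where $\hat g^t$ is a stochastic subgradient at $x^t$, $\mathcal T_M$ truncates every coordinate to $[-M,M]$ and $\mathcal P_{\mathcal Y_e}$ is the orthogonal projection onto $\mathcal Y_e$; its result is $x_e=\frac1{T_e}\sum_{t<T_e}x^t$. Finally, with $\epsilon=c/2$, each of the points $S^{x_{E-1},0},\dots,S^{x_{E-1},d}$ is simulated $\lceil 32\sigma^2\epsilon^{-2}\log(8(d+1)/\delta)\rceil$ times, and a point with minimal empirical mean is returned. Theorem. For every $\sigma>0$ there is a constant $C>0$, depending only on $\sigma$, such that for all $d\ge1$, $N\ge2$, $L\ge0$, $c>0$ there is a constant $C_3$ (independent of $\delta$) such that for all $\delta\in(0,1)$ the following holds. There are iteration numbers $T_e$ and truncation levels $M_e>0$ with, for all $0\le e<E$ and $\delta_e=\delta/(2E)$, $$C^{-1}\tfrac{dW_e^2}{\epsilon_e^2}\log\tfrac1{\delta_e}\le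 T_e\le C\tfrac{dW_e^2}{\epsilon_e^2}\log\tfrac1{\delta_e}+C_3,\qquad C^{-1}\sqrt{\log\tfrac{dW_eT_e}{\epsilon_e}}\le M_e\le C\sqrt{\log\tfrac{dW_eT_e}{\epsilon_e}}+C_3$$ (the square root being read as $0$ if the logarithm is negative), such that the adaptive SSGD algorithm with these parameters has the $(c,\delta)$-PCS-IZ guarantee for every model in $\mathcal{MC}_c$, and its number $\tau$ of simulations satisfies, almost surely for every model in $\mathcal{MC}_c$, $$\tau\le C\Big[\tfrac{d^2\log N}{c^2}\log\tfrac1\delta+\tfrac{d^3\log N}{c^2}\log\tfrac{d^2N}{c^3}+\tfrac{d^3\log N\,L^2}{c^2}\Big]\quad\text{and}\quad \tau\le C\,\tfrac{d^2\log N}{c^2}\log\tfrac1\delta+C_3 .$$ Moreover, $T(\delta,\mathcal{MC}_c)$ satisfies the same two upper bounds (a negative bound being read as $0$; this can only happen if $\mathcal{MC}_c$ is empty). In particular, the simulation cost is $\tilde O\big(d^2\log(N)\,c^{-2}\log(1/\delta)\big)$. -/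

import Mathlib

open MeasureTheory ProbabilityTheory
open scoped ENNReal NNReal

universe u

noncomputable section

/-! ### The decision set, convexity and models -/

/-- The decision set `[N]^d`: vectors with `d` integer coordinates in `{1, …, N}`. -/
abbrev Grid (d N : ℕ) : Type := Fin d → Set.Icc (1 : ℤ) (N : ℤ)

/-- `L♮`-convexity of a function on `[N]^d`, i.e. discrete midpoint convexity:
`f x + f y ≥ f ⌈(x + y)/2⌉ + f ⌊(x + y)/2⌋`, with rounding in each coordinate. Here `u` and `v`
stand for the rounded-up and the rounded-down midpoint, which always lie in `[N]^d`. -/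
def LNaturalConvex {d N : ℕ} (f : Grid d N → ℝ) : Prop :=
  ∀ x y u v : Grid d N,
    (∀ i, (u i : ℤ) = ⌈(((x i : ℤ) : ℝ) + ((y i : ℤ) : ℝ)) / 2⌉) →
    (∀ i, (v i : ℤ) = ⌊(((x i : ℤ) : ℝ) + ((y i : ℤ) : ℝ)) / 2⌋) →
    f u + f v ≤ f x + f y

/-- A stochastic system over `[N]^d`: a space `Y` of randomness, a deterministic performance
function `F x y`, and the law on `Y` of the random object `ξ_x` for every decision variable `x`. -/
structure SimModel (d N : ℕ) where
  Y : Type u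
  [measurableSpaceY : MeasurableSpace Y]
  F : Grid d N → Y → ℝ
  measurable_F : ∀ x, Measurable (F x)
  law : Grid d N → Measure Y
  [isProbabilityMeasure_law : ∀ x, IsProbabilityMeasure (law x)]

attribute [instance] SimModel.measurableSpaceY SimModel.isProbabilityMeasure_law

namespace SimModel

variable {d N : ℕ}

/-- The objective function `f x = 𝔼[F(x, ξ_x)]`. -/
def objective (S : SimModel d N) (x : Grid d N) : ℝ := ∫ y, S.F x y ∂(S.law x)

/-- The centred output `F(x, ξ_x) - f x` is sub-Gaussian with parameter `σ²` for every `x`. -/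
def IsSubGaussian (S : SimModel d N) (σ : ℝ≥0) : Prop :=
  ∀ x, HasSubgaussianMGF (fun y => S.F x y - S.objective x) (σ ^ 2) (S.law x)

/-- The objective function has `ℓ_∞`-Lipschitz constant `L`. -/
def IsLipschitz (S : SimModel d N) (L : ℝ) : Prop :=
  ∀ x y : Grid d N, (∀ i, |(x i : ℤ) - (y i : ℤ)| ≤ 1) → |S.objective x - S.objective y| ≤ L

/-- `x` is the optimal system, and its objective value is smaller than that of any other system
by at least the indifference zone parameter `c` (so `x` is the unique minimizer if `c > 0`). -/
def IsOptimalWithGap (S : SimModel d N) (c : ℝ) (x : Grid d N) : Prop :=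
  ∀ y, y ≠ x → S.objective x + c ≤ S.objective y

/-- The sample space: one independent copy of `ξ_x` for every time step and every system `x`. -/
abbrev Sample (S : SimModel d N) : Type _ := ℕ × Grid d N → S.Y

/-- The joint law of the independent copies of all the `ξ_x`. -/
def prob (S : SimModel d N) : Measure S.Sample :=
  Measure.infinitePi fun p : ℕ × Grid d N => S.law p.2

/-- The outcome of the `n`-th simulation (counted from `0`), if system `x` is simulated then. -/
def outcome (S : SimModel d N) (ω : S.Sample) (n : ℕ) (x : Grid d N) : ℝ := S.F x (ω (n, x))

end SimModel

/-- The class `MC_c` of models with an `L♮`-convex objective function on `[N]^d` and indifference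
zone parameter `c`, whose outputs are sub-Gaussian with parameter `σ²` and whose objective
function has `ℓ_∞`-Lipschitz constant `L`. -/
def modelClass (d N : ℕ) (σ : ℝ≥0) (L c : ℝ) : Set (SimModel d N) :=
  {S | LNaturalConvex S.objective ∧ S.IsSubGaussian σ ∧ S.IsLipschitz L ∧
    ∃ x, S.IsOptimalWithGap c x}

/-! ### Simulation algorithms and their cost -/

/-- A simulation algorithm over the systems `X`. A history of length `n` lists the systems
simulated so far with the observed values. -/
structure SimAlgorithm (X : Type) where
  /-- stopping rule -/
  halted : (n : ℕ) → (Fin n → X × ℝ) → Prop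
  /-- sampling rule: the system to simulate next -/
  sample : (n : ℕ) → (Fin n → X × ℝ) → X
  /-- recommendation rule: the system returned on stopping -/
  recommend : (n : ℕ) → (Fin n → X × ℝ) → X

namespace SimAlgorithm

variable {X : Type}

/-- The three rules are measurable functions of the history. -/
def IsMeasurable [MeasurableSpace X] (A : SimAlgorithm X) : Prop :=
  ∀ n, MeasurableSet {h | A.halted n h} ∧ Measurable (A.sample n) ∧ Measurable (A.recommend n)

/-- The first `n` simulations (regardless of stopping), where `obs k x` is the value observed if
the `k`-th simulation is at `x`. -/
def history (A : SimAlgorithm X) (obs : ℕ → X → ℝ) : (n : ℕ) → Fin n → X × ℝ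
  | 0 => Fin.elim0
  | n + 1 =>
    Fin.snoc (α := fun _ => X × ℝ) (A.history obs n)
      (A.sample n (A.history obs n), obs n (A.sample n (A.history obs n)))

/-- The stopping time `τ`, which is the number of simulations; it is `⊤` if the algorithm never
stops. -/
def cost (A : SimAlgorithm X) (obs : ℕ → X → ℝ) : ℕ∞ :=
  ⨅ (n : ℕ) (_ : A.halted n (A.history obs n)), (n : ℕ∞)

/-- The system returned at the stopping time (meaningful if the algorithm stops). -/
def output (A : SimAlgorithm X) (obs : ℕ → X → ℝ) : X :=
  A.recommend (A.cost obs).toNat (A.history obs (A.cost obs).toNat)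

end SimAlgorithm

/-- The `(c, δ)`-PCS-IZ guarantee of an algorithm on a model with indifference zone parameter `c`:
it stops almost surely, and with probability at least `1 - δ` it returns the optimal system. -/
def IsPCSIZ {d N : ℕ} (c δ : ℝ) (A : SimAlgorithm (Grid d N)) (S : SimModel d N) : Prop :=
  (∀ᵐ ω ∂S.prob, A.cost (S.outcome ω) < ⊤) ∧
    ENNReal.ofReal (1 - δ) ≤
      S.prob {ω | A.cost (S.outcome ω) < ⊤ ∧ S.IsOptimalWithGap c (A.output (S.outcome ω))}

/-- `A` is an algorithm with the `(c, δ)`-PCS-IZ guarantee on every model of the class. -/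
def IsPCSIZAlgorithm {d N : ℕ} (c δ : ℝ) (𝓜 : Set (SimModel d N))
    (A : SimAlgorithm (Grid d N)) : Prop :=
  A.IsMeasurable ∧ ∀ S ∈ 𝓜, IsPCSIZ c δ A S

/-- The expected simulation cost `T(δ, MC_c)`: the infimum over all the algorithms with the
`(c, δ)`-PCS-IZ guarantee of the worst expected number of simulations. -/
def expectedSimulationCost {d N : ℕ} (c δ : ℝ) (𝓜 : Set (SimModel d N)) : ℝ≥0∞ :=
  ⨅ (A : SimAlgorithm (Grid d N)) (_ : IsPCSIZAlgorithm c δ 𝓜 A),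
    ⨆ (S : SimModel d N) (_ : S ∈ 𝓜), ∫⁻ ω, (A.cost (S.outcome ω) : ℝ≥0∞) ∂S.prob

/-! ### A notation for writing algorithms -/

/-- A sequential simulation procedure with result in `α`: either it ends with a result, or it
simulates one system `x` and goes on depending on the observed value. -/
inductive SimProgram (X α : Type) : Type
  | ret (a : α) : SimProgram X α
  | query (x : X) (k : ℝ → SimProgram X α) : SimProgram X α

namespace SimProgram

variable {X α β : Type}

/-- Run `p`, then continue with its result. -/
def bind : SimProgram X α → (α → SimProgram X β) → SimProgram X β
  | ret a, g => g a
  | query x k, g => query x fun r => (k r).bind g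

/-- Simulate each of the systems `x 0, …, x (n - 1)` once and collect the observed values. -/
def collect : (n : ℕ) → (Fin n → X) → SimProgram X (Fin n → ℝ)
  | 0, _ => ret Fin.elim0
  | n + 1, x => query (x 0) fun r => (collect n (Fin.tail x)).bind fun v =>
      ret (Fin.cons (α := fun _ => ℝ) r v)

/-- Simulate each of the systems `x 0, …, x (m - 1)` in `n` independent replications and collect
the sums of the observed values. -/
def collectSums {m : ℕ} (x : Fin m → X) : (n : ℕ) → SimProgram X (Fin m → ℝ)
  | 0 => ret 0
  | n + 1 => (collect m x).bind fun v => (collectSums x n).bind fun s => ret (v + s)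

/-- One step of the procedure, when the value `r` is observed. -/
def step : SimProgram X α → ℝ → SimProgram X α
  | ret a, _ => ret a
  | query _ k, r => k r

/-- What is left of the procedure after the observations of a history. -/
def after (p : SimProgram X α) : (n : ℕ) → (Fin n → X × ℝ) → SimProgram X α
  | 0, _ => p
  | n + 1, h => (p.after n (Fin.init h)).step (h (Fin.last n)).2

/-- The procedure has ended. -/
def IsDone : SimProgram X α → Prop
  | ret _ => True
  | query _ _ => False

/-- The next system to simulate (`x₀` if the procedure has ended). -/
def next (x₀ : X) : SimProgram X α → X
  | ret _ => x₀
  | query x _ => x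

/-- The result (`a₀` if the procedure has not ended). -/
def result (a₀ : α) : SimProgram X α → α
  | ret a => a
  | query _ _ => a₀

/-- The simulation algorithm that carries out a procedure with results in `X`. The default `x₀`
is never simulated before the end or returned at the end. -/
def toAlgorithm (x₀ : X) (p : SimProgram X X) : SimAlgorithm X where
  halted n h := (p.after n h).IsDone
  sample n h := (p.after n h).next x₀
  recommend n h := (p.after n h).result x₀

end SimProgram

/-! ### Stochastic subgradients -/

section Subgradient

variable {d N : ℕ}

/-- The lower corner `y ∈ [N-1]^d` of a cube `y + [0,1]^d` that contains `x ∈ [1,N]^d`. -/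
def cubeCorner (N : ℕ) (x : Fin d → ℝ) (i : Fin d) : ℤ := max 1 (min ⌊x i⌋ ((N : ℤ) - 1))

/-- A consistent permutation of `x - y`, where `y` is the lower corner of the cube of `x`: the
coordinates of `x - y` are listed in decreasing order. -/
def consistentPerm (N : ℕ) (x : Fin d → ℝ) : Equiv.Perm (Fin d) :=
  Tuple.sort fun i => -(x i - (cubeCorner N x i : ℝ))

/-- The `k`-th neighbouring point `S^{x,k} = y + e_{α(1)} + … + e_{α(k)}`, for `0 ≤ k ≤ d`. -/
def neighbor (hN : 2 ≤ N) (x : Fin d → ℝ) (k : ℕ) : Grid d N := fun i =>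
  ⟨cubeCorner N x i + if ((consistentPerm N x).symm i : ℕ) < k then 1 else 0, by
    simp only [cubeCorner, Set.mem_Icc]
    split_ifs <;> omega⟩

/-- The stochastic subgradient at `x`: `ĝ_{α(i)} = F(S^{x,i}, ξ¹_i) - F(S^{x,i-1}, ξ²_{i-1})`, from
`2d` independent simulations. -/
def stochSubgradient (hN : 2 ≤ N) (x : Fin d → ℝ) : SimProgram (Grid d N) (Fin d → ℝ) :=
  (SimProgram.collect d fun i : Fin d => neighbor hN x (i + 1)).bind fun a =>
  (SimProgram.collect d fun i : Fin d => neighbor hN x i).bind fun b =>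
  .ret fun j => a ((consistentPerm N x).symm j) - b ((consistentPerm N x).symm j)

end Subgradient

/-! ### The adaptive stochastic subgradient method -/

section Algorithm

variable {d N : ℕ}

/-- The componentwise truncation `𝒯_M(g) = (g ∧ M𝟏) ∨ (-M𝟏)`. -/
def truncate (M : ℝ) (g : Fin d → ℝ) : Fin d → ℝ := fun i => max (min (g i) M) (-M)

/-- The orthogonal projection of `y` onto the box with corners `lo ≤ hi`. -/
def projBox (lo hi y : Fin d → ℝ) : Fin d → ℝ := fun i => max (min (y i) (hi i)) (lo i)

/-- `T` projected and truncated stochastic subgradient steps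
`x^{t+1} = 𝒫(x^t - η 𝒯_M(ĝ^t))` from `x`; the result is `s + x^0 + … + x^{T-1}`. -/
def ssgdLoop (hN : 2 ≤ N) (lo hi : Fin d → ℝ) (M η : ℝ) :
    (T : ℕ) → (x s : Fin d → ℝ) → SimProgram (Grid d N) (Fin d → ℝ)
  | 0, _, s => .ret s
  | T + 1, x, s => (stochSubgradient hN x).bind fun g =>
      ssgdLoop hN lo hi M η T (projBox lo hi (x - η • truncate M g)) (s + x)

/-- The projected and truncated stochastic subgradient method on the box with corners `lo ≤ hi`,
started at `x`; the result is the average of the `T` iterates. -/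
def ssgd (hN : 2 ≤ N) (lo hi : Fin d → ℝ) (T : ℕ) (M η : ℝ) (x : Fin d → ℝ) :
    SimProgram (Grid d N) (Fin d → ℝ) :=
  (ssgdLoop hN lo hi M η T x 0).bind fun s => .ret ((T : ℝ)⁻¹ • s)

/-- The side length `2^{-e} N` of the search box of epoch `e` (before it is cut off by
`[1,N]^d`). -/
def boxWidth (N e : ℕ) : ℝ := N / 2 ^ e

/-- The precision `ε_e = 2^{-e} c N / 4` of epoch `e`. -/
def epochPrecision (c : ℝ) (N e : ℕ) : ℝ := c * N / 4 / 2 ^ e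

/-- The number of epochs `E = ⌈log₂ N⌉ + 1`. -/
def numEpochs (N : ℕ) : ℕ := Nat.clog 2 N + 1

/-- The step size `η = W / (M √T)` of `T` steps with truncation level `M` in a search box of side
length `W`. -/
def stepSize (W M : ℝ) (T : ℕ) : ℝ := W / (M * √T)

/-- The result `x_e` of epoch `e`, with `T e` iterations and truncation level `M e` in epoch `e`.
The search box is `[1,N]^d` in epoch `0` and
`𝒩(x_e, 2^{-e-2} N) = {y ∈ [1,N]^d : ‖y - x_e‖_∞ ≤ 2^{-e-2} N}` in epoch `e + 1`; every epoch starts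
at the centre, `(N/2, …, N/2)` in epoch `0` and `x_e` in epoch `e + 1`. -/
def epochResult (hN : 2 ≤ N) (T : ℕ → ℕ) (M : ℕ → ℝ) :
    ℕ → SimProgram (Grid d N) (Fin d → ℝ)
  | 0 => ssgd hN (fun _ => 1) (fun _ => N) (T 0) (M 0) (stepSize (boxWidth N 0) (M 0) (T 0))
      (fun _ => N / 2)
  | e + 1 => (epochResult hN T M e).bind fun x =>
      ssgd hN (fun i => max 1 (x i - N / 2 ^ (e + 2))) (fun i => min N (x i + N / 2 ^ (e + 2)))
        (T (e + 1)) (M (e + 1)) (stepSize (boxWidth N (e + 1)) (M (e + 1)) (T (e + 1))) x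

/-- The least index at which `v` is minimal. -/
def argminIndex {m : ℕ} (v : Fin (m + 1) → ℝ) : Fin (m + 1) :=
  (Finset.univ.filter fun i => ∀ j, v i ≤ v j).min' <| by
    obtain ⟨i, hi⟩ := Finite.exists_min v
    exact ⟨i, by simpa using hi⟩

/-- The number of replications at each of the `d + 1` neighbouring points in the rounding process:
by Hoeffding's bound, the confidence intervals of half-width `ε / 4` around the `d + 1` empirical
means hold simultaneously with probability at least `1 - δ / 4`. -/
def roundingReplications (σ : ℝ) (d : ℕ) (ε δ : ℝ) : ℕ :=
  ⌈32 * σ ^ 2 / ε ^ 2 * Real.log (8 * (d + 1) / δ)⌉₊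

/-- The rounding process: simulate the `d + 1` neighbouring points of `x` and return the one with
minimal empirical mean. -/
def roundPoint (hN : 2 ≤ N) (σ ε δ : ℝ) (x : Fin d → ℝ) : SimProgram (Grid d N) (Grid d N) :=
  (SimProgram.collectSums (fun k : Fin (d + 1) => neighbor hN x k)
      (roundingReplications σ d ε δ)).bind fun s =>
  .ret (neighbor hN x (argminIndex fun k => s k / roundingReplications σ d ε δ))

/-- The adaptive stochastic subgradient method for the `(c, δ)`-PCS-IZ guarantee: the epochs
`0, …, E - 1`, then rounding of `x_{E-1}` to precision `c / 2`. -/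
def adaptiveSSGD (hN : 2 ≤ N) (σ c δ : ℝ) (T : ℕ → ℕ) (M : ℕ → ℝ) : SimAlgorithm (Grid d N) :=
  SimProgram.toAlgorithm (neighbor hN (fun _ => 1) 0) <|
    (epochResult hN T M (numEpochs N - 1)).bind fun x => roundPoint hN σ (c / 2) δ x

end Algorithm

/-! ### The cost bounds -/

/-- `d² log N / c² · log (1/δ)`. -/
def leadingCost (d N : ℕ) (c δ : ℝ) : ℝ := d ^ 2 * Real.log N / c ^ 2 * Real.log (1 / δ)

/-- `d² log N / c² · log (1/δ) + d³ log N / c² · log (d² N / c³) + d³ log N L² / c²`. -/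
def fullCost (d N : ℕ) (L c δ : ℝ) : ℝ :=
  leadingCost d N c δ + d ^ 3 * Real.log N / c ^ 2 * Real.log (d ^ 2 * N / c ^ 3) +
    d ^ 3 * Real.log N * L ^ 2 / c ^ 2

/-- The scale `d W² / ε² · log (1/δ)` of the number of iterations in a search box of side length
`W`, for precision `ε` and failing probability `δ`. -/
def iterationScale (d : ℕ) (W ε δ : ℝ) : ℝ := d * W ^ 2 / ε ^ 2 * Real.log (1 / δ)

/-- The scale `√(log (d W T / ε))` of the truncation level for `T` iterations in a search box of
side length `W`, for precision `ε`. -/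
def truncationScale (d : ℕ) (W ε : ℝ) (T : ℕ) : ℝ := √(Real.log (d * W * T / ε))

end

/-! ### Discrete convex analysis on the grid -/

section DiscreteConvexity

variable {d N : ℕ}

/-! The engine is sharpness. Averaging a point with the minimizer `a` and applying midpoint
convexity repeatedly shows that `f` grows at rate `c` in the `ℓ_∞` distance from `a`
(`LNaturalConvex.sharp`). This growth passes to the piecewise linear extension of `f`, whose
subgradient `g` at `x` is made of the increments of `f` along the chain of neighbours of `x`. Hence
`c ‖x - a‖ ≤ ⟨g, x - a⟩` (`LNaturalConvex.sharp_subgradient`), and a regret bound for the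
subgradient steps directly bounds `c` times the distance of the averaged iterate from `a`.

In a box of side `W`, the regret per step is of order `d M W / √T`. The noise of `⟨ĝ, x - a⟩` has
variance proxy of order `σ² d W²`, with `d` and not `d²`, because the coordinates of `ĝ` use
disjoint independent simulations. The target is accuracy `W / 4`, so `W` cancels: it suffices that
`T` is of order `(d / c²) log (1/δ_e)` plus `d² M² / c²`. One `T` thus serves every epoch, each
epoch halves the box, about `log₂ N` epochs bring the iterate within `1/4` of `a`, and each step
costs `2d` simulations. At distance `1/4` the minimizer is one of the `d + 1` neighbours
(`exists_neighbor_eq`), and a Chernoff bound for the empirical means finds it.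

The probabilistic bound is an exponential supermartingale (`expect_ssgdLoop_le`), evaluated program
by program through `SimProgram.expect`, an iterated integral identified with the product law by
`SimProgram.IsUniform.lintegral_run`. Truncation preserves sub-Gaussianity up to a constant, by
symmetrization (`integral_exp_contraction_le`), and its bias is made smaller than `c / (16 d)`.

`T` must dominate `d² M² / c²` while `M` contains `√(log (4dT/c))`; this circularity is resolved by
bounding the logarithm by a small multiple of `T` plus a constant
(`truncation_le_sqrt_iterationNumber`). The number of simulations is deterministic, so the almost
sure bounds and the bounds on the expected cost are one numerical estimate. The bound with `log (d²
N / c³)` also uses `c ≤ L`, valid in a nonempty class, to keep the bracket from degenerating for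
large `c`. -/

theorem ceil_half_eq (a b : ℤ) : ⌈((a : ℝ) + (b : ℝ)) / 2⌉ = (a + b + 1) / 2 := by
  rw [Int.ceil_eq_iff]
  have h1 : (a + b + 1) / 2 * 2 ≤ a + b + 1 := by omega
  have h2 : a + b ≤ (a + b + 1) / 2 * 2 := by omega
  have h1' : (((a + b + 1) / 2 : ℤ) : ℝ) * 2 ≤ a + b + 1 := by exact_mod_cast h1
  have h2' : (a : ℝ) + b ≤ (((a + b + 1) / 2 : ℤ) : ℝ) * 2 := by exact_mod_cast h2
  have h3 : (a + b + 1) / 2 * 2 < a + b + 2 := by omega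
  have h3' : (((a + b + 1) / 2 : ℤ) : ℝ) * 2 < a + b + 2 := by exact_mod_cast h3
  constructor <;> linarith

theorem floor_half_eq (a b : ℤ) : ⌊((a : ℝ) + (b : ℝ)) / 2⌋ = (a + b) / 2 := by
  rw [Int.floor_eq_iff]
  have h1 : (a + b) / 2 * 2 ≤ a + b := by omega
  have h1' : (((a + b) / 2 : ℤ) : ℝ) * 2 ≤ a + b := by exact_mod_cast h1
  have h3 : a + b < (a + b) / 2 * 2 + 2 := by omega
  have h3' : (a : ℝ) + b < (((a + b) / 2 : ℤ) : ℝ) * 2 + 2 := by exact_mod_cast h3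
  constructor <;> linarith

/-- The rounded-up midpoint of two grid points. -/
def midUp (x y : Grid d N) : Grid d N := fun i =>
  ⟨((x i : ℤ) + (y i : ℤ) + 1) / 2, by
    have h1 := (x i).2; have h2 := (y i).2
    simp only [Set.mem_Icc] at h1 h2 ⊢
    omega⟩

/-- The rounded-down midpoint of two grid points. -/
def midDown (x y : Grid d N) : Grid d N := fun i =>
  ⟨((x i : ℤ) + (y i : ℤ)) / 2, by
    have h1 := (x i).2; have h2 := (y i).2
    simp only [Set.mem_Icc] at h1 h2 ⊢
    omega⟩

theorem LNaturalConvex.midpoint {f : Grid d N → ℝ} (hf : LNaturalConvex f) (x y : Grid d N) :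
    f (midUp x y) + f (midDown x y) ≤ f x + f y :=
  hf x y _ _ (fun i => by rw [ceil_half_eq]; rfl) (fun i => by rw [floor_half_eq]; rfl)

/-- An `L♮`-convex function with indifference zone parameter `c` grows at rate at least `c` in the
`ℓ_∞` distance from its minimizer. -/
theorem LNaturalConvex.sharp {f : Grid d N → ℝ} (hf : LNaturalConvex f) {c : ℝ} (hc : 0 < c)
    {a : Grid d N} (ha : ∀ y, y ≠ a → f a + c ≤ f y) (z : Grid d N) (j : Fin d) :
    f a + c * |((z j : ℤ) : ℝ) - ((a j : ℤ) : ℝ)| ≤ f z := by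
  have key : ∀ n : ℕ, ∀ z : Grid d N, (∀ i, |(z i : ℤ) - (a i : ℤ)| ≤ n) → ∀ j,
      f a + c * ((|(z j : ℤ) - (a j : ℤ)| : ℤ) : ℝ) ≤ f z := by
    intro n
    induction n with
    | zero =>
      intro z hz j
      have : z = a := by
        funext i
        apply Subtype.ext
        have := hz i
        rw [abs_le] at this
        push_cast at this
        omega
      simp [this]
    | succ n ih =>
      intro z hz j
      -- At distance one the two midpoints are again at distance up to one, so halving gains nothing
      -- and the gap hypothesis itself is used. From distance two on both midpoints are strictly
      -- closer, and their rounding errors cancel: their distances to `a` in coordinate `j` add up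
      -- to that of `z`.
      rcases Nat.eq_zero_or_pos n with rfl | hn
      · by_cases hza : z = a
        · simp [hza]
        · have h1 := ha z hza
          have h2 : ((|(z j : ℤ) - (a j : ℤ)| : ℤ) : ℝ) ≤ 1 := by exact_mod_cast hz j
          nlinarith
      · have hu := ih (midUp z a) (fun i => by
          have := hz i
          rw [abs_le] at this ⊢
          simp only [midUp]
          push_cast at this ⊢
          omega) j
        have hv := ih (midDown z a) (fun i => by
          have := hz i
          rw [abs_le] at this ⊢
          simp only [midDown]
          push_cast at this ⊢
          omega) j
        have hm := hf.midpoint z a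
        have hs : |(z j : ℤ) - (a j : ℤ)| =
            |((midUp z a) j : ℤ) - (a j : ℤ)| + |((midDown z a) j : ℤ) - (a j : ℤ)| := by
          simp only [midUp, midDown]
          rcases le_total (a j : ℤ) (z j : ℤ) with h | h
          · rw [abs_of_nonneg (by omega), abs_of_nonneg (by omega), abs_of_nonneg (by omega)]
            omega
          · rw [abs_of_nonpos (by omega), abs_of_nonpos (by omega), abs_of_nonpos (by omega)]
            omega
        rw [hs]
        push_cast at hu hv ⊢
        linarith
  have := key N z (fun i => by
    have h1 := (z i).2; have h2 := (a i).2
    simp only [Set.mem_Icc] at h1 h2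
    rw [abs_le]; omega) j
  simpa using this

/-- An `L♮`-convex function that is constant along a maximal chain of a cube is minimal there. -/
theorem LNaturalConvex.chain_le {h : Grid d N → ℝ} (hh : LNaturalConvex h) {m : ℝ}
    (π : Equiv.Perm (Fin d)) (s : ℕ → Grid d N) (y : Fin d → ℤ)
    (hs : ∀ k i, (s k i : ℤ) = y i + if (π.symm i : ℕ) < k then 1 else 0)
    (hm : ∀ k ≤ d, h (s k) = m) (z : Grid d N) : m ≤ h z := by
  have hs0 : ∀ i, (s 0 i : ℤ) = y i := fun i => by rw [hs]; simp
  have hsd : ∀ i, (s d i : ℤ) = y i + 1 := fun i => by rw [hs]; simp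
  -- For vertices of the cube the two rounded midpoints are join and meet. If `z` is raised at `π
  -- n`, its join with `s n` is `s (n + 1)`, where `h = m`, and its meet with `s n` is covered by
  -- induction.
  have cube : ∀ n ≤ d, ∀ z : Grid d N, (∀ i, (z i : ℤ) = y i ∨ (z i : ℤ) = y i + 1) →
      (∀ i, (z i : ℤ) = y i + 1 → (π.symm i : ℕ) < n) → m ≤ h z := by
    intro n
    induction n with
    | zero =>
      intro _ z hz hz'
      have : z = s 0 := by
        funext i
        apply Subtype.ext
        rw [hs0]
        rcases hz i with h | h
        · exact h
        · exact absurd (hz' i h) (by simp)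
      rw [this, hm 0 (by omega)]
    | succ n ih =>
      intro hn z hz hz'
      by_cases hzn : (z (π ⟨n, hn⟩) : ℤ) = y (π ⟨n, hn⟩)
      · refine ih (by omega) z hz fun i hi => ?_
        have h1 := hz' i hi
        have h2 : (π.symm i : ℕ) ≠ n := by
          intro h
          have : i = π ⟨n, hn⟩ := by
            rw [← Equiv.symm_apply_eq]; exact Fin.ext h
          rw [← this] at hzn
          omega
        omega
      · have hmid := hh.midpoint z (s n)
        have hup : midUp z (s n) = s (n + 1) := by
          funext i
          apply Subtype.ext
          simp only [midUp]
          rw [hs, hs]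
          by_cases hin : i = π ⟨n, hn⟩
          · have h1 : (π.symm i : ℕ) = n := by rw [hin]; simp
            have h2 := hz i
            rw [← hin] at hzn
            rw [h1, if_neg (by omega), if_pos (by omega)]
            omega
          · have h1 : (π.symm i : ℕ) ≠ n := by
              intro h
              exact hin (by rw [← Equiv.symm_apply_eq]; exact Fin.ext h)
            have h2 := hz i
            have h3 := hz' i
            split_ifs <;> omega
        have hdown := ih (by omega) (midDown z (s n)) (fun i => by
          simp only [midDown]
          rw [hs]
          have h2 := hz i
          split_ifs <;> omega) (fun i => by
          simp only [midDown]
          rw [hs]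
          have h2 := hz i
          split_ifs <;> omega)
        rw [hup, hm _ hn, hm n (by omega)] at hmid
        linarith
  have hcube : ∀ z : Grid d N, (∀ i, (z i : ℤ) = y i ∨ (z i : ℤ) = y i + 1) → m ≤ h z :=
    fun z hz => cube d le_rfl z hz fun i _ => (π.symm i).2
  -- The opposite cube `y - {0,1}^d`: paired with the top `s d`, such a point has lower midpoint `s
  -- 0` and upper midpoint in the original cube.
  have hneg : ∀ z : Grid d N, (∀ i, (z i : ℤ) = y i ∨ (z i : ℤ) = y i - 1) → m ≤ h z := by
    intro z hz
    have hmid := hh.midpoint z (s d)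
    have h1 : midDown z (s d) = s 0 := by
      funext i
      apply Subtype.ext
      simp only [midDown]
      have := hz i
      rw [hsd, hs0]; omega
    have h2 := hcube (midUp z (s d)) (fun i => by
      simp only [midUp]
      have := hz i
      rw [hsd]; omega)
    rw [h1, hm 0 (by omega), hm d le_rfl] at hmid
    linarith
  -- From local to global: midpoints with the corner `s 0` land in the two cubes when `z` is within
  -- distance one of `y`, and otherwise come strictly closer to `y`.
  have hnear : ∀ n : ℕ, ∀ z : Grid d N, (∀ i, |(z i : ℤ) - y i| ≤ n + 1) → m ≤ h z := by
    intro n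
    induction n with
    | zero =>
      intro z hz
      have hz' : ∀ i, y i - 1 ≤ (z i : ℤ) ∧ (z i : ℤ) ≤ y i + 1 := fun i => by
        have := hz i; rw [abs_le] at this; push_cast at this; omega
      have hmid := hh.midpoint z (s 0)
      have h1 := hcube (midUp z (s 0)) (fun i => by
        simp only [midUp]
        have := hz' i
        rw [hs0]; omega)
      have h2 := hneg (midDown z (s 0)) (fun i => by
        simp only [midDown]
        have := hz' i
        rw [hs0]; omega)
      rw [hm 0 (by omega)] at hmid
      linarith
    | succ n ih =>
      intro z hz
      have hz' : ∀ i, y i - (n + 2) ≤ (z i : ℤ) ∧ (z i : ℤ) ≤ y i + (n + 2) := fun i => by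
        have := hz i; rw [abs_le] at this; push_cast at this; omega
      have hmid := hh.midpoint z (s 0)
      have h1 := ih (midUp z (s 0)) (fun i => by
        simp only [midUp]
        have := hz' i
        rw [hs0, abs_le]; omega)
      have h2 := ih (midDown z (s 0)) (fun i => by
        simp only [midDown]
        have := hz' i
        rw [hs0, abs_le]; omega)
      rw [hm 0 (by omega)] at hmid
      linarith
  refine hnear N z fun i => ?_
  have h1 := (z i).2; have h2 := (s 0 i).2
  rw [hs0] at h2
  simp only [Set.mem_Icc] at h1 h2
  rw [abs_le]; omega

/-- Summation by parts: a nonnegative sequence interpolated with decreasing weights in `[0,1]`. -/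
theorem interpolate_nonneg {H ρ : ℕ → ℝ} (hH : ∀ k, 0 ≤ H k) (hρ1 : ρ 0 ≤ 1)
    (hρ0 : ∀ k, 0 ≤ ρ k) (hρ : ∀ k, ρ (k + 1) ≤ ρ k) (n : ℕ) :
    0 ≤ H 0 + ∑ k ∈ Finset.range n, (H (k + 1) - H k) * ρ k := by
  -- The induction needs this stronger invariant, the boundary term of Abel summation.
  have : ρ n * H n ≤ H 0 + ∑ k ∈ Finset.range n, (H (k + 1) - H k) * ρ k := by
    induction n with
    | zero => simp; nlinarith [hH 0]
    | succ n ih =>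
      rw [Finset.sum_range_succ]
      nlinarith [hH (n + 1), hρ n]
  exact (mul_nonneg (hρ0 n) (hH n)).trans this

/-! ### The subgradient of the convex extension -/

/-- The subgradient at `x` of the convex extension of `f`. -/
noncomputable def subgradient (hN : 2 ≤ N) (f : Grid d N → ℝ) (x : Fin d → ℝ) (j : Fin d) : ℝ :=
  f (neighbor hN x (((consistentPerm N x).symm j : ℕ) + 1)) -
    f (neighbor hN x ((consistentPerm N x).symm j))

theorem neighbor_apply (hN : 2 ≤ N) (x : Fin d → ℝ) (k : ℕ) (i : Fin d) :
    (neighbor hN x k i : ℤ) =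
      cubeCorner N x i + if ((consistentPerm N x).symm i : ℕ) < k then 1 else 0 := rfl

theorem cubeCorner_le {x : Fin d → ℝ} {i : Fin d} (hx : 1 ≤ x i) :
    (cubeCorner N x i : ℝ) ≤ x i := by
  have h : cubeCorner N x i ≤ ⌊x i⌋ := by
    have : 1 ≤ ⌊x i⌋ := Int.le_floor.2 (by simpa using hx)
    simp only [cubeCorner]; omega
  exact (Int.cast_le.2 h).trans (Int.floor_le _)

theorem le_cubeCorner_add_one {x : Fin d → ℝ} {i : Fin d} (hx : x i ≤ N) :
    x i ≤ cubeCorner N x i + 1 := by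
  have h : ⌊x i⌋ ≤ cubeCorner N x i ∨ (N : ℤ) - 1 ≤ cubeCorner N x i := by
    simp only [cubeCorner]; omega
  rcases h with h | h
  · have := (Int.cast_le (R := ℝ)).2 h
    linarith [Int.lt_floor_add_one (x i)]
  · have := (Int.cast_le (R := ℝ)).2 h
    push_cast at this
    linarith

theorem consistentPerm_antitone (x : Fin d → ℝ) {k l : Fin d} (h : k ≤ l) :
    x (consistentPerm N x l) - cubeCorner N x (consistentPerm N x l) ≤
      x (consistentPerm N x k) - cubeCorner N x (consistentPerm N x k) := by
  have := Tuple.monotone_sort (fun i => -(x i - (cubeCorner N x i : ℝ))) h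
  simp only [Function.comp] at this
  simpa [consistentPerm] using neg_le_neg this

theorem neighbor_sub (hN : 2 ≤ N) (x : Fin d → ℝ) (k j : Fin d) :
    ((neighbor hN x (k + 1) j : ℤ) : ℝ) - ((neighbor hN x k j : ℤ) : ℝ) =
      if (consistentPerm N x) k = j then 1 else 0 := by
  rw [neighbor_apply, neighbor_apply]
  have : (consistentPerm N x) k = j ↔ (((consistentPerm N x).symm j : Fin d) : ℕ) = k := by
    rw [← Equiv.eq_symm_apply, Fin.ext_iff, eq_comm]
  simp only [this]
  split_ifs <;> first | omega | simp

/-- Subtracting the linear function with slope `g` preserves `L♮`-convexity, since the two rounded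
midpoints have the same sum as the two points. It also makes the function constant along the chain
of neighbours of `x`, so `LNaturalConvex.chain_le` makes that constant its global minimum. -/
theorem LNaturalConvex.subgradient_le {f : Grid d N → ℝ} (hf : LNaturalConvex f) (hN : 2 ≤ N)
    (x : Fin d → ℝ) (z : Grid d N) :
    ∑ j, subgradient hN f x j * (((z j : ℤ) : ℝ) - cubeCorner N x j) ≤
      f z - f (neighbor hN x 0) := by
  set g := subgradient hN f x with hg
  set h : Grid d N → ℝ := fun z => f z - ∑ j, g j * ((z j : ℤ) : ℝ) with hh
  have hconv : LNaturalConvex h := by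
    intro a b u v hu hv
    have h1 := hf a b u v hu hv
    have h2 : ∀ j, ((u j : ℤ) : ℝ) + ((v j : ℤ) : ℝ) = ((a j : ℤ) : ℝ) + ((b j : ℤ) : ℝ) := by
      intro j
      have := hu j; have h' := hv j
      rw [ceil_half_eq] at this
      rw [floor_half_eq] at h'
      exact_mod_cast (show (u j : ℤ) + (v j : ℤ) = (a j : ℤ) + (b j : ℤ) by omega)
    have h3 : ∑ j, g j * ((u j : ℤ) : ℝ) + ∑ j, g j * ((v j : ℤ) : ℝ) =
        ∑ j, g j * ((a j : ℤ) : ℝ) + ∑ j, g j * ((b j : ℤ) : ℝ) := by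
      rw [← Finset.sum_add_distrib, ← Finset.sum_add_distrib]
      refine Finset.sum_congr rfl fun j _ => ?_
      rw [← mul_add, ← mul_add, h2]
    simp only [hh]; linarith
  have hconst : ∀ k ≤ d, h (neighbor hN x k) = h (neighbor hN x 0) := by
    intro k
    induction k with
    | zero => intro _; rfl
    | succ k ih =>
      intro hk
      rw [← ih (by omega)]
      have h1 : ∑ j, g j * ((neighbor hN x (k + 1) j : ℤ) : ℝ) -
          ∑ j, g j * ((neighbor hN x k j : ℤ) : ℝ) = g (consistentPerm N x ⟨k, hk⟩) := by
        rw [← Finset.sum_sub_distrib]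
        simp_rw [← mul_sub]
        have := fun j => neighbor_sub hN x ⟨k, hk⟩ j
        simp only at this
        simp_rw [this]
        simp
      have h2 : g (consistentPerm N x ⟨k, hk⟩) = f (neighbor hN x (k + 1)) - f (neighbor hN x k) := by
        simp [hg, subgradient]
      simp only [hh]; linarith
  have := hconv.chain_le (consistentPerm N x) (neighbor hN x) (cubeCorner N x)
    (neighbor_apply hN x) hconst z
  simp only [hh] at this
  have h0 : ∀ j, ((neighbor hN x 0 j : ℤ) : ℝ) = cubeCorner N x j := fun j => by
    rw [neighbor_apply]; simp
  simp_rw [h0] at this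
  simp_rw [mul_sub, Finset.sum_sub_distrib]
  linarith

/-- The subgradient inequality at the minimizer, combined with sharpness. -/
theorem LNaturalConvex.sharp_subgradient {f : Grid d N → ℝ} (hf : LNaturalConvex f) (hN : 2 ≤ N)
    {c : ℝ} (hc : 0 < c) {a : Grid d N} (ha : ∀ y, y ≠ a → f a + c ≤ f y)
    {x : Fin d → ℝ} (hx : ∀ i, 1 ≤ x i) (hx' : ∀ i, x i ≤ N) (j : Fin d) :
    c * |x j - ((a j : ℤ) : ℝ)| ≤ ∑ i, subgradient hN f x i * (x i - ((a i : ℤ) : ℝ)) := by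
  have hsub := hf.subgradient_le hN x a
  have hd : 0 < d := j.pos
  set π := consistentPerm N x with hπ
  set r : Fin d → ℝ := fun i => x i - cubeCorner N x i with hr
  -- The fractional parts of `x` in decreasing order, continued by `0` so that the weights are
  -- nonnegative and decreasing on all of `ℕ`.
  set ρ : ℕ → ℝ := fun k => if h : k < d then r (π ⟨k, h⟩) else 0 with hρ
  have hr0 : ∀ i, 0 ≤ r i := fun i => sub_nonneg.2 (cubeCorner_le (hx i))
  have hr1 : ∀ i, r i ≤ 1 := fun i => by
    have := le_cubeCorner_add_one (hx' i)
    simp only [hr]; linarith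
  have hρ0 : ∀ k, 0 ≤ ρ k := fun k => by
    simp only [hρ]; split_ifs
    · exact hr0 _
    · exact le_rfl
  have hρm : ∀ k, ρ (k + 1) ≤ ρ k := fun k => by
    by_cases h : k + 1 < d
    · simp only [hρ, dif_pos h, dif_pos (show k < d by omega)]
      exact consistentPerm_antitone x (by simp [Fin.le_def])
    · simp only [hρ, dif_neg h]
      exact hρ0 k
  have hρ1 : ρ 0 ≤ 1 := by simp only [hρ, dif_pos hd]; exact hr1 _
  -- The absolute value is replaced by either linear minorant `s · (x j - a j)`: interpolation along
  -- the chain reproduces affine functions exactly. Thus `H ≥ 0` on the chain says that the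
  -- extension of `f` at `x` is at least `f a + c s (x j - a j)`; the subgradient inequality at `a`
  -- does the rest.
  have main : ∀ s : ℝ, |s| = 1 → c * (s * (x j - ((a j : ℤ) : ℝ))) ≤
      ∑ i, subgradient hN f x i * (x i - ((a i : ℤ) : ℝ)) := by
    intro s hs
    set H : ℕ → ℝ := fun k => f (neighbor hN x k) - f a -
      c * (s * (((neighbor hN x k j : ℤ) : ℝ) - ((a j : ℤ) : ℝ))) with hH
    have hH0 : ∀ k, 0 ≤ H k := fun k => by
      have h1 := hf.sharp hc ha (neighbor hN x k) j
      have h2 : s * (((neighbor hN x k j : ℤ) : ℝ) - ((a j : ℤ) : ℝ)) ≤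
          |((neighbor hN x k j : ℤ) : ℝ) - ((a j : ℤ) : ℝ)| := by
        refine (le_abs_self _).trans ?_
        rw [abs_mul, hs, one_mul]
      have := mul_le_mul_of_nonneg_left h2 hc.le
      simp only [hH]; linarith
    have hint := interpolate_nonneg hH0 hρ1 hρ0 hρm d
    have e1 : ∑ k ∈ Finset.range d, (H (k + 1) - H k) * ρ k =
        ∑ i, subgradient hN f x i * r i - c * (s * r j) := by
      rw [← Fin.sum_univ_eq_sum_range (fun k => (H (k + 1) - H k) * ρ k) d]
      have e2 : ∀ k : Fin d, (H ((k : ℕ) + 1) - H k) * ρ k =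
          subgradient hN f x (π k) * r (π k) -
            c * (s * ((if π k = j then 1 else 0) * r (π k))) := by
        intro k
        rw [← neighbor_sub hN]
        simp only [hρ, dif_pos k.2, hH, subgradient, ← hπ, Equiv.symm_apply_apply, Fin.eta]
        ring
      simp_rw [e2]
      rw [Finset.sum_sub_distrib, Equiv.sum_comp π (fun i => subgradient hN f x i * r i),
        Equiv.sum_comp π (fun i => c * (s * ((if i = j then 1 else 0) * r i)))]
      simp
    have e3 : H 0 = f (neighbor hN x 0) - f a -
        c * (s * ((cubeCorner N x j : ℝ) - ((a j : ℤ) : ℝ))) := by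
      simp only [hH, neighbor_apply]; simp
    rw [e1, e3] at hint
    have e4 : ∑ i, subgradient hN f x i * (x i - ((a i : ℤ) : ℝ)) =
        ∑ i, subgradient hN f x i * r i -
          ∑ i, subgradient hN f x i * (((a i : ℤ) : ℝ) - cubeCorner N x i) := by
      rw [← Finset.sum_sub_distrib]
      refine Finset.sum_congr rfl fun i _ => ?_
      simp only [hr]; ring
    rw [e4]
    have e5 : c * (s * r j) = c * (s * (x j - ((a j : ℤ) : ℝ))) -
        c * (s * ((cubeCorner N x j : ℝ) - ((a j : ℤ) : ℝ))) := by simp only [hr]; ring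
    linarith
  rcases abs_cases (x j - ((a j : ℤ) : ℝ)) with ⟨h, _⟩ | ⟨h, _⟩
  · rw [h]; simpa using main 1 (by simp)
  · rw [h]; simpa using main (-1) (by simp)

/-- A grid point at distance at most `1/4` from `x` is one of the neighbouring points of `x`. -/
theorem exists_neighbor_eq (hN : 2 ≤ N) {x : Fin d → ℝ} (hx : ∀ i, 1 ≤ x i) (hx' : ∀ i, x i ≤ N)
    {a : Grid d N} (ha : ∀ i, |x i - ((a i : ℤ) : ℝ)| ≤ 1 / 4) :
    ∃ k : Fin (d + 1), neighbor hN x k = a := by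
  classical
  have hr0 : ∀ i, (cubeCorner N x i : ℝ) ≤ x i := fun i => cubeCorner_le (hx i)
  have hr1 : ∀ i, x i ≤ cubeCorner N x i + 1 := fun i => le_cubeCorner_add_one (hx' i)
  -- Fractional parts are at most `1/4` where `a` agrees with the corner and at least `3/4` where it
  -- is raised. In decreasing order the raised coordinates therefore form an initial segment, and
  -- `a` is on the chain.
  have hcase : ∀ i, ((a i : ℤ) = cubeCorner N x i ∧ x i - cubeCorner N x i ≤ 1 / 4) ∨
      ((a i : ℤ) = cubeCorner N x i + 1 ∧ 3 / 4 ≤ x i - cubeCorner N x i) := by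
    intro i
    have h := abs_le.1 (ha i)
    have h0 := hr0 i; have h1 := hr1 i
    have l1 : cubeCorner N x i - 1 < (a i : ℤ) := by
      rw [← Int.cast_lt (R := ℝ)]; push_cast; linarith
    have l2 : (a i : ℤ) < cubeCorner N x i + 2 := by
      rw [← Int.cast_lt (R := ℝ)]; push_cast; linarith
    have : (a i : ℤ) = cubeCorner N x i ∨ (a i : ℤ) = cubeCorner N x i + 1 := by omega
    rcases this with e | e
    · left; refine ⟨e, ?_⟩; rw [e] at h; linarith
    · right; refine ⟨e, ?_⟩; rw [e] at h; push_cast at h; linarith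
  set π := consistentPerm N x with hπ
  have hdown : ∀ k l : Fin d, k ≤ l → (a (π l) : ℤ) = cubeCorner N x (π l) + 1 →
      (a (π k) : ℤ) = cubeCorner N x (π k) + 1 := by
    intro k l hkl hl
    have := consistentPerm_antitone (N := N) x hkl
    rw [← hπ] at this
    rcases hcase (π k) with h | h
    · rcases hcase (π l) with h' | h'
      · omega
      · linarith [h.2, h'.2]
    · exact h.1
  let P : ℕ → Prop := fun n => ∀ k : Fin d, n ≤ k → (a (π k) : ℤ) = cubeCorner N x (π k)
  have hex : ∃ n, P n := ⟨d, fun k hk => absurd k.2 (by omega)⟩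
  refine ⟨⟨Nat.find hex, ?_⟩, ?_⟩
  · have : Nat.find hex ≤ d := Nat.find_min' hex fun k hk => absurd k.2 (by omega)
    omega
  · funext i
    apply Subtype.ext
    rw [neighbor_apply, ← hπ]
    obtain ⟨k, rfl⟩ := π.surjective i
    simp only [Equiv.symm_apply_apply]
    split_ifs with hk
    · have := Nat.find_min hex (m := k) hk
      simp only [P, not_forall] at this
      obtain ⟨l, hkl, hl⟩ := this
      have hl' : (a (π l) : ℤ) = cubeCorner N x (π l) + 1 := by
        rcases hcase (π l) with h | h
        · exact absurd h.1 hl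
        · exact h.1
      exact (hdown k l hkl hl').symm
    · rw [Nat.find_spec hex k (by omega)]; simp

end DiscreteConvexity

/-! ### Semantics of simulation programs -/

namespace SimProgram

variable {X α β : Type}

/-- The result of a procedure started at time `n`, where `obs k x` is the value observed if the
`k`-th simulation is at `x`. -/
def run (obs : ℕ → X → ℝ) : SimProgram X α → ℕ → α
  | ret a, _ => a
  | query x k, n => (k (obs n x)).run obs (n + 1)

/-- The invariant linking the history-based algorithm to the recursive semantics: feeding the
history to the procedure leaves a remainder that, run from time `n`, gives the result of the whole
run. -/
theorem run_after (x₀ : X) (p : SimProgram X X) (obs : ℕ → X → ℝ) (n : ℕ) :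
    (p.after n ((p.toAlgorithm x₀).history obs n)).run obs n = p.run obs 0 := by
  induction n with
  | zero => rfl
  | succ n ih =>
    rw [← ih]
    simp only [after, SimAlgorithm.history, Fin.init_snoc, Fin.snoc_last]
    have : (p.toAlgorithm x₀).sample n ((p.toAlgorithm x₀).history obs n) =
      (p.after n ((p.toAlgorithm x₀).history obs n)).next x₀ := rfl
    rw [this]
    cases p.after n ((p.toAlgorithm x₀).history obs n) with
    | ret a => rfl
    | query x k => rfl

/-- `P ω` is a family of procedures that make exactly `n` simulations, with all decisions
depending measurably on the parameter `ω` and on the values observed. -/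
def IsUniform [MeasurableSpace X] [MeasurableSpace α] :
    (n : ℕ) → {Ω : Type} → [MeasurableSpace Ω] → (Ω → SimProgram X α) → Prop
  | 0, Ω, _, P => ∃ f : Ω → α, Measurable f ∧ P = fun ω => ret (f ω)
  -- The observed value becomes part of the parameter of the continuation, so that the later
  -- decisions are jointly measurable in everything seen so far.
  | n + 1, Ω, _, P => ∃ (x : Ω → X) (k : Ω × ℝ → SimProgram X α), Measurable x ∧
      IsUniform n k ∧ P = fun ω => query (x ω) fun r => k (ω, r)

section Uniform

variable [MeasurableSpace X] [MeasurableSpace α] [MeasurableSpace β]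
  {Ω Ω' : Type} [MeasurableSpace Ω] [MeasurableSpace Ω']

theorem IsUniform.ret {f : Ω → α} (hf : Measurable f) :
    IsUniform 0 fun ω => (ret (f ω) : SimProgram X α) := ⟨f, hf, rfl⟩

theorem IsUniform.query {n : ℕ} {x : Ω → X} {k : Ω × ℝ → SimProgram X α} (hx : Measurable x)
    (hk : IsUniform n k) : IsUniform (n + 1) fun ω => query (x ω) fun r => k (ω, r) :=
  ⟨x, k, hx, hk, rfl⟩

theorem IsUniform.comp {n : ℕ} {P : Ω → SimProgram X α} (hP : IsUniform n P) {g : Ω' → Ω}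
    (hg : Measurable g) : IsUniform n fun ω => P (g ω) := by
  induction n generalizing Ω Ω' with
  | zero =>
    obtain ⟨f, hf, rfl⟩ := hP
    exact ⟨fun ω => f (g ω), hf.comp hg, rfl⟩
  | succ n ih =>
    obtain ⟨x, k, hx, hk, rfl⟩ := hP
    exact ⟨fun ω => x (g ω), fun p => k (g p.1, p.2), hx.comp hg,
      ih hk (g := fun p : Ω' × ℝ => (g p.1, p.2)) (by fun_prop), rfl⟩

theorem IsUniform.bind {m n : ℕ} {P : Ω → SimProgram X α} (hP : IsUniform m P)
    {Q : Ω → α → SimProgram X β} (hQ : IsUniform n fun p : Ω × α => Q p.1 p.2) :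
    IsUniform (m + n) fun ω => (P ω).bind (Q ω) := by
  induction m generalizing Ω with
  | zero =>
    obtain ⟨f, hf, rfl⟩ := hP
    rw [zero_add]
    exact hQ.comp (g := fun ω => (ω, f ω)) (by fun_prop)
  | succ m ih =>
    obtain ⟨x, k, hx, hk, rfl⟩ := hP
    rw [Nat.add_right_comm]
    exact ⟨x, fun p => (k p).bind (Q p.1), hx, ih (Q := fun p => Q p.1) hk
      (hQ.comp (g := fun q : (Ω × ℝ) × α => (q.1.1, q.2)) (by fun_prop)), rfl⟩

theorem IsUniform.congr {m n : ℕ} {P : Ω → SimProgram X α} (hP : IsUniform m P) (h : m = n) :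
    IsUniform n P := h ▸ hP

theorem IsUniform.step {n : ℕ} {P : Ω → SimProgram X α} (hP : IsUniform n P) :
    IsUniform (n - 1) fun p : Ω × ℝ => (P p.1).step p.2 := by
  cases n with
  | zero =>
    obtain ⟨f, hf, rfl⟩ := hP
    exact ⟨fun p => f p.1, by fun_prop, rfl⟩
  | succ n =>
    obtain ⟨x, k, hx, hk, rfl⟩ := hP
    exact hk

theorem IsUniform.after {m : ℕ} {p : SimProgram X α} (hp : IsUniform m fun _ : Unit => p) (n : ℕ) :
    IsUniform (m - n) fun h : Fin n → X × ℝ => p.after n h := by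
  induction n with
  | zero => exact hp.comp (g := fun _ => ()) measurable_const
  | succ n ih =>
    rw [← Nat.sub_sub]
    refine ih.step.comp (g := fun h : Fin (n + 1) → X × ℝ => (Fin.init h, (h (Fin.last n)).2)) ?_
    refine Measurable.prodMk ?_ (by fun_prop)
    exact measurable_pi_lambda _ fun i => measurable_pi_apply _

theorem IsUniform.isDone_iff {n : ℕ} {P : Ω → SimProgram X α} (hP : IsUniform n P) (ω : Ω) :
    (P ω).IsDone ↔ n = 0 := by
  cases n with
  | zero =>
    obtain ⟨f, hf, rfl⟩ := hP
    simp [IsDone]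
  | succ n =>
    obtain ⟨x, k, hx, hk, rfl⟩ := hP
    simp [IsDone]

theorem IsUniform.measurable_next {n : ℕ} {P : Ω → SimProgram X α} (hP : IsUniform n P) (x₀ : X) :
    Measurable fun ω => (P ω).next x₀ := by
  cases n with
  | zero =>
    obtain ⟨f, hf, rfl⟩ := hP
    exact measurable_const
  | succ n =>
    obtain ⟨x, k, hx, hk, rfl⟩ := hP
    exact hx

theorem IsUniform.measurable_result {n : ℕ} {P : Ω → SimProgram X α} (hP : IsUniform n P)
    (a₀ : α) : Measurable fun ω => (P ω).result a₀ := by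
  cases n with
  | zero =>
    obtain ⟨f, hf, rfl⟩ := hP
    exact hf
  | succ n =>
    obtain ⟨x, k, hx, hk, rfl⟩ := hP
    exact measurable_const

theorem IsUniform.isMeasurable_toAlgorithm {m : ℕ} {p : SimProgram X X}
    (hp : IsUniform m fun _ : Unit => p) (x₀ : X) : (p.toAlgorithm x₀).IsMeasurable := by
  intro n
  refine ⟨?_, (hp.after n).measurable_next x₀, (hp.after n).measurable_result x₀⟩
  have : {h | (p.toAlgorithm x₀).halted n h} = {_h | m - n = 0} := by
    ext h
    exact (hp.after n).isDone_iff h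
  rw [this]
  exact MeasurableSet.const _

/-- After `n` observations exactly `m - n` simulations remain, whatever was observed, so the first
halting time is the constant `m`. -/
theorem IsUniform.cost_toAlgorithm {m : ℕ} {p : SimProgram X X}
    (hp : IsUniform m fun _ : Unit => p) (x₀ : X) (obs : ℕ → X → ℝ) :
    (p.toAlgorithm x₀).cost obs = m := by
  have h : ∀ n, (p.toAlgorithm x₀).halted n ((p.toAlgorithm x₀).history obs n) ↔ m ≤ n := fun n =>
    ((hp.after n).isDone_iff _).trans Nat.sub_eq_zero_iff_le
  simp only [SimAlgorithm.cost, h]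
  refine le_antisymm (iInf₂_le m le_rfl) (le_iInf₂ fun n hn => by exact_mod_cast hn)

theorem IsUniform.output_toAlgorithm {m : ℕ} {p : SimProgram X X}
    (hp : IsUniform m fun _ : Unit => p) (x₀ : X) (obs : ℕ → X → ℝ) :
    (p.toAlgorithm x₀).output obs = p.run obs 0 := by
  rw [SimAlgorithm.output, hp.cost_toAlgorithm x₀ obs, ENat.toNat_natCast, ← run_after x₀ p obs m]
  change (p.after m ((p.toAlgorithm x₀).history obs m)).result x₀ = _
  have h := (hp.after m).isDone_iff ((p.toAlgorithm x₀).history obs m)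
  rw [Nat.sub_self] at h
  generalize p.after m ((p.toAlgorithm x₀).history obs m) = q at *
  cases q with
  | ret a => rfl
  | query x k => simp [IsDone] at h

end Uniform

/-! ### Expectations -/

section Expect

variable {d N : ℕ} (S : SimModel.{u} d N)

/-- The expectation of `φ` of the result of a procedure. -/
noncomputable def expect : SimProgram (Grid d N) α → (α → ℝ≥0∞) → ℝ≥0∞
  | ret a, φ => φ a
  | query x k, φ => ∫⁻ y, (k (S.F x y)).expect φ ∂S.law x

theorem expect_bind (p : SimProgram (Grid d N) α) (g : α → SimProgram (Grid d N) β)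
    (φ : β → ℝ≥0∞) : expect S (p.bind g) φ = expect S p fun a => expect S (g a) φ := by
  induction p with
  | ret a => rfl
  | query x k ih => simp only [bind, expect, ih]

theorem expect_mono (p : SimProgram (Grid d N) α) {φ ψ : α → ℝ≥0∞} (h : ∀ a, φ a ≤ ψ a) :
    expect S p φ ≤ expect S p ψ := by
  induction p with
  | ret a => exact h a
  | query x k ih => exact lintegral_mono fun y => ih _

theorem expect_const (p : SimProgram (Grid d N) α) (r : ℝ≥0∞) : expect S p (fun _ => r) = r := by
  induction p with
  | ret a => rfl
  | query x k ih => simp [expect, ih]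

/-- Splitting off a constant requires measurability of the constant only. The union bound and the
supermartingale recursion can therefore work with arbitrary `φ`. -/
theorem expect_add_const (p : SimProgram (Grid d N) α) (φ : α → ℝ≥0∞) (r : ℝ≥0∞) :
    expect S p (fun a => φ a + r) = expect S p φ + r := by
  induction p with
  | ret a => rfl
  | query x k ih => simp only [expect, ih]; rw [lintegral_add_right _ measurable_const]; simp

theorem expect_const_mul (p : SimProgram (Grid d N) α) (φ : α → ℝ≥0∞) {r : ℝ≥0∞} (hr : r ≠ ∞) :
    expect S p (fun a => r * φ a) = r * expect S p φ := by
  induction p with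
  | ret a => rfl
  | query x k ih => simp only [expect, ih]; rw [lintegral_const_mul' _ _ hr]

end Expect

end SimProgram

/-! ### The law of the result of a procedure -/

section Law

variable {d N : ℕ} (S : SimModel.{u} d N)

instance : IsProbabilityMeasure S.prob := by unfold SimModel.prob; infer_instance

/-- Resampling one coordinate preserves a product measure. -/
theorem measurePreserving_update_infinitePi {ι : Type*} [DecidableEq ι] {Y : ι → Type*}
    [∀ i, MeasurableSpace (Y i)] (μ : ∀ i, Measure (Y i)) [∀ i, IsProbabilityMeasure (μ i)]
    (j : ι) :
    MeasurePreserving (fun p : Y j × (∀ i, Y i) => Function.update p.2 j p.1)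
      ((μ j).prod (Measure.infinitePi μ)) (Measure.infinitePi μ) := by
  have hmeas : Measurable fun p : Y j × (∀ i, Y i) => Function.update p.2 j p.1 := by
    refine measurable_pi_lambda _ fun i => ?_
    by_cases h : i = j
    · subst h; simpa using measurable_fst
    · simp only [Function.update_of_ne h]; fun_prop
  refine ⟨hmeas, Measure.eq_infinitePi μ fun s t ht => ?_⟩
  rw [Measure.map_apply hmeas (MeasurableSet.pi s.countable_toSet fun i _ => ht i)]
  by_cases hj : j ∈ s
  · have : (fun p : Y j × (∀ i, Y i) => Function.update p.2 j p.1) ⁻¹' Set.pi s t =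
        t j ×ˢ Set.pi (s.erase j : Finset ι) t := by
      ext ⟨y, ω⟩
      simp only [Set.mem_preimage, Set.mem_pi, Set.mem_prod, Finset.mem_coe, Finset.mem_erase]
      constructor
      · intro h
        refine ⟨by simpa using h j hj, fun i hi => ?_⟩
        simpa [Function.update_of_ne hi.1] using h i hi.2
      · rintro ⟨h1, h2⟩ i hi
        by_cases h : i = j
        · subst h; simpa using h1
        · simpa [Function.update_of_ne h] using h2 i ⟨h, hi⟩
    rw [this, Measure.prod_prod, Measure.infinitePi_pi μ fun i _ => ht i,
      Finset.mul_prod_erase s (fun i => μ i (t i)) hj]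
  · have : (fun p : Y j × (∀ i, Y i) => Function.update p.2 j p.1) ⁻¹' Set.pi s t =
        Set.univ ×ˢ Set.pi s t := by
      ext ⟨y, ω⟩
      simp only [Set.mem_preimage, Set.mem_pi, Set.mem_prod, Finset.mem_coe, Set.mem_univ,
        true_and]
      refine forall₂_congr fun i hi => ?_
      rw [Function.update_of_ne (ne_of_mem_of_not_mem hi hj)]
    rw [this, Measure.prod_prod, Measure.infinitePi_pi μ fun i _ => ht i]
    simp

theorem SimProgram.run_congr {X α : Type} {obs obs' : ℕ → X → ℝ} (p : SimProgram X α) (n : ℕ)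
    (h : ∀ m, n ≤ m → ∀ x, obs m x = obs' m x) : p.run obs n = p.run obs' n := by
  induction p generalizing n with
  | ret a => rfl
  | query x k ih =>
    simp only [run]
    rw [h n le_rfl, ih _ (n + 1) fun m hm => h m (by omega)]

theorem measurable_outcome (n : ℕ) {Ω : Type*} [MeasurableSpace Ω] {x : Ω → Grid d N}
    {ω : Ω → S.Sample} (hx : Measurable x) (hω : Measurable ω) :
    Measurable fun w => S.outcome (ω w) n (x w) := by
  have h : Measurable fun p : S.Sample × Grid d N => S.outcome p.1 n p.2 :=
    measurable_from_prod_countable_left fun z =>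
      (S.measurable_F z).comp (measurable_pi_apply (n, z))
  exact h.comp (hω.prodMk hx)

variable {α Ω : Type} [MeasurableSpace α] [MeasurableSpace Ω]

theorem SimProgram.IsUniform.measurable_run {m : ℕ} {P : Ω → SimProgram (Grid d N) α}
    (hP : IsUniform m P) (n : ℕ) :
    Measurable fun p : Ω × S.Sample => (P p.1).run (S.outcome p.2) n := by
  induction m generalizing n Ω with
  | zero =>
    obtain ⟨f, hf, rfl⟩ := hP
    exact hf.comp measurable_fst
  | succ m ih =>
    obtain ⟨x, k, hx, hk, rfl⟩ := hP
    have h1 : Measurable fun p : Ω × S.Sample => S.outcome p.2 n (x p.1) :=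
      measurable_outcome S n (hx.comp measurable_fst) measurable_snd
    exact (ih hk (n + 1)).comp
      (f := fun p : Ω × S.Sample => ((p.1, S.outcome p.2 n (x p.1)), p.2)) (by fun_prop)

/-- The coordinate `(n, x w)` may be replaced by a fresh copy without changing the law. The
continuation reads only coordinates of time at least `n + 1`, so it does not notice the replacement;
Fubini then separates the first observation from the rest. -/
theorem SimProgram.IsUniform.lintegral_run {m : ℕ} {P : Ω → SimProgram (Grid d N) α}
    (hP : IsUniform m P) (n : ℕ) {φ : α → ℝ≥0∞} (hφ : Measurable φ) (w : Ω) :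
    ∫⁻ ω, φ ((P w).run (S.outcome ω) n) ∂S.prob = expect S (P w) φ := by
  classical
  induction m generalizing n Ω with
  | zero =>
    obtain ⟨f, hf, rfl⟩ := hP
    simp [run, expect]
  | succ m ih =>
    obtain ⟨x, k, hx, hk, rfl⟩ := hP
    have hmp := measurePreserving_update_infinitePi (fun p : ℕ × Grid d N => S.law p.2) (n, x w)
    have hrun := hφ.comp (hk.measurable_run S (n + 1))
    have hmeas : Measurable fun ω : S.Sample =>
        φ ((k (w, S.outcome ω n (x w))).run (S.outcome ω) (n + 1)) := by
      have h1 : Measurable fun ω : S.Sample => S.outcome ω n (x w) :=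
        measurable_outcome S n measurable_const measurable_id
      exact hrun.comp (f := fun ω : S.Sample => ((w, S.outcome ω n (x w)), ω)) (by fun_prop)
    have hF := S.measurable_F (x w)
    simp only [run, expect]
    calc ∫⁻ ω, φ ((k (w, S.outcome ω n (x w))).run (S.outcome ω) (n + 1)) ∂S.prob
        = ∫⁻ p, φ ((k (w, S.F (x w) p.1)).run (S.outcome p.2) (n + 1))
            ∂((S.law (x w)).prod S.prob) := by
          rw [SimModel.prob, ← hmp.lintegral_comp hmeas]
          refine lintegral_congr fun p => ?_
          have h1 : S.outcome (Function.update p.2 (n, x w) p.1) n (x w) = S.F (x w) p.1 := by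
            simp [SimModel.outcome]
          rw [h1]
          congr 1
          refine run_congr _ _ fun i hi z => ?_
          simp only [SimModel.outcome]
          rw [Function.update_of_ne]
          intro h
          have := congrArg Prod.fst h
          simp only at this
          omega
      _ = ∫⁻ y, ∫⁻ ω, φ ((k (w, S.F (x w) y)).run (S.outcome ω) (n + 1)) ∂S.prob ∂S.law (x w) :=
          lintegral_prod _ (hrun.comp (f := fun p : S.Y × S.Sample => ((w, S.F (x w) p.1), p.2))
            (by fun_prop)).aemeasurable
      _ = _ := lintegral_congr fun y => ih hk (n + 1) (w, S.F (x w) y)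

/-- The probability guarantee of a procedure in terms of its expectation functional. -/
theorem SimProgram.IsUniform.le_prob_output {m : ℕ} {p : SimProgram (Grid d N) (Grid d N)}
    (hp : IsUniform m fun _ : Unit => p) (x₀ : Grid d N) (G : Set (Grid d N)) {δ : ℝ}
    (hδ : 0 ≤ δ) (h : expect S p (Gᶜ.indicator 1) ≤ ENNReal.ofReal δ) :
    ENNReal.ofReal (1 - δ) ≤ S.prob {ω | (p.toAlgorithm x₀).cost (S.outcome ω) < ⊤ ∧
      (p.toAlgorithm x₀).output (S.outcome ω) ∈ G} := by
  have hrun : Measurable fun ω => p.run (S.outcome ω) 0 :=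
    (hp.measurable_run S 0).comp (f := fun ω => ((), ω)) (by fun_prop)
  have hset : {ω | (p.toAlgorithm x₀).cost (S.outcome ω) < ⊤ ∧
      (p.toAlgorithm x₀).output (S.outcome ω) ∈ G} = (fun ω => p.run (S.outcome ω) 0) ⁻¹' G := by
    ext ω
    simp [hp.cost_toAlgorithm, hp.output_toAlgorithm]
  have hG : MeasurableSet G := G.to_countable.measurableSet
  have hc : S.prob ((fun ω => p.run (S.outcome ω) 0) ⁻¹' G)ᶜ ≤ ENNReal.ofReal δ := by
    rw [← hp.lintegral_run S 0 (measurable_one.indicator hG.compl) ()] at h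
    rw [← Set.preimage_compl]
    refine le_trans (le_of_eq ?_) h
    rw [← lintegral_indicator_one (hrun hG.compl)]
    rfl
  rw [hset, ENNReal.ofReal_sub 1 hδ, ENNReal.ofReal_one, tsub_le_iff_right,
    ← measure_univ (μ := S.prob), ← Set.union_compl_self ((fun ω => p.run (S.outcome ω) 0) ⁻¹' G)]
  exact (measure_union_le _ _).trans (by gcongr)

end Law

/-! ### Measurability of the adaptive stochastic subgradient method -/

section Measurability

variable {d N : ℕ}

theorem measurable_cubeCorner (i : Fin d) :
    Measurable fun x : Fin d → ℝ => cubeCorner N x i :=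
  (Measurable.of_discrete (f := fun z : ℤ => max 1 (min z ((N : ℤ) - 1)))).comp
    (Int.measurable_floor.comp (measurable_pi_apply i))

/-- For each permutation, the set where the stable sort returns it is cut out by finitely many
inequalities between fractional parts, with ties broken by index. Since there are finitely many
permutations, any function of the permutation is measurable. -/
theorem measurable_comp_consistentPerm {γ : Type*} [MeasurableSpace γ]
    (g : Equiv.Perm (Fin d) → γ) : Measurable fun x : Fin d → ℝ => g (consistentPerm N x) := by
  let _ : MeasurableSpace (Equiv.Perm (Fin d)) := ⊤
  have h : Measurable fun x : Fin d → ℝ => consistentPerm N x := by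
    refine measurable_to_countable' fun π => ?_
    have hr : ∀ i, Measurable fun x : Fin d → ℝ => -(x i - (cubeCorner N x i : ℝ)) := fun i => by
      have := (Measurable.of_discrete (f := fun z : ℤ => (z : ℝ))).comp
        (measurable_cubeCorner (N := N) i)
      exact ((measurable_pi_apply i).sub this).neg
    have : (fun x : Fin d → ℝ => consistentPerm N x) ⁻¹' {π} =
        (⋂ i, ⋂ j, ⋂ (_ : i ≤ j), {x | -(x (π i) - (cubeCorner N x (π i) : ℝ)) ≤
          -(x (π j) - (cubeCorner N x (π j) : ℝ))}) ∩
        ⋂ i, ⋂ j, ⋂ (_ : i < j), ({x | -(x (π i) - (cubeCorner N x (π i) : ℝ)) =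
            -(x (π j) - (cubeCorner N x (π j) : ℝ))}ᶜ ∪ {_x | π i < π j}) := by
      ext x
      simp only [Set.mem_preimage, Set.mem_singleton_iff, Set.mem_inter_iff, Set.mem_iInter,
        Set.mem_union, Set.mem_compl_iff, Set.mem_ofPred_eq, ← imp_iff_not_or]
      rw [eq_comm, consistentPerm, Tuple.eq_sort_iff]
      rfl
    rw [this]
    refine MeasurableSet.inter ?_ ?_
    · exact .iInter fun i => .iInter fun j => .iInter fun _ => measurableSet_le (hr _) (hr _)
    · exact .iInter fun i => .iInter fun j => .iInter fun _ =>
        (measurableSet_eq_fun (hr _) (hr _)).compl.union (.const _)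
  exact measurable_from_top.comp h

theorem measurable_neighbor (hN : 2 ≤ N) (k : ℕ) :
    Measurable fun x : Fin d → ℝ => neighbor hN x k := by
  refine measurable_pi_lambda _ fun i => Measurable.subtype_mk ?_
  exact (measurable_cubeCorner i).add (measurable_comp_consistentPerm fun π =>
    if (π.symm i : ℕ) < k then (1 : ℤ) else 0)

theorem argminIndex_eq_iff {m : ℕ} (v : Fin (m + 1) → ℝ) (i : Fin (m + 1)) :
    argminIndex v = i ↔ (∀ j, v i ≤ v j) ∧ ∀ k < i, ¬ ∀ j, v k ≤ v j := by
  have hmem : ∀ j, v (argminIndex v) ≤ v j := by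
    have := Finset.min'_mem (Finset.univ.filter fun i => ∀ j, v i ≤ v j) (by
      obtain ⟨i, hi⟩ := Finite.exists_min v
      exact ⟨i, by simpa using hi⟩)
    exact (Finset.mem_filter.1 this).2
  have hle : ∀ k, (∀ j, v k ≤ v j) → argminIndex v ≤ k := fun k hk =>
    Finset.min'_le _ _ (by simpa using hk)
  constructor
  · rintro rfl
    exact ⟨hmem, fun k hk h => absurd (hle k h) (not_le.2 hk)⟩
  · rintro ⟨h1, h2⟩
    refine le_antisymm (hle i h1) (not_lt.1 fun h => h2 _ h hmem)

theorem measurable_argminIndex {m : ℕ} : Measurable (argminIndex : (Fin (m + 1) → ℝ) → _) := by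
  refine measurable_to_countable' fun i => ?_
  have h : ∀ i : Fin (m + 1), MeasurableSet {v : Fin (m + 1) → ℝ | ∀ j, v i ≤ v j} := fun i => by
    simp only [Set.ofPred_forall]
    exact .iInter fun j => measurableSet_le (measurable_pi_apply _) (measurable_pi_apply _)
  have : (argminIndex : (Fin (m + 1) → ℝ) → _) ⁻¹' {i} =
      {v | ∀ j, v i ≤ v j} ∩ ⋂ k, ⋂ (_ : k < i), {v | ∀ j, v k ≤ v j}ᶜ := by
    ext v
    simp only [Set.mem_preimage, Set.mem_singleton_iff, argminIndex_eq_iff]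
    simp
  rw [this]
  exact (h i).inter (.iInter fun k => .iInter fun _ => (h k).compl)

variable {Ω : Type} [MeasurableSpace Ω]

namespace SimProgram

variable {X : Type} [MeasurableSpace X]

theorem isUniform_collect {n : ℕ} {x : Ω → Fin n → X} (hx : Measurable x) :
    IsUniform n fun ω => collect n (x ω) := by
  induction n generalizing Ω with
  | zero => exact IsUniform.ret (f := fun _ => Fin.elim0) measurable_const
  | succ n ih =>
    refine IsUniform.query (x := fun ω => x ω 0) (k := fun p : Ω × ℝ =>
      (collect n (Fin.tail (x p.1))).bind fun v => ret (Fin.cons (α := fun _ => ℝ) p.2 v))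
      ((measurable_pi_apply 0).comp hx) ?_
    refine IsUniform.bind (n := 0) (ih (x := fun p : Ω × ℝ => Fin.tail (x p.1)) ?_)
      (Q := fun p v => ret (Fin.cons (α := fun _ => ℝ) p.2 v)) (IsUniform.ret ?_)
    · exact measurable_pi_lambda _ fun i =>
        (measurable_pi_apply i.succ).comp (hx.comp measurable_fst)
    · refine measurable_pi_lambda _ fun i => ?_
      refine Fin.cases ?_ (fun j => ?_) i
      · simp only [Fin.cons_zero]; fun_prop
      · simp only [Fin.cons_succ]; fun_prop

theorem isUniform_collectSums {m : ℕ} {x : Ω → Fin m → X} (hx : Measurable x) (n : ℕ) :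
    IsUniform (n * m) fun ω => collectSums (x ω) n := by
  induction n with
  | zero => rw [zero_mul]; exact IsUniform.ret measurable_const
  | succ n ih =>
    refine IsUniform.congr (m := m + (n * m + 0)) ?_ (by ring)
    refine (isUniform_collect hx).bind (Q := fun ω v => (collectSums (x ω) n).bind fun s =>
      ret (v + s)) ?_
    refine (ih.comp (g := Prod.fst) measurable_fst).bind (Q := fun p s => ret (p.2 + s)) ?_
    exact IsUniform.ret (by fun_prop)

end SimProgram

open SimProgram

theorem isUniform_stochSubgradient (hN : 2 ≤ N) :
    IsUniform (2 * d) fun x : Fin d → ℝ => stochSubgradient hN x := by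
  refine IsUniform.congr (m := d + (d + 0)) ?_ (by ring)
  refine (isUniform_collect (x := fun (x : Fin d → ℝ) (i : Fin d) => neighbor hN x (i + 1))
    (measurable_pi_lambda _ fun i => measurable_neighbor hN _)).bind
    (Q := fun x a => (collect d fun i : Fin d => neighbor hN x i).bind fun b =>
      .ret fun j => a ((consistentPerm N x).symm j) - b ((consistentPerm N x).symm j)) ?_
  refine (isUniform_collect
    (x := fun (p : (Fin d → ℝ) × (Fin d → ℝ)) (i : Fin d) => neighbor hN p.1 i)
    (measurable_pi_lambda _ fun i => (measurable_neighbor hN _).comp measurable_fst)).bind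
    (Q := fun p b => .ret fun j =>
      p.2 ((consistentPerm N p.1).symm j) - b ((consistentPerm N p.1).symm j)) ?_
  refine IsUniform.ret (measurable_pi_lambda _ fun j => ?_)
  have heval : Measurable fun q : (Fin d → ℝ) × Fin d => q.1 q.2 :=
    measurable_from_prod_countable_left fun k => measurable_pi_apply k
  have hp : Measurable fun q : ((Fin d → ℝ) × (Fin d → ℝ)) × (Fin d → ℝ) =>
      (consistentPerm N q.1.1).symm j :=
    (measurable_comp_consistentPerm fun π => π.symm j).comp (measurable_fst.comp measurable_fst)
  refine Measurable.sub ?_ ?_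
  · exact heval.comp ((measurable_snd.comp measurable_fst).prodMk hp)
  · exact heval.comp (measurable_snd.prodMk hp)

theorem measurable_truncate (M : ℝ) : Measurable (truncate M : (Fin d → ℝ) → Fin d → ℝ) :=
  measurable_pi_lambda _ fun i => by unfold truncate; fun_prop

theorem isUniform_ssgdLoop (hN : 2 ≤ N) {lo hi : Ω → Fin d → ℝ} (hlo : Measurable lo)
    (hhi : Measurable hi) (M η : ℝ) (T : ℕ) {x s : Ω → Fin d → ℝ} (hx : Measurable x)
    (hs : Measurable s) :
    IsUniform (T * (2 * d)) fun ω => ssgdLoop hN (lo ω) (hi ω) M η T (x ω) (s ω) := by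
  induction T generalizing Ω with
  | zero => rw [zero_mul]; exact IsUniform.ret hs
  | succ T ih =>
    refine IsUniform.congr (m := 2 * d + T * (2 * d)) ?_ (by ring)
    refine ((isUniform_stochSubgradient hN).comp hx).bind (Q := fun ω g =>
      ssgdLoop hN (lo ω) (hi ω) M η T (projBox (lo ω) (hi ω) (x ω - η • truncate M g))
        (s ω + x ω)) ?_
    refine ih (lo := fun p : Ω × (Fin d → ℝ) => lo p.1) (hi := fun p => hi p.1)
      (x := fun p => projBox (lo p.1) (hi p.1) (x p.1 - η • truncate M p.2))
      (s := fun p => s p.1 + x p.1) (by fun_prop) (by fun_prop) ?_ (by fun_prop)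
    have ht := measurable_truncate (d := d) M
    refine measurable_pi_lambda _ fun i => ?_
    unfold projBox
    fun_prop

theorem isUniform_ssgd (hN : 2 ≤ N) {lo hi : Ω → Fin d → ℝ} (hlo : Measurable lo)
    (hhi : Measurable hi) (T : ℕ) (M η : ℝ) {x : Ω → Fin d → ℝ} (hx : Measurable x) :
    IsUniform (T * (2 * d)) fun ω => ssgd hN (lo ω) (hi ω) T M η (x ω) :=
  (isUniform_ssgdLoop hN hlo hhi M η T hx measurable_const).bind (n := 0)
    (Q := fun _ s => .ret ((T : ℝ)⁻¹ • s)) (IsUniform.ret (by fun_prop))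

/-- A constant iteration number suffices, since the prescribed scale is the same in every epoch
(`iterationScale_epoch`). -/
theorem isUniform_epochResult (hN : 2 ≤ N) (T : ℕ) (M : ℕ → ℝ) (e : ℕ) :
    IsUniform ((e + 1) * (T * (2 * d))) fun _ : Unit =>
      epochResult (d := d) hN (fun _ => T) M e := by
  induction e with
  | zero =>
    rw [zero_add, one_mul]
    exact isUniform_ssgd hN measurable_const measurable_const T _ _ measurable_const
  | succ e ih =>
    refine IsUniform.congr (m := (e + 1) * (T * (2 * d)) + T * (2 * d)) ?_ (by ring)
    refine ih.bind (Q := fun _ x => ssgd hN (fun i => max 1 (x i - N / 2 ^ (e + 2)))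
      (fun i => min N (x i + N / 2 ^ (e + 2))) T (M (e + 1))
      (stepSize (boxWidth N (e + 1)) (M (e + 1)) T) x) ?_
    refine isUniform_ssgd hN (lo := fun (p : Unit × (Fin d → ℝ)) i =>
      max 1 (p.2 i - N / 2 ^ (e + 2))) (hi := fun p i => min N (p.2 i + N / 2 ^ (e + 2)))
      ?_ ?_ T _ _ measurable_snd
    · exact measurable_pi_lambda _ fun i => by fun_prop
    · exact measurable_pi_lambda _ fun i => by fun_prop

theorem Measurable.neighbor {Γ : Type*} [MeasurableSpace Γ] (hN : 2 ≤ N) {x : Γ → Fin d → ℝ}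
    {k : Γ → ℕ} (hx : Measurable x) (hk : Measurable k) :
    Measurable fun p => neighbor hN (x p) (k p) := by
  have h : Measurable fun q : (Fin d → ℝ) × ℕ => _root_.neighbor hN q.1 q.2 :=
    measurable_from_prod_countable_left fun k => measurable_neighbor hN k
  have hxk : Measurable fun p => (x p, k p) := hx.prodMk hk
  have := h.comp hxk
  exact this

theorem measurable_argminIndex_div {m : ℕ} (n : ℕ) :
    Measurable fun v : Fin (m + 1) → ℝ => ((argminIndex fun k => v k / (n : ℝ) : Fin _) : ℕ) := by
  have h : Measurable fun (v : Fin (m + 1) → ℝ) k => v k / (n : ℝ) :=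
    measurable_pi_lambda _ fun k => by fun_prop
  exact (Measurable.of_discrete (f := fun k : Fin (m + 1) => (k : ℕ))).comp
    (measurable_argminIndex.comp h)

theorem isUniform_collectSums_neighbor (hN : 2 ≤ N) (n : ℕ) :
    IsUniform (n * (d + 1)) fun x : Fin d → ℝ =>
      collectSums (fun k : Fin (d + 1) => neighbor hN x k) n :=
  isUniform_collectSums (measurable_pi_lambda _ fun _ => measurable_neighbor hN _) n

theorem isUniform_roundPoint (hN : 2 ≤ N) (σ ε δ : ℝ) :
    IsUniform (roundingReplications σ d ε δ * (d + 1)) fun x : Fin d → ℝ =>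
      roundPoint hN σ ε δ x :=
  IsUniform.bind (n := 0) (isUniform_collectSums_neighbor hN _)
    (Q := fun x s => .ret (neighbor hN x (argminIndex fun k =>
      s k / (roundingReplications σ d ε δ : ℝ))))
    (IsUniform.ret (Measurable.neighbor hN measurable_fst
      ((measurable_argminIndex_div _).comp measurable_snd)))

/-- The adaptive stochastic subgradient method makes a deterministic number of simulations. -/
theorem isUniform_adaptiveSSGD (hN : 2 ≤ N) (σ c δ : ℝ) (T : ℕ) (M : ℕ → ℝ) :
    IsUniform (numEpochs N * (T * (2 * d)) + roundingReplications σ d (c / 2) δ * (d + 1))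
      fun _ : Unit => (epochResult (d := d) hN (fun _ => T) M (numEpochs N - 1)).bind fun x =>
        roundPoint hN σ (c / 2) δ x :=
  (isUniform_epochResult hN T M (numEpochs N - 1)).bind
    (Q := fun _ x => roundPoint hN σ (c / 2) δ x)
    ((isUniform_roundPoint hN σ (c / 2) δ).comp measurable_snd)

end Measurability

/-! ### Truncated sub-Gaussian random variables -/

section SubGaussian

variable {Ω : Type*} [MeasurableSpace Ω] {P : Measure Ω} [IsProbabilityMeasure P]

/-- Symmetrization: contractions do not increase the product of the two one-sided exponential
moments. -/
theorem integral_exp_mul_integral_exp_neg_le {Z W : Ω → ℝ} (t : ℝ)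
    (hWZ : ∀ a b, |W a - W b| ≤ |Z a - Z b|)
    (hW : ∀ t : ℝ, Integrable (fun ω => Real.exp (t * W ω)) P)
    (hZ : ∀ t : ℝ, Integrable (fun ω => Real.exp (t * Z ω)) P) :
    (∫ ω, Real.exp (t * W ω) ∂P) * ∫ ω, Real.exp (-t * W ω) ∂P ≤
      (∫ ω, Real.exp (t * Z ω) ∂P) * ∫ ω, Real.exp (-t * Z ω) ∂P := by
  -- With an independent copy `V'`, the product of the two moments is the expectation of `cosh (t (V
  -- - V'))`, and `cosh` increases with the absolute value of its argument, which a contraction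
  -- decreases.
  have key : ∀ V : Ω → ℝ, (∀ t : ℝ, Integrable (fun ω => Real.exp (t * V ω)) P) →
      Integrable (fun p : Ω × Ω => Real.cosh (t * (V p.1 - V p.2))) (P.prod P) ∧
      (∫ ω, Real.exp (t * V ω) ∂P) * ∫ ω, Real.exp (-t * V ω) ∂P =
        ∫ p, Real.cosh (t * (V p.1 - V p.2)) ∂(P.prod P) := by
    intro V hV
    have e : ∀ p : Ω × Ω, Real.cosh (t * (V p.1 - V p.2)) =
        2⁻¹ * (Real.exp (t * V p.1) * Real.exp (-t * V p.2)) +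
          2⁻¹ * (Real.exp (-t * V p.1) * Real.exp (t * V p.2)) := by
      intro p
      rw [Real.cosh_eq, ← Real.exp_add, ← Real.exp_add]
      ring_nf
    have h1 := ((hV t).mul_prod (hV (-t))).const_mul 2⁻¹
    have h2 := ((hV (-t)).mul_prod (hV t)).const_mul 2⁻¹
    simp_rw [e]
    refine ⟨h1.add h2, ?_⟩
    rw [integral_add h1 h2, integral_const_mul, integral_const_mul,
      integral_prod_mul (fun ω => Real.exp (t * V ω)) (fun ω => Real.exp (-t * V ω)),
      integral_prod_mul (fun ω => Real.exp (-t * V ω)) (fun ω => Real.exp (t * V ω))]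
    ring
  rw [(key W hW).2, (key Z hZ).2]
  refine integral_mono (key W hW).1 (key Z hZ).1 fun p => ?_
  simp only
  rw [Real.cosh_le_cosh, abs_mul, abs_mul]
  exact mul_le_mul_of_nonneg_left (hWZ _ _) (abs_nonneg _)

/-- A bounded contraction of a sub-Gaussian random variable is sub-Gaussian. -/
theorem integral_exp_contraction_le {Z : Ω → ℝ} {m : ℝ} {κ : ℝ≥0} (hZm : Measurable Z)
    (hZ : HasSubgaussianMGF (fun ω => Z ω - m) κ P) {φ : ℝ → ℝ} (hφm : Measurable φ)
    (hφ : ∀ a b, |φ a - φ b| ≤ |a - b|) {M : ℝ} (hM : ∀ a, |φ a| ≤ M) (t : ℝ) :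
    Integrable (fun ω => Real.exp (t * φ (Z ω))) P ∧
    ∫ ω, Real.exp (t * φ (Z ω)) ∂P ≤ Real.exp (t * ∫ ω, φ (Z ω) ∂P + κ * t ^ 2) := by
  have hmeas : Measurable fun ω => φ (Z ω) := hφm.comp hZm
  have hint : Integrable (fun ω => φ (Z ω)) P :=
    Integrable.of_bound hmeas.aestronglyMeasurable M (ae_of_all _ fun ω => hM _)
  have hexp : ∀ t : ℝ, Integrable (fun ω => Real.exp (t * φ (Z ω))) P := fun t =>
    Integrable.of_bound (Real.measurable_exp.comp (hmeas.const_mul t)).aestronglyMeasurable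
      (Real.exp (|t| * M)) (ae_of_all _ fun ω => by
      rw [Real.norm_eq_abs, Real.abs_exp, Real.exp_le_exp]
      refine (le_abs_self _).trans ?_
      rw [abs_mul]
      exact mul_le_mul_of_nonneg_left (hM _) (abs_nonneg _))
  refine ⟨hexp t, ?_⟩
  set μ := ∫ ω, φ (Z ω) ∂P with hμ
  have h1 := integral_exp_mul_integral_exp_neg_le (P := P) (Z := fun ω => Z ω - m)
    (W := fun ω => φ (Z ω)) t (fun a b => by simpa using hφ (Z a) (Z b)) hexp
    hZ.integrable_exp_mul
  -- Both one-sided moments contribute `κ t² / 2`; this is why the contraction is obtained with `κ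
  -- t²` in place of `κ t² / 2`.
  have h2 : (∫ ω, Real.exp (t * (Z ω - m)) ∂P) * ∫ ω, Real.exp (-t * (Z ω - m)) ∂P ≤
      Real.exp (κ * t ^ 2) := by
    have e : Real.exp (κ * t ^ 2) = Real.exp (κ * t ^ 2 / 2) * Real.exp (κ * (-t) ^ 2 / 2) := by
      rw [← Real.exp_add]; ring_nf
    rw [e]
    exact mul_le_mul (hZ.mgf_le t) (hZ.mgf_le (-t)) (integral_nonneg fun _ => Real.exp_nonneg _)
      (Real.exp_nonneg _)
  -- Jensen's inequality, through the tangent line of the exponential. Dividing by this lower bound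
  -- turns the two-sided product estimate into a one-sided one centred at the mean of `φ (Z)`.
  have h3 : Real.exp (-t * μ) ≤ ∫ ω, Real.exp (-t * φ (Z ω)) ∂P := by
    have : ∀ ω, Real.exp (-t * μ) * (1 - t * (φ (Z ω) - μ)) ≤ Real.exp (-t * φ (Z ω)) := by
      intro ω
      have e : Real.exp (-t * φ (Z ω)) = Real.exp (-t * μ) * Real.exp (-t * (φ (Z ω) - μ)) := by
        rw [← Real.exp_add]; ring_nf
      rw [e]
      refine mul_le_mul_of_nonneg_left ?_ (Real.exp_nonneg _)
      have := Real.add_one_le_exp (-t * (φ (Z ω) - μ))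
      linarith
    have hi : Integrable (fun ω => Real.exp (-t * μ) * (1 - t * (φ (Z ω) - μ))) P :=
      (((integrable_const _).sub ((hint.sub (integrable_const _)).const_mul t))).const_mul _
    refine le_trans (le_of_eq ?_) (integral_mono hi (hexp (-t)) this)
    have hi' : Integrable (fun ω => t * (φ (Z ω) - μ)) P :=
      (hint.sub (integrable_const _)).const_mul t
    rw [integral_const_mul, integral_sub (integrable_const _) hi', integral_const_mul,
      integral_sub hint (integrable_const _)]
    simp [hμ]
  have h4 : (∫ ω, Real.exp (t * φ (Z ω)) ∂P) * Real.exp (-t * μ) ≤ Real.exp (κ * t ^ 2) :=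
    (mul_le_mul_of_nonneg_left h3 (integral_nonneg fun _ => Real.exp_nonneg _)).trans
      (h1.trans h2)
  have h5 : Real.exp (-t * μ) * Real.exp (t * μ) = 1 := by rw [← Real.exp_add]; simp
  calc ∫ ω, Real.exp (t * φ (Z ω)) ∂P
      = (∫ ω, Real.exp (t * φ (Z ω)) ∂P) * Real.exp (-t * μ) * Real.exp (t * μ) := by
        rw [mul_assoc, h5, mul_one]
    _ ≤ Real.exp (κ * t ^ 2) * Real.exp (t * μ) :=
        mul_le_mul_of_nonneg_right h4 (Real.exp_nonneg _)
    _ = _ := by rw [← Real.exp_add]; ring_nf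

/-- Truncation of a real number to `[-M, M]`. -/
def clip (M z : ℝ) : ℝ := max (min z M) (-M)

theorem measurable_clip (M : ℝ) : Measurable (clip M) := by unfold clip; fun_prop

theorem abs_clip_le {M : ℝ} (hM : 0 ≤ M) (z : ℝ) : |clip M z| ≤ M := by
  rw [abs_le]
  exact ⟨le_max_right _ _, max_le (min_le_right _ _) (by linarith)⟩

theorem abs_clip_sub_clip_le (M a b : ℝ) : |clip M a - clip M b| ≤ |a - b| :=
  (abs_max_sub_max_le_abs _ _ _).trans
    ((abs_min_sub_min_le_max _ _ _ _).trans (by simp))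

/-- As `|m| ≤ L`, the clipping levels are at distance at least `s` from `m`; clipping removes no
more than the part of the deviation from `m` beyond `s`. -/
theorem abs_clip_sub_le {L s : ℝ} {m : ℝ} (hm : |m| ≤ L) (hs : 0 ≤ s) (z : ℝ) :
    |clip (L + s) z - z| ≤ max (|z - m| - s) 0 := by
  have hm' := abs_le.1 hm
  unfold clip
  have h0 : z - m ≤ |z - m| := le_abs_self _
  have h1 : -(z - m) ≤ |z - m| := neg_le_abs _
  rcases le_total z (L + s) with h | h
  · rw [min_eq_left h]
    rcases le_total z (-(L + s)) with h' | h'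
    · rw [max_eq_right h']
      refine le_trans ?_ (le_max_left _ _)
      rw [abs_of_nonneg (by linarith)]; linarith
    · rw [max_eq_left h']; simp
  · rw [min_eq_right h, max_eq_left (by linarith [abs_nonneg m])]
    refine le_trans ?_ (le_max_left _ _)
    rw [abs_of_nonpos (by linarith)]; linarith

/-- The bias of truncation. -/
theorem abs_integral_clip_sub_le {Z : Ω → ℝ} {m L s l : ℝ} {κ : ℝ≥0} (hZm : Measurable Z)
    (hZ : HasSubgaussianMGF (fun ω => Z ω - m) κ P) (hZ0 : ∫ ω, Z ω - m ∂P = 0)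
    (hm : |m| ≤ L) (hs : 0 ≤ s) (hl : 0 < l) :
    |∫ ω, clip (L + s) (Z ω) ∂P - m| ≤ 2 / l * Real.exp (-l * s + κ * l ^ 2 / 2) := by
  have hL : 0 ≤ L := (abs_nonneg _).trans hm
  have hint : Integrable (fun ω => clip (L + s) (Z ω)) P :=
    Integrable.of_bound ((measurable_clip _).comp hZm).aestronglyMeasurable (L + s)
      (ae_of_all _ fun ω => abs_clip_le (by linarith) _)
  have hI := hZ.integrable
  have hint' : Integrable (fun ω => clip (L + s) (Z ω) - m) P := hint.sub (integrable_const _)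
  have e1 : ∫ ω, clip (L + s) (Z ω) ∂P - m =
      ∫ ω, (clip (L + s) (Z ω) - m) - (Z ω - m) ∂P := by
    rw [integral_sub hint' hI, hZ0,
      integral_sub hint (integrable_const _)]
    simp
  rw [e1]
  have hE : Integrable (fun ω => Real.exp (-l * s) / l *
      (Real.exp (l * (Z ω - m)) + Real.exp (-l * (Z ω - m)))) P :=
    ((hZ.integrable_exp_mul l).add (hZ.integrable_exp_mul (-l))).const_mul _
  refine (abs_integral_le_integral_abs).trans ?_
  refine (integral_mono (hint'.sub hI).abs hE fun ω => ?_).trans ?_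
  · change |clip (L + s) (Z ω) - m - (Z ω - m)| ≤ _
    rw [show clip (L + s) (Z ω) - m - (Z ω - m) = clip (L + s) (Z ω) - Z ω by ring]
    refine (abs_clip_sub_le hm hs _).trans ?_
    have hpos : 0 ≤ Real.exp (-l * s) / l *
        (Real.exp (l * (Z ω - m)) + Real.exp (-l * (Z ω - m))) := by positivity
    refine max_le ?_ hpos
    have h1 : Real.exp (l * |Z ω - m|) ≤
        Real.exp (l * (Z ω - m)) + Real.exp (-l * (Z ω - m)) := by
      rcases abs_cases (Z ω - m) with ⟨h, _⟩ | ⟨h, _⟩ <;> rw [h]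
      · linarith [Real.exp_nonneg (-l * (Z ω - m))]
      · rw [show l * -(Z ω - m) = -l * (Z ω - m) by ring]
        linarith [Real.exp_nonneg (l * (Z ω - m))]
    -- The excess over `s` is dominated by an exponential, so the moment generating function bounds
    -- its mean without any tail integral.
    have h2 : l * (|Z ω - m| - s) ≤ Real.exp (-l * s) * Real.exp (l * |Z ω - m|) := by
      rw [← Real.exp_add]
      have := Real.add_one_le_exp (-l * s + l * |Z ω - m|)
      linarith
    calc |Z ω - m| - s ≤ Real.exp (-l * s) * Real.exp (l * |Z ω - m|) / l := by
          rw [le_div_iff₀ hl]; linarith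
      _ = Real.exp (-l * s) / l * Real.exp (l * |Z ω - m|) := by ring
      _ ≤ _ := mul_le_mul_of_nonneg_left h1 (by positivity)
  · rw [integral_const_mul, integral_add (hZ.integrable_exp_mul l) (hZ.integrable_exp_mul (-l))]
    have h1 := hZ.mgf_le l
    have h2 := hZ.mgf_le (-l)
    rw [mgf] at h1 h2
    rw [neg_sq] at h2
    calc _ ≤ Real.exp (-l * s) / l *
          (Real.exp (κ * l ^ 2 / 2) + Real.exp (κ * l ^ 2 / 2)) := by
          gcongr
      _ = _ := by rw [Real.exp_add]; ring

end SubGaussian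

/-! ### Exponential moments of the stochastic subgradient -/

section SubgradientMoments

open SimProgram

variable {d N : ℕ} (S : SimModel.{u} d N)

/-- Independence of the simulations within one batch, in the form in which exponential moments use
it. -/
theorem expect_collect_prod (n : ℕ) (x : Fin n → Grid d N) (φ : Fin n → ℝ → ℝ≥0∞)
    (hφ : ∀ i, Measurable (φ i)) :
    expect S (collect n x) (fun v => ∏ i, φ i (v i)) =
      ∏ i, ∫⁻ y, φ i (S.F (x i) y) ∂S.law (x i) := by
  induction n with
  | zero => simp [collect, expect]
  | succ n ih =>
    have hm : ∀ i z, Measurable fun y => φ i (S.F z y) := fun i z =>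
      (hφ i).comp (S.measurable_F z)
    simp only [collect, expect, expect_bind]
    have h : ∀ r : ℝ, (fun v : Fin n → ℝ => ∏ i, φ i
        ((Fin.cons (α := fun _ => ℝ) r v : Fin (n + 1) → ℝ) i)) =
        fun v => (∏ i, φ i.succ (v i)) * φ 0 r := by
      intro r; funext v
      rw [Fin.prod_univ_succ, mul_comm]
      simp
    simp only [h]
    have h2 : ∀ r, expect S (collect n (Fin.tail x)) (fun v => (∏ i, φ i.succ (v i)) * φ 0 r) =
        (∏ i : Fin n, ∫⁻ y, φ i.succ (S.F (x i.succ) y) ∂S.law (x i.succ)) * φ 0 r := by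
      intro r
      cases n with
      | zero => simp [collect, expect]
      | succ n =>
        -- The factor `φ 0 r` may be infinite, so it cannot be pulled out by `expect_const_mul`; it
        -- is absorbed into the first of the remaining functions instead.
        have h3 := ih (Fin.tail x) (fun i : Fin (n + 1) =>
          if i = 0 then fun a => φ (Fin.succ 0) a * φ 0 r else φ i.succ) (fun i => by
            split_ifs
            · exact (hφ _).mul_const _
            · exact hφ _)
        rw [Fin.prod_univ_succ] at h3
        simp only [if_true, Fin.succ_ne_zero, if_false] at h3
        rw [lintegral_mul_const _ (hm _ _)] at h3
        rw [Fin.prod_univ_succ]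
        simp only [Fin.tail] at h3 ⊢
        rw [mul_right_comm, ← h3]
        congr 1
        funext v
        rw [Fin.prod_univ_succ, Fin.prod_univ_succ]
        simp only [if_true, Fin.succ_ne_zero, if_false]
        rw [mul_right_comm]
    simp only [h2]
    rw [lintegral_const_mul _ (hm _ _), Fin.prod_univ_succ, mul_comm]

-- The two outputs are independent under the product law, so their variance proxies add up to `2σ²`;
-- both centred outputs have mean zero.
variable {S} in
theorem SimModel.IsSubGaussian.sub {σ : ℝ≥0} (hS : S.IsSubGaussian σ) (a b : Grid d N) :
    HasSubgaussianMGF (fun p : S.Y × S.Y => S.F a p.1 - S.F b p.2 -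
      (S.objective a - S.objective b)) (2 * σ ^ 2) ((S.law a).prod (S.law b)) ∧
    ∫ p, S.F a p.1 - S.F b p.2 - (S.objective a - S.objective b) ∂((S.law a).prod (S.law b)) =
      0 := by
  have hma := S.measurable_F a
  have hmb := S.measurable_F b
  have h1 : HasSubgaussianMGF (fun p : S.Y × S.Y => S.F a p.1 - S.objective a) (σ ^ 2)
      ((S.law a).prod (S.law b)) :=
    HasSubgaussianMGF.of_map (Y := Prod.fst) (X := fun y => S.F a y - S.objective a)
      measurable_fst.aemeasurable (by rw [Measure.map_fst_prod]; simpa using hS a)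
  have h2 : HasSubgaussianMGF (fun p : S.Y × S.Y => S.F b p.2 - S.objective b) (σ ^ 2)
      ((S.law a).prod (S.law b)) :=
    HasSubgaussianMGF.of_map (Y := Prod.snd) (X := fun y => S.F b y - S.objective b)
      measurable_snd.aemeasurable (by rw [Measure.map_snd_prod]; simpa using hS b)
  have hz : ∀ x, ∫ y, S.F x y - S.objective x ∂S.law x = 0 := fun x => by
    have hi : Integrable (S.F x) (S.law x) := by
      have := (hS x).integrable.add (integrable_const (S.objective x))
      refine this.congr (ae_of_all _ fun y => ?_)
      simp
    rw [integral_sub hi (integrable_const _)]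
    simp [SimModel.objective]
  have e : (fun p : S.Y × S.Y => S.F a p.1 - S.F b p.2 - (S.objective a - S.objective b)) =
      fun p => (S.F a p.1 - S.objective a) - (S.F b p.2 - S.objective b) := by
    funext p; ring
  rw [e]
  refine ⟨?_, ?_⟩
  · rw [two_mul]
    exact h1.sub_of_indepFun h2 (indepFun_prod (X := fun y => S.F a y - S.objective a)
      (Y := fun y => S.F b y - S.objective b) (by fun_prop) (by fun_prop))
  · rw [integral_sub h1.integrable h2.integrable,
      integral_fun_fst (fun y => S.F a y - S.objective a),
      integral_fun_snd (fun y => S.F b y - S.objective b), hz, hz]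
    simp

variable {S} in
/-- The exponential moment of one coordinate of the truncated stochastic subgradient. -/
theorem SimModel.IsSubGaussian.lintegral_exp_clip_le {σ : ℝ≥0} (hS : S.IsSubGaussian σ)
    {L s l B : ℝ} (hs : 0 ≤ s) (hl : 0 < l)
    (hB : 2 / l * Real.exp (-l * s + σ ^ 2 * l ^ 2) ≤ B) (a b : Grid d N)
    (hab : |S.objective a - S.objective b| ≤ L) (t : ℝ) :
    ∫⁻ y, ∫⁻ y', ENNReal.ofReal (Real.exp (t * clip (L + s) (S.F a y - S.F b y'))) ∂S.law b
      ∂S.law a ≤ ENNReal.ofReal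
        (Real.exp (t * (S.objective a - S.objective b) + |t| * B + 2 * σ ^ 2 * t ^ 2)) := by
  have hma := S.measurable_F a
  have hmb := S.measurable_F b
  have hc := measurable_clip (L + s)
  have hL : 0 ≤ L := (abs_nonneg _).trans hab
  obtain ⟨hsg, hz⟩ := hS.sub a b
  have hZ : Measurable fun p : S.Y × S.Y => S.F a p.1 - S.F b p.2 := by fun_prop
  obtain ⟨h1, h2⟩ := integral_exp_contraction_le hZ hsg hc (abs_clip_sub_clip_le _)
    (abs_clip_le (M := L + s) (by linarith)) t
  have h3 := abs_integral_clip_sub_le hZ hsg hz hab hs hl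
  rw [← lintegral_prod (fun p : S.Y × S.Y => ENNReal.ofReal
      (Real.exp (t * clip (L + s) (S.F a p.1 - S.F b p.2)))) (by fun_prop),
    ← ofReal_integral_eq_lintegral_ofReal h1 (ae_of_all _ fun _ => Real.exp_nonneg _)]
  refine ENNReal.ofReal_le_ofReal (h2.trans (Real.exp_le_exp.2 ?_))
  push_cast at h3 ⊢
  have h4 : 2 / l * Real.exp (-l * s + 2 * (σ : ℝ) ^ 2 * l ^ 2 / 2) ≤ B := by
    refine le_trans (le_of_eq ?_) hB
    ring_nf
  set I := ∫ p, clip (L + s) (S.F a p.1 - S.F b p.2) ∂((S.law a).prod (S.law b))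
  have h5 : t * (I - (S.objective a - S.objective b)) ≤ |t| * B :=
    (le_abs_self _).trans (by
      rw [abs_mul]
      exact mul_le_mul_of_nonneg_left (h3.trans h4) (abs_nonneg _))
  linarith

variable {S} in
/-- The exponential moment of the truncated stochastic subgradient in a direction `w`. -/
theorem SimModel.IsSubGaussian.expect_stochSubgradient_le {σ : ℝ≥0} (hS : S.IsSubGaussian σ)
    (hN : 2 ≤ N) {L s l B : ℝ} (hL : S.IsLipschitz L) (hs : 0 ≤ s) (hl : 0 < l)
    (hB : 2 / l * Real.exp (-l * s + σ ^ 2 * l ^ 2) ≤ B) (x w : Fin d → ℝ) :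
    expect S (stochSubgradient hN x) (fun g =>
      ENNReal.ofReal (Real.exp (∑ j, w j * truncate (L + s) g j))) ≤
    ENNReal.ofReal (Real.exp (∑ j, (w j * subgradient hN S.objective x j + |w j| * B +
      2 * σ ^ 2 * w j ^ 2))) := by
  set π := consistentPerm N x with hπ
  have hc := measurable_clip (L + s)
  -- In the order of the chain, coordinate `j` of the subgradient depends only on the `j`-th value
  -- of each of the two batches. The exponential moment therefore factorizes and the variance
  -- proxies of the coordinates add.
  have hprod : ∀ u : Fin d → ℝ, ENNReal.ofReal (Real.exp (∑ j, u j)) =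
      ∏ j, ENNReal.ofReal (Real.exp (u (π j))) := by
    intro u
    rw [← Equiv.sum_comp π, Real.exp_sum, ENNReal.ofReal_prod_of_nonneg fun _ _ =>
      Real.exp_nonneg _]
  rw [hprod]
  simp only [stochSubgradient, expect_bind, expect, hprod, truncate, ← hπ,
    Equiv.symm_apply_apply]
  have h1 : ∀ a : Fin d → ℝ, expect S (collect d fun i : Fin d => neighbor hN x i) (fun b =>
      ∏ j : Fin d, ENNReal.ofReal (Real.exp (w (π j) * max (min (a j - b j) (L + s)) (-(L + s))))) =
      ∏ j : Fin d, ∫⁻ y', ENNReal.ofReal (Real.exp (w (π j) *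
        clip (L + s) (a j - S.F (neighbor hN x j) y'))) ∂S.law (neighbor hN x j) := fun a =>
    expect_collect_prod S d _ (fun (j : Fin d) r => ENNReal.ofReal (Real.exp (w (π j) *
      clip (L + s) (a j - r)))) fun j => by fun_prop
  simp only [h1]
  rw [expect_collect_prod S d _ (fun (j : Fin d) r => ∫⁻ y', ENNReal.ofReal (Real.exp (w (π j) *
        clip (L + s) (r - S.F (neighbor hN x j) y'))) ∂S.law (neighbor hN x j)) fun j => by
      have := S.measurable_F (neighbor hN x j)
      refine Measurable.lintegral_prod_right' (f := fun p : ℝ × S.Y => ENNReal.ofReal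
        (Real.exp (w (π j) * clip (L + s) (p.1 - S.F (neighbor hN x j) p.2)))) ?_
      fun_prop]
  refine Finset.prod_le_prod' fun j _ => ?_
  have := hS.lintegral_exp_clip_le hs hl hB (neighbor hN x (j + 1)) (neighbor hN x j)
    (hL _ _ fun i => by
      rw [neighbor_apply, neighbor_apply, abs_le]
      split_ifs <;> omega) (w (π j))
  refine this.trans (le_of_eq ?_)
  simp only [subgradient, ← hπ, Equiv.symm_apply_apply]

end SubgradientMoments

/-! ### High-probability bounds for the stochastic subgradient method -/

section HighProbability

open SimProgram

variable {d N : ℕ} {S : SimModel.{u} d N}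

namespace SimProgram

variable {α β : Type}

/-- The union bound for sequential composition: either the first stage ends in the bad set `B`, or
the second stage fails from a good start. -/
theorem expect_bind_le (S : SimModel.{u} d N) (p : SimProgram (Grid d N) α)
    (g : α → SimProgram (Grid d N) β) {B : Set α} {φ : β → ℝ≥0∞} {r : ℝ≥0∞} (hφ : ∀ b, φ b ≤ 1)
    (h : ∀ a, a ∉ B → expect S (g a) φ ≤ r) :
    expect S (p.bind g) φ ≤ expect S p (B.indicator 1) + r := by
  rw [expect_bind, ← expect_add_const]
  refine expect_mono S p fun a => ?_
  by_cases ha : a ∈ B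
  · rw [Set.indicator_of_mem ha]
    refine le_trans ?_ le_self_add
    exact (expect_mono S _ hφ).trans (expect_const S _ 1).le
  · rw [Set.indicator_of_notMem ha, zero_add]
    exact h a ha

/-- Additivity, unlike adding a constant, needs measurability; it is imported from the genuine
integral over the sample space. -/
theorem IsUniform.expect_sum [MeasurableSpace α] {m : ℕ} {p : SimProgram (Grid d N) α}
    (hp : IsUniform m fun _ : Unit => p) {ι : Type*} (s : Finset ι) (φ : ι → α → ℝ≥0∞)
    (hφ : ∀ i, Measurable (φ i)) :
    expect S p (fun a => ∑ i ∈ s, φ i a) = ∑ i ∈ s, expect S p (φ i) := by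
  have hrun : Measurable fun ω => p.run (S.outcome ω) 0 :=
    (hp.measurable_run S 0).comp (f := fun ω => ((), ω)) (by fun_prop)
  rw [← hp.lintegral_run S 0 (Finset.measurable_fun_sum s fun i _ => hφ i) (),
    lintegral_finsetSum s fun i _ => show Measurable fun ω => φ i (p.run (S.outcome ω) 0) from
      (hφ i).comp hrun]
  exact Finset.sum_congr rfl fun i _ => hp.lintegral_run S 0 (hφ i) ()

end SimProgram

/-! ### Exponential regret bounds for the projected steps -/

theorem sq_projBox_sub_le {lo hi u a : Fin d → ℝ} {j : Fin d} (h1 : lo j ≤ a j) (h2 : a j ≤ hi j) :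
    (projBox lo hi u j - a j) ^ 2 ≤ (u j - a j) ^ 2 := by
  rw [sq_le_sq]
  have h : projBox lo hi a j = a j := by
    simp only [projBox]; rw [min_eq_left h2, max_eq_left h1]
  conv_lhs => rw [← h]
  simp only [projBox]
  exact (abs_max_sub_max_le_abs _ _ _).trans
    ((abs_min_sub_min_le_max _ _ _ _).trans (by simp))

theorem projBox_mem {lo hi u : Fin d → ℝ} {j : Fin d} (h : lo j ≤ hi j) :
    lo j ≤ projBox lo hi u j ∧ projBox lo hi u j ≤ hi j :=
  ⟨le_max_right _ _, max_le (min_le_right _ _) h⟩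

/-- Projection onto the box is nonexpansive and fixes the point `a` in it; expanding the square and
bounding truncated coordinates by `M` gives the usual descent inequality. -/
theorem sum_sq_step_le {lo hi x a g : Fin d → ℝ} {M η : ℝ} (hM : 0 ≤ M)
    (ha : ∀ j, lo j ≤ a j ∧ a j ≤ hi j) :
    ∑ j, (projBox lo hi (x - η • truncate M g) j - a j) ^ 2 ≤
      ∑ j, (x j - a j) ^ 2 - 2 * η * ∑ j, truncate M g j * (x j - a j) + η ^ 2 * (d * M ^ 2) := by
  calc _ ≤ ∑ j, ((x j - a j) ^ 2 - 2 * η * (truncate M g j * (x j - a j)) + η ^ 2 * M ^ 2) := by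
        refine Finset.sum_le_sum fun j _ => (sq_projBox_sub_le (ha j).1 (ha j).2).trans ?_
        have h : truncate M g j ^ 2 ≤ M ^ 2 := by
          rw [← sq_abs]
          exact pow_le_pow_left₀ (abs_nonneg _) (abs_clip_le hM (g j)) 2
        have := mul_le_mul_of_nonneg_left h (sq_nonneg η)
        simp only [Pi.sub_apply, Pi.smul_apply, smul_eq_mul]
        nlinarith
    _ = _ := by
        rw [Finset.sum_add_distrib, Finset.sum_sub_distrib, ← Finset.mul_sum]
        simp
        ring

variable {σ : ℝ≥0} {L c : ℝ} {a : Grid d N}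

/-- The exponential supermartingale of the projected and truncated stochastic subgradient method. -/
theorem expect_ssgdLoop_le (hN : 2 ≤ N) (hd : 1 ≤ d) (hconv : LNaturalConvex S.objective)
    (hS : S.IsSubGaussian σ) (hL : S.IsLipschitz L) (hL0 : 0 ≤ L) (hc : 0 < c)
    (ha : S.IsOptimalWithGap c a) {s l B : ℝ} (hs : 0 ≤ s) (hl : 0 < l)
    (hB : 2 / l * Real.exp (-l * s + σ ^ 2 * l ^ 2) ≤ B)
    {lo hi : Fin d → ℝ} (hlo : ∀ i, 1 ≤ lo i) (hhi : ∀ i, hi i ≤ N)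
    (habox : ∀ i, lo i ≤ ((a i : ℤ) : ℝ) ∧ ((a i : ℤ) : ℝ) ≤ hi i)
    {W : ℝ} (hW : ∀ i, hi i - lo i ≤ W) {η t : ℝ} (hη : 0 < η) (ht : 0 < t)
    (z : Fin d → ℝ) (r : ℝ) (T : ℕ) (x v : Fin d → ℝ) (hx : ∀ i, lo i ≤ x i ∧ x i ≤ hi i)
    (φ : (Fin d → ℝ) → ℝ≥0∞)
    (hφ : ∀ y : Fin d → ℝ, (∀ i, v i + T * lo i ≤ y i ∧ y i ≤ v i + T * hi i) →
      φ y ≤ ENNReal.ofReal (Real.exp (t * (c * ‖y - z‖) + r))) :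
    expect S (ssgdLoop hN lo hi (L + s) η T x v) φ ≤
      ENNReal.ofReal (Real.exp (t * (c * ‖v + (T : ℝ) • (fun i => ((a i : ℤ) : ℝ)) - z‖) +
        t / (2 * η) * ∑ j, (x j - ((a j : ℤ) : ℝ)) ^ 2 +
        T * (t * (η * (d * (L + s) ^ 2) / 2 + d * (W * B)) + 2 * σ ^ 2 * t ^ 2 * (d * W ^ 2)) +
        r)) := by
  set A : Fin d → ℝ := fun i => ((a i : ℤ) : ℝ) with hA
  set K := t * (η * (d * (L + s) ^ 2) / 2 + d * (W * B)) + 2 * σ ^ 2 * t ^ 2 * (d * W ^ 2) with hK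
  have hB0 : 0 ≤ B := le_trans (by positivity) hB
  have : Nonempty (Fin d) := ⟨⟨0, hd⟩⟩
  induction T generalizing x v with
  | zero =>
    refine (hφ v fun i => by simp).trans (ENNReal.ofReal_le_ofReal (Real.exp_le_exp.2 ?_))
    have : 0 ≤ t / (2 * η) * ∑ j, (x j - A j) ^ 2 :=
      mul_nonneg (by positivity) (Finset.sum_nonneg fun j _ => sq_nonneg _)
    simp only [Nat.cast_zero, zero_smul, add_zero, zero_mul]
    linarith
  | succ T ih =>
    simp only [ssgdLoop, expect_bind]
    -- In the potential all remaining iterates are replaced by `A`. Adding the actual iterate `x`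
    -- costs `c ‖x - A‖`, and the change of the squared distance releases `-⟨ĝ, x - A⟩`; the random
    -- factor is isolated so that its exponential moment can be taken.
    have hstep : ∀ g : Fin d → ℝ, expect S (ssgdLoop hN lo hi (L + s) η T
        (projBox lo hi (x - η • truncate (L + s) g)) (v + x)) φ ≤
        ENNReal.ofReal (Real.exp (t * (c * ‖v + ((T + 1 : ℕ) : ℝ) • A - z‖) +
          t * (c * ‖x - A‖) + t / (2 * η) * ∑ j, (x j - A j) ^ 2 +
          t * (η * (d * (L + s) ^ 2) / 2) + T * K + r)) *
        ENNReal.ofReal (Real.exp (∑ j, (-t * (x j - A j)) * truncate (L + s) g j)) := by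
      intro g
      refine (ih _ (v + x) (fun i => projBox_mem ((hx i).1.trans (hx i).2)) fun y hy =>
        hφ y fun i => ?_).trans ?_
      · have h1 := hy i; have h2 := hx i
        simp only [Pi.add_apply] at h1
        push_cast
        constructor <;> linarith
      · rw [← ENNReal.ofReal_mul (Real.exp_nonneg _), ← Real.exp_add]
        refine ENNReal.ofReal_le_ofReal (Real.exp_le_exp.2 ?_)
        have h1 := sum_sq_step_le (x := x) (a := A) (g := g) (M := L + s) (η := η)
          (by linarith) habox
        have h2 := mul_le_mul_of_nonneg_left h1 (show 0 ≤ t / (2 * η) by positivity)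
        have h3 : ∑ j, (-t * (x j - A j)) * truncate (L + s) g j =
            -t * ∑ j, truncate (L + s) g j * (x j - A j) := by
          rw [Finset.mul_sum]
          exact Finset.sum_congr rfl fun j _ => by ring
        have h4 : t / (2 * η) * (∑ j, (x j - A j) ^ 2 -
            2 * η * ∑ j, truncate (L + s) g j * (x j - A j) + η ^ 2 * (d * (L + s) ^ 2)) =
            t / (2 * η) * ∑ j, (x j - A j) ^ 2 + -t * ∑ j, truncate (L + s) g j * (x j - A j) +
              t * (η * (d * (L + s) ^ 2) / 2) := by
          field_simp
          ring
        have h5 : ‖v + x + (T : ℝ) • A - z‖ ≤ ‖v + ((T + 1 : ℕ) : ℝ) • A - z‖ + ‖x - A‖ := by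
          refine le_trans (le_of_eq ?_) (norm_add_le _ _)
          congr 1
          push_cast
          rw [add_smul, one_smul]
          abel
        have h6 := mul_le_mul_of_nonneg_left h5 (mul_pos ht hc).le
        rw [h3]
        linarith
    refine (expect_mono S _ hstep).trans ?_
    rw [expect_const_mul S _ _ ENNReal.ofReal_ne_top]
    refine (mul_le_mul_right (hS.expect_stochSubgradient_le hN hL hs hl hB x
      (fun j => -t * (x j - A j))) _).trans ?_
    rw [← ENNReal.ofReal_mul (Real.exp_nonneg _), ← Real.exp_add]
    refine ENNReal.ofReal_le_ofReal (Real.exp_le_exp.2 ?_)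
    have hxW : ∀ j, |x j - A j| ≤ W := fun j => by
      have h1 := hx j; have h2 := habox j; have h3 := hW j
      rw [abs_le]; constructor <;> linarith
    -- This closes the recursion: the mean drift `-t ⟨g, x - A⟩` pays for the term `t c ‖x - A‖`.
    -- Only the step size, bias and variance terms collected in `K` remain.
    have hsharp : c * ‖x - A‖ ≤ ∑ j, subgradient hN S.objective x j * (x j - A j) := by
      rw [← le_div_iff₀' hc, pi_norm_le_iff_of_nonempty]
      intro j
      rw [le_div_iff₀' hc]
      exact hconv.sharp_subgradient hN hc ha (fun i => (hlo i).trans (hx i).1)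
        (fun i => (hx i).2.trans (hhi i)) j
    have h7 : ∑ j, (-t * (x j - A j) * subgradient hN S.objective x j +
        |-t * (x j - A j)| * B + 2 * σ ^ 2 * (-t * (x j - A j)) ^ 2) ≤
        -t * ∑ j, subgradient hN S.objective x j * (x j - A j) +
          d * (t * (W * B) + 2 * σ ^ 2 * t ^ 2 * W ^ 2) := by
      have : ∀ j, -t * (x j - A j) * subgradient hN S.objective x j +
          |-t * (x j - A j)| * B + 2 * σ ^ 2 * (-t * (x j - A j)) ^ 2 ≤
          -t * (subgradient hN S.objective x j * (x j - A j)) +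
            (t * (W * B) + 2 * σ ^ 2 * t ^ 2 * W ^ 2) := by
        intro j
        have e1 : |-t * (x j - A j)| = t * |x j - A j| := by
          rw [abs_mul, abs_neg, abs_of_pos ht]
        have e2 : (x j - A j) ^ 2 ≤ W ^ 2 := by
          rw [← sq_abs]; exact pow_le_pow_left₀ (abs_nonneg _) (hxW j) 2
        have e3 : t * |x j - A j| * B ≤ t * W * B := by gcongr; exact hxW j
        have e4 : 2 * (σ : ℝ) ^ 2 * t ^ 2 * (x j - A j) ^ 2 ≤ 2 * σ ^ 2 * t ^ 2 * W ^ 2 := by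
          gcongr
        rw [e1]
        linarith
      refine (Finset.sum_le_sum fun j _ => this j).trans (le_of_eq ?_)
      rw [Finset.sum_add_distrib, ← Finset.mul_sum, Finset.sum_const, Finset.card_univ,
        Fintype.card_fin, nsmul_eq_mul]
    have h8 := mul_le_mul_of_nonneg_left hsharp ht.le
    have h9 : t * (η * (d * (L + s) ^ 2) / 2) + d * (t * (W * B) + 2 * σ ^ 2 * t ^ 2 * W ^ 2) =
      K := by rw [hK]; ring
    have h10 : (((T + 1 : ℕ) : ℝ)) * K = T * K + K := by push_cast; ring
    rw [h10]
    linarith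

/-- With high probability, the average of the iterates is close to the optimal system. -/
theorem expect_ssgd_le (hN : 2 ≤ N) (hd : 1 ≤ d) (hσ : 0 < σ)
    (hconv : LNaturalConvex S.objective)
    (hS : S.IsSubGaussian σ) (hL : S.IsLipschitz L) (hL0 : 0 ≤ L) (hc : 0 < c)
    (ha : S.IsOptimalWithGap c a) {s l B : ℝ} (hs : 0 < s) (hl : 0 < l)
    (hB : 2 / l * Real.exp (-l * s + σ ^ 2 * l ^ 2) ≤ B)
    {lo hi : Fin d → ℝ} (hlo : ∀ i, 1 ≤ lo i) (hhi : ∀ i, hi i ≤ N)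
    (habox : ∀ i, lo i ≤ ((a i : ℤ) : ℝ) ∧ ((a i : ℤ) : ℝ) ≤ hi i)
    {W : ℝ} (hW0 : 0 < W) (hW : ∀ i, hi i - lo i ≤ W) {T : ℕ} (hT : 0 < T) {δ : ℝ} (hδ : 0 < δ)
    (hTM : 16 * d * (L + s) ≤ c * √T) (hBc : 16 * d * B ≤ c)
    (hTδ : 512 * σ ^ 2 * d / c ^ 2 * Real.log (1 / δ) ≤ T)
    (x : Fin d → ℝ) (hx : ∀ i, lo i ≤ x i ∧ x i ≤ hi i) :
    expect S (ssgd hN lo hi T (L + s) (stepSize W (L + s) T) x)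
      ({y : Fin d → ℝ | (∀ i, lo i ≤ y i ∧ y i ≤ hi i) ∧
        ∀ i, |y i - ((a i : ℤ) : ℝ)| ≤ W / 4}ᶜ.indicator 1) ≤ ENNReal.ofReal δ := by
  set G : Set (Fin d → ℝ) := {y | (∀ i, lo i ≤ y i ∧ y i ≤ hi i) ∧
    ∀ i, |y i - ((a i : ℤ) : ℝ)| ≤ W / 4} with hG
  set A : Fin d → ℝ := fun i => ((a i : ℤ) : ℝ) with hA
  have hT' : (0 : ℝ) < T := by exact_mod_cast hT
  have hd' : (0 : ℝ) < d := by exact_mod_cast hd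
  have hσ' : (0 : ℝ) < σ := by exact_mod_cast hσ
  have hM : 0 < L + s := by linarith
  have hsT : 0 < √(T : ℝ) := Real.sqrt_pos.2 hT'
  set η := stepSize W (L + s) T with hη
  have hη0 : 0 < η := by rw [hη, stepSize]; positivity
  -- Chosen so that the variance term in the exponent is exactly `t W c T / 16`.
  set t : ℝ := c / (32 * σ ^ 2 * d * W) with ht
  have ht0 : 0 < t := by positivity
  simp only [ssgd, expect_bind, expect]
  -- Chernoff's bound: with `z = T A` the norm in the initial potential vanishes, and the offset `r
  -- = -t c T W / 4` makes the exponential at least `1` on the failure event. The average always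
  -- lies in the box, so failure can only be a deviation beyond `W / 4` in some coordinate.
  have hmain := expect_ssgdLoop_le hN hd hconv hS hL hL0 hc ha hs.le hl hB hlo hhi habox hW hη0 ht0
    ((T : ℝ) • A) (-(t * (c * (T * (W / 4))))) T x 0 hx
    (fun y => (Gᶜ.indicator 1 ((T : ℝ)⁻¹ • y) : ℝ≥0∞)) (by
      intro y hy
      by_cases hyG : (T : ℝ)⁻¹ • y ∈ G
      · simp [hyG]
      · rw [Set.indicator_of_mem (show (T : ℝ)⁻¹ • y ∈ Gᶜ from hyG), Pi.one_apply,
          ← ENNReal.ofReal_one]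
        refine ENNReal.ofReal_le_ofReal (Real.one_le_exp ?_)
        have hbox : ∀ i, lo i ≤ ((T : ℝ)⁻¹ • y) i ∧ ((T : ℝ)⁻¹ • y) i ≤ hi i := fun i => by
          have := hy i
          simp only [Pi.zero_apply, zero_add] at this
          simp only [Pi.smul_apply, smul_eq_mul]
          rw [inv_mul_eq_div, le_div_iff₀ hT', div_le_iff₀ hT']
          constructor <;> linarith
        simp only [hG, Set.mem_ofPred_eq, not_and, not_forall, not_le] at hyG
        obtain ⟨i, hi⟩ := hyG hbox
        have h1 : T * (W / 4) ≤ ‖y - (T : ℝ) • A‖ := by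
          refine le_trans ?_ (norm_le_pi_norm (y - (T : ℝ) • A) i)
          have e : (y - (T : ℝ) • A) i = T * (((T : ℝ)⁻¹ • y) i - A i) := by
            simp only [Pi.sub_apply, Pi.smul_apply, smul_eq_mul]
            field_simp
          rw [e, Real.norm_eq_abs, abs_mul, abs_of_pos hT']
          exact mul_le_mul_of_nonneg_left hi.le hT'.le
        have := mul_le_mul_of_nonneg_left h1 (mul_pos ht0 hc).le
        linarith)
  refine hmain.trans ?_
  rw [← Real.exp_log hδ]
  refine ENNReal.ofReal_le_ofReal (Real.exp_le_exp.2 ?_)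
  have h0 : ‖(0 : Fin d → ℝ) + (T : ℝ) • A - (T : ℝ) • A‖ = 0 := by simp
  rw [h0]
  have hD : ∑ j, (x j - A j) ^ 2 ≤ d * W ^ 2 := by
    have : ∀ j, (x j - A j) ^ 2 ≤ W ^ 2 := fun j => by
      rw [← sq_abs]
      refine pow_le_pow_left₀ (abs_nonneg _) ?_ 2
      have h1 := hx j; have h2 := habox j; have h3 := hW j
      rw [abs_le]; constructor <;> linarith
    refine (Finset.sum_le_sum fun j _ => this j).trans (le_of_eq ?_)
    simp
  have hD' := mul_le_mul_of_nonneg_left hD (show 0 ≤ t / (2 * η) by positivity)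
  have hsq : √(T : ℝ) * √(T : ℝ) = T := Real.mul_self_sqrt hT'.le
  -- The step size equalizes the distance and squared gradient terms. Together they cost at most `t
  -- W c T / 16`, and so do the bias and the variance separately; against the offset `-4/16` a net
  -- `-t W c T / 16 = -T c² / (512 σ² d) ≤ log δ` remains.
  have e1 : t / (2 * η) * (d * W ^ 2) = t * W * (d * (L + s)) * √T / 2 := by
    rw [hη, stepSize]; field_simp
  have e2 : (T : ℝ) * (t * (η * (d * (L + s) ^ 2) / 2)) = t * W * (d * (L + s)) * √T / 2 := by
    rw [hη, stepSize]; field_simp; rw [sq]; linear_combination (-1 : ℝ) * hsq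
  have e3 : t * W * (d * (L + s)) * √T ≤ t * W * c * T / 16 := by
    have := mul_le_mul_of_nonneg_left hTM (show 0 ≤ t * W * √T / 16 by positivity)
    calc _ = t * W * √T / 16 * (16 * d * (L + s)) := by ring
      _ ≤ _ := this
      _ = t * W * c * (√T * √T) / 16 := by ring
      _ = _ := by rw [hsq]
  have e4 : (T : ℝ) * (t * (d * (W * B))) ≤ t * W * c * T / 16 := by
    have := mul_le_mul_of_nonneg_left hBc (show 0 ≤ t * W * T / 16 by positivity)
    linarith
  have e5 : (T : ℝ) * (2 * σ ^ 2 * t ^ 2 * (d * W ^ 2)) = t * W * c * T / 16 := by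
    rw [ht]; field_simp; ring
  have e6 : t * W * c * T / 16 = T * (c ^ 2 / (512 * σ ^ 2 * d)) := by
    rw [ht]; field_simp; ring
  have e7 : Real.log (1 / δ) ≤ T * (c ^ 2 / (512 * σ ^ 2 * d)) := by
    have := mul_le_mul_of_nonneg_right hTδ (show 0 ≤ c ^ 2 / (512 * (σ : ℝ) ^ 2 * d) by positivity)
    refine le_trans (le_of_eq ?_) this
    field_simp
  rw [one_div, Real.log_inv] at e7
  linarith

/-- The failure probability of the first `e + 1` epochs. -/
theorem expect_epochResult_le (hN : 2 ≤ N) (hd : 1 ≤ d) (hσ : 0 < σ)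
    (hconv : LNaturalConvex S.objective)
    (hS : S.IsSubGaussian σ) (hL : S.IsLipschitz L) (hL0 : 0 ≤ L) (hc : 0 < c)
    (ha : S.IsOptimalWithGap c a) {s l B : ℝ} (hs : 0 < s) (hl : 0 < l)
    (hB : 2 / l * Real.exp (-l * s + σ ^ 2 * l ^ 2) ≤ B)
    {T : ℕ} (hT : 0 < T) {δ : ℝ} (hδ : 0 < δ)
    (hTM : 16 * d * (L + s) ≤ c * √T) (hBc : 16 * d * B ≤ c)
    (hTδ : 512 * σ ^ 2 * d / c ^ 2 * Real.log (1 / δ) ≤ T) (e : ℕ) :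
    expect S (epochResult hN (fun _ => T) (fun _ => L + s) e)
      ({y : Fin d → ℝ | (∀ i, 1 ≤ y i ∧ y i ≤ N) ∧
        ∀ i, |y i - ((a i : ℤ) : ℝ)| ≤ N / 2 ^ (e + 2)}ᶜ.indicator 1) ≤
      ENNReal.ofReal ((e + 1) * δ) := by
  have hN' : (2 : ℝ) ≤ N := by exact_mod_cast hN
  have ha1 : ∀ i, (1 : ℝ) ≤ ((a i : ℤ) : ℝ) ∧ ((a i : ℤ) : ℝ) ≤ N := fun i => by
    have := (a i).2
    simp only [Set.mem_Icc] at this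
    exact ⟨by exact_mod_cast this.1, by exact_mod_cast this.2⟩
  induction e with
  | zero =>
    have := expect_ssgd_le hN hd hσ hconv hS hL hL0 hc ha hs hl hB (lo := fun _ => 1)
      (hi := fun _ => (N : ℝ)) (fun _ => le_rfl) (fun _ => le_rfl) ha1 (W := boxWidth N 0)
      (by simp only [boxWidth]; positivity) (fun i => by simp [boxWidth]) hT hδ hTM hBc hTδ
      (fun _ => (N : ℝ) / 2) (fun i => ⟨by linarith, by linarith⟩)
    have e1 : (N : ℝ) / 2 ^ (0 + 2) = boxWidth N 0 / 4 := by simp only [boxWidth]; ring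
    have e2 : (((0 : ℕ) : ℝ) + 1) * δ = δ := by simp
    rw [e1, e2]
    exact this
  | succ e ih =>
    have e2 : (((e + 1 : ℕ) : ℝ) + 1) * δ = (e + 1) * δ + δ := by push_cast; ring
    rw [e2, ENNReal.ofReal_add (by positivity) hδ.le]
    simp only [epochResult]
    refine (expect_bind_le S _ _ (B := {y : Fin d → ℝ | (∀ i, 1 ≤ y i ∧ y i ≤ N) ∧
        ∀ i, |y i - ((a i : ℤ) : ℝ)| ≤ N / 2 ^ (e + 2)}ᶜ) (r := ENNReal.ofReal δ)
        (fun b => Set.indicator_le_self _ _ b) fun x hx => ?_).trans (add_le_add_left ih _)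
    simp only [Set.mem_compl_iff, Set.mem_ofPred_eq, not_not] at hx
    obtain ⟨hx1, hx2⟩ := hx
    have hr : (0 : ℝ) < N / 2 ^ (e + 2) := by positivity
    -- The accuracy `W / 4` of one epoch is the radius of the next box, whose side is therefore half
    -- as long and which still contains the minimizer.
    have hW : boxWidth N (e + 1) = 2 * (N / 2 ^ (e + 2)) := by
      simp only [boxWidth]; rw [pow_succ, pow_succ, pow_succ]; field_simp
    refine le_trans (expect_mono S _ fun y => ?_) (expect_ssgd_le hN hd hσ hconv hS hL hL0 hc ha hs
      hl hB (lo := fun i => max 1 (x i - N / 2 ^ (e + 2)))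
      (hi := fun i => min (N : ℝ) (x i + N / 2 ^ (e + 2)))
      (fun i => le_max_left _ _) (fun i => min_le_left _ _)
      (fun i => ?_) (W := boxWidth N (e + 1)) (by rw [hW]; positivity) (fun i => ?_)
      hT hδ hTM hBc hTδ x (fun i => ?_))
    · refine Set.indicator_le_indicator_of_subset (Set.compl_subset_compl.2 ?_)
        (fun _ => zero_le_one) y
      rintro y ⟨hy1, hy2⟩
      refine ⟨fun i => ⟨(le_max_left _ _).trans (hy1 i).1, (hy1 i).2.trans (min_le_left _ _)⟩,
        fun i => (hy2 i).trans (le_of_eq ?_)⟩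
      simp only [boxWidth]
      rw [show e + 1 + 2 = (e + 1) + 1 + 1 from rfl, pow_succ _ (e + 1 + 1), pow_succ _ (e + 1)]
      field_simp
      ring
    · have h1 := abs_le.1 (hx2 i); have h2 := ha1 i
      exact ⟨max_le h2.1 (by linarith), le_min h2.2 (by linarith)⟩
    · have h1 := le_max_right 1 (x i - (N : ℝ) / 2 ^ (e + 2))
      have h2 := min_le_right (N : ℝ) (x i + (N : ℝ) / 2 ^ (e + 2))
      rw [hW]; linarith
    · have h2 := hx1 i
      exact ⟨max_le h2.1 (by linarith), le_min h2.2 (by linarith)⟩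

/-! ### The rounding process -/

/-- Exponential moments multiply over independent replications; keeping an arbitrary weight `w`
allows the difference of two sums to be treated directly. -/
theorem expect_collectSums_exp_le (hS : S.IsSubGaussian σ) {m : ℕ} (x : Fin m → Grid d N)
    (w : Fin m → ℝ) (n : ℕ) :
    expect S (collectSums x n) (fun v => ENNReal.ofReal (Real.exp (∑ k, w k * v k))) ≤
      ENNReal.ofReal (Real.exp (n * ∑ k, (w k * S.objective (x k) + σ ^ 2 * w k ^ 2 / 2))) := by
  have hone : expect S (collect m x) (fun v => ENNReal.ofReal (Real.exp (∑ k, w k * v k))) ≤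
      ENNReal.ofReal (Real.exp (∑ k, (w k * S.objective (x k) + σ ^ 2 * w k ^ 2 / 2))) := by
    simp only [Real.exp_sum, ENNReal.ofReal_prod_of_nonneg fun _ _ => Real.exp_nonneg _]
    rw [expect_collect_prod S m x (fun k r => ENNReal.ofReal (Real.exp (w k * r)))
      fun k => by fun_prop]
    refine Finset.prod_le_prod' fun k _ => ?_
    have h1 := hS (x k)
    have e : ∀ y, Real.exp (w k * S.F (x k) y) = Real.exp (w k * S.objective (x k)) *
        Real.exp (w k * (S.F (x k) y - S.objective (x k))) := fun y => by
      rw [← Real.exp_add]; ring_nf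
    simp_rw [e]
    rw [← ofReal_integral_eq_lintegral_ofReal ((h1.integrable_exp_mul _).const_mul _)
      (ae_of_all _ fun _ => by positivity), integral_const_mul, Real.exp_add]
    refine ENNReal.ofReal_le_ofReal (mul_le_mul_of_nonneg_left ?_ (Real.exp_nonneg _))
    have h2 := h1.mgf_le (w k)
    rw [mgf] at h2
    push_cast at h2
    exact h2
  induction n with
  | zero => simp [collectSums, expect]
  | succ n ih =>
    simp only [collectSums, expect_bind, expect]
    have e : ∀ v u : Fin m → ℝ, ENNReal.ofReal (Real.exp (∑ k, w k * (v + u) k)) =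
        ENNReal.ofReal (Real.exp (∑ k, w k * v k)) * ENNReal.ofReal (Real.exp (∑ k, w k * u k)) := by
      intro v u
      rw [← ENNReal.ofReal_mul (Real.exp_nonneg _), ← Real.exp_add, ← Finset.sum_add_distrib]
      simp only [Pi.add_apply, mul_add]
    simp only [e, expect_const_mul S _ _ ENNReal.ofReal_ne_top]
    refine (expect_mono S _ fun v => mul_le_mul_right ih _).trans ?_
    simp only [mul_comm _ (ENNReal.ofReal (Real.exp (n * _)))]
    rw [expect_const_mul S _ _ ENNReal.ofReal_ne_top]
    refine (mul_le_mul_right hone _).trans (le_of_eq ?_)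
    rw [← ENNReal.ofReal_mul (Real.exp_nonneg _), ← Real.exp_add]
    push_cast
    rw [add_mul, one_mul]

theorem argminIndex_le {m : ℕ} (v : Fin (m + 1) → ℝ) (j : Fin (m + 1)) :
    v (argminIndex v) ≤ v j := ((argminIndex_eq_iff v _).1 rfl).1 j

/-- An incorrect point is returned only if its sum is at most that of the optimal neighbour. Each
such comparison is a Chernoff bound with gap `c`, and there are at most `d + 1` of them. -/
theorem expect_roundPoint_le (hN : 2 ≤ N) (hσ : 0 < σ)
    (hS : S.IsSubGaussian σ) (hc : 0 < c) (ha : S.IsOptimalWithGap c a) {δ : ℝ} (hδ : 0 < δ)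
    (hδ1 : δ < 1) {x : Fin d → ℝ} {k₀ : Fin (d + 1)} (hk : neighbor hN x k₀ = a) :
    expect S (roundPoint hN σ (c / 2) δ x) (({a} : Set (Grid d N))ᶜ.indicator 1) ≤
      ENNReal.ofReal (δ / 2) := by
  have hσ' : (0 : ℝ) < σ := by exact_mod_cast hσ
  have hX : (1 : ℝ) < 8 * (d + 1) / δ := by
    rw [lt_div_iff₀ hδ]
    have : (0 : ℝ) ≤ d := by positivity
    linarith
  have hlog : 0 < Real.log (8 * (d + 1) / δ) := Real.log_pos hX
  set n := roundingReplications σ d (c / 2) δ with hn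
  have hn1 : 32 * σ ^ 2 / (c / 2) ^ 2 * Real.log (8 * (d + 1) / δ) ≤ n := Nat.le_ceil _
  have hn0 : (0 : ℝ) < n := lt_of_lt_of_le (by positivity) hn1
  set X : Fin (d + 1) → Grid d N := fun k => neighbor hN x k with hXdef
  -- The minimizer of `-t c + σ² t²`, with minimum `-c² / (4σ²)`.
  set t : ℝ := c / (2 * σ ^ 2) with ht
  have ht0 : 0 < t := by positivity
  simp only [roundPoint, expect_bind, expect]
  have hunif : IsUniform (n * (d + 1)) fun _ : Unit => collectSums X n :=
    isUniform_collectSums measurable_const n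
  have hpt : ∀ v : Fin (d + 1) → ℝ,
      (({a} : Set (Grid d N))ᶜ.indicator 1 (neighbor hN x (argminIndex fun k => v k / (n : ℝ))) :
        ℝ≥0∞) ≤ ∑ k ∈ Finset.univ.filter (fun k => X k ≠ a),
          ENNReal.ofReal (Real.exp (∑ j, (t * ((if j = k₀ then 1 else 0) -
            (if j = k then 1 else 0))) * v j)) := by
    intro v
    set k := argminIndex fun k => v k / (n : ℝ) with hkdef
    by_cases hka : X k = a
    · rw [Set.indicator_of_notMem]
      · exact zero_le
      · simpa [hXdef] using hka
    · refine le_trans ?_ (Finset.single_le_sum (f := fun k => ENNReal.ofReal (Real.exp (∑ j,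
        (t * ((if j = k₀ then 1 else 0) - (if j = k then 1 else 0))) * v j)))
        (fun _ _ => zero_le) (Finset.mem_filter.2 ⟨Finset.mem_univ k, hka⟩))
      refine (Set.indicator_le_self _ _ _).trans ?_
      rw [Pi.one_apply, ← ENNReal.ofReal_one]
      refine ENNReal.ofReal_le_ofReal (Real.one_le_exp ?_)
      have h1 := argminIndex_le (fun k => v k / (n : ℝ)) k₀
      simp only [← hkdef] at h1
      rw [div_le_div_iff_of_pos_right hn0] at h1
      simp only [mul_sub, sub_mul, Finset.sum_sub_distrib]
      simp
      nlinarith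
  refine (expect_mono S _ hpt).trans ?_
  rw [hunif.expect_sum _ _ fun k => by fun_prop]
  have hterm : ∀ k ∈ Finset.univ.filter (fun k => X k ≠ a),
      expect S (collectSums X n) (fun v => ENNReal.ofReal (Real.exp (∑ j,
        (t * ((if j = k₀ then 1 else 0) - (if j = k then 1 else 0))) * v j))) ≤
      ENNReal.ofReal (δ / (8 * (d + 1))) := by
    intro k hk'
    have hka : X k ≠ a := (Finset.mem_filter.1 hk').2
    have hkk : k ≠ k₀ := fun h => hka (by rw [h]; exact hk)
    refine (expect_collectSums_exp_le hS X _ n).trans ?_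
    have hgap := ha _ hka
    have e1 : ∑ j, (t * ((if j = k₀ then 1 else 0) - (if j = k then 1 else 0)) *
        S.objective (X j) + σ ^ 2 *
          (t * ((if j = k₀ then 1 else 0) - (if j = k then 1 else 0))) ^ 2 / 2) =
        t * (S.objective a - S.objective (X k)) + σ ^ 2 * t ^ 2 := by
      have : ∀ j, (t * ((if j = k₀ then 1 else 0) - (if j = k then 1 else 0)) *
        S.objective (X j) + σ ^ 2 *
          (t * ((if j = k₀ then 1 else 0) - (if j = k then 1 else 0))) ^ 2 / 2) =
          (if j = k₀ then t * S.objective (X j) + σ ^ 2 * t ^ 2 / 2 else 0) +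
          (if j = k then -(t * S.objective (X j)) + σ ^ 2 * t ^ 2 / 2 else 0) := by
        intro j
        by_cases h1 : j = k₀
        · by_cases h2 : j = k
          · exact absurd (h2.symm.trans h1) hkk
          · simp [h1, Ne.symm hkk]
        · by_cases h2 : j = k
          · simp [h2, hkk]
          · simp [h1, h2]
      simp_rw [this]
      rw [Finset.sum_add_distrib]
      have hk0 : X k₀ = a := hk
      simp [hk0]
      ring
    rw [e1]
    have hpos : 0 < δ / (8 * ((d : ℝ) + 1)) := by positivity
    rw [← Real.exp_log hpos]
    refine ENNReal.ofReal_le_ofReal (Real.exp_le_exp.2 ?_)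
    have hl : Real.log (δ / (8 * ((d : ℝ) + 1))) = -Real.log (8 * (d + 1) / δ) := by
      rw [← Real.log_inv, inv_div]
    rw [hl]
    have h2 : t * (S.objective a - S.objective (X k)) + σ ^ 2 * t ^ 2 ≤ -(c ^ 2 / (4 * σ ^ 2)) := by
      have h3 : t * (S.objective a - S.objective (X k)) ≤ t * (-c) :=
        mul_le_mul_of_nonneg_left (by linarith) ht0.le
      have h4 : t * (-c) + σ ^ 2 * t ^ 2 = -(c ^ 2 / (4 * σ ^ 2)) := by
        rw [ht]; field_simp; ring
      linarith
    have h5 := mul_le_mul_of_nonneg_left h2 hn0.le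
    have h6 := mul_le_mul_of_nonneg_right hn1 (show 0 ≤ c ^ 2 / (4 * (σ : ℝ) ^ 2) by positivity)
    have h7 : 32 * σ ^ 2 / (c / 2) ^ 2 * Real.log (8 * (d + 1) / δ) * (c ^ 2 / (4 * (σ : ℝ) ^ 2)) =
        32 * Real.log (8 * (d + 1) / δ) := by
      field_simp; ring
    linarith
  refine (Finset.sum_le_sum hterm).trans ?_
  rw [Finset.sum_const, nsmul_eq_mul]
  have hcard : (((Finset.univ.filter (fun k => X k ≠ a)).card : ℕ) : ℝ≥0∞) ≤
      ENNReal.ofReal (d + 1) := by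
    have h1 : (Finset.univ.filter (fun k => X k ≠ a)).card ≤ d + 1 :=
      (Finset.card_filter_le _ _).trans (by simp)
    have h2 : ENNReal.ofReal ((d : ℝ) + 1) = ((d + 1 : ℕ) : ℝ≥0∞) := by
      rw [← ENNReal.ofReal_natCast]; push_cast; rfl
    rw [h2]
    exact_mod_cast h1
  refine (mul_le_mul_left hcard _).trans ?_
  rw [← ENNReal.ofReal_mul (by positivity)]
  refine ENNReal.ofReal_le_ofReal ?_
  have : ((d : ℝ) + 1) * (δ / (8 * (d + 1))) = δ / 8 := by field_simp
  rw [this]; linarith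

/-- The probability guarantee of the adaptive stochastic subgradient method. -/
theorem isPCSIZ_adaptiveSSGD (hN : 2 ≤ N) (hd : 1 ≤ d) (hσ : 0 < σ) (hL0 : 0 ≤ L) (hc : 0 < c)
    {s l B : ℝ} (hs : 0 < s) (hl : 0 < l)
    (hB : 2 / l * Real.exp (-l * s + σ ^ 2 * l ^ 2) ≤ B)
    {T : ℕ} (hT : 0 < T) {δ : ℝ} (hδ : 0 < δ) (hδ1 : δ < 1)
    (hTM : 16 * d * (L + s) ≤ c * √T) (hBc : 16 * d * B ≤ c)
    (hTδ : 512 * σ ^ 2 * d / c ^ 2 * Real.log (1 / (δ / (2 * numEpochs N))) ≤ T) :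
    IsPCSIZAlgorithm c δ (modelClass.{u} d N σ L c)
      (adaptiveSSGD (d := d) hN σ c δ (fun _ => T) (fun _ => L + s)) := by
  have hunif := isUniform_adaptiveSSGD (d := d) hN σ c δ T (fun _ => L + s)
  refine ⟨hunif.isMeasurable_toAlgorithm _, ?_⟩
  rintro S ⟨hconv, hS, hL, a, ha⟩
  refine ⟨ae_of_all _ fun ω => ?_, ?_⟩
  · rw [adaptiveSSGD, hunif.cost_toAlgorithm]
    exact ENat.natCast_lt_top _
  have hE : numEpochs N - 1 = Nat.clog 2 N := rfl
  have hE' : ((numEpochs N : ℕ) : ℝ) = Nat.clog 2 N + 1 := by simp [numEpochs]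
  have hEpos : (0 : ℝ) < Nat.clog 2 N + 1 := by positivity
  have hδ' : 0 < δ / (2 * numEpochs N) := by rw [hE']; positivity
  refine (hunif.le_prob_output S (neighbor hN (fun _ => 1) 0) {a} hδ.le ?_).trans
    (measure_mono ?_)
  · have hep := expect_epochResult_le hN hd hσ hconv hS hL hL0 hc ha hs hl hB hT hδ' hTM hBc hTδ
      (numEpochs N - 1)
    refine (expect_bind_le S _ _ (B := {y : Fin d → ℝ | (∀ i, 1 ≤ y i ∧ y i ≤ N) ∧
        ∀ i, |y i - ((a i : ℤ) : ℝ)| ≤ N / 2 ^ (numEpochs N - 1 + 2)}ᶜ)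
        (r := ENNReal.ofReal (δ / 2))
        (fun b => Set.indicator_le_self _ _ b) fun x hx => ?_).trans ?_
    · simp only [Set.mem_compl_iff, Set.mem_ofPred_eq, not_not] at hx
      -- The last epoch has index `⌈log₂ N⌉`, and `N ≤ 2 ^ ⌈log₂ N⌉`.
      have hquarter : (N : ℝ) / 2 ^ (numEpochs N - 1 + 2) ≤ 1 / 4 := by
        rw [hE, pow_add, div_le_div_iff₀ (by positivity) (by norm_num)]
        have : (N : ℝ) ≤ 2 ^ Nat.clog 2 N := by
          exact_mod_cast Nat.le_pow_clog (by norm_num) N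
        linarith
      obtain ⟨k, hk⟩ := exists_neighbor_eq hN (fun i => (hx.1 i).1) (fun i => (hx.1 i).2)
        fun i => (hx.2 i).trans hquarter
      exact expect_roundPoint_le hN hσ hS hc ha hδ hδ1 hk
    · refine (add_le_add_left hep _).trans ?_
      rw [← ENNReal.ofReal_add (by positivity) (by positivity)]
      refine ENNReal.ofReal_le_ofReal (le_of_eq ?_)
      rw [hE, hE']
      field_simp
      ring
  · rintro ω ⟨h1, h2⟩
    refine ⟨h1, ?_⟩
    rw [Set.mem_singleton_iff] at h2
    rw [adaptiveSSGD, h2]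
    exact ha

end HighProbability

/-! ### Choice of the parameters -/

section Parameters

/-- `1 + L² + log d + log⁺ (1/c)`, the part of the iteration number that does not depend on the
failure probability. -/
noncomputable def logOverhead (d : ℕ) (L c : ℝ) : ℝ :=
  1 + L ^ 2 + (Real.log d + max 0 (-Real.log c))

/-- The constant part of the truncation level. -/
noncomputable def truncBase (σ : ℝ) (d : ℕ) (c : ℝ) : ℝ :=
  (64 * σ ^ 2 + 2 * σ) * (1 + √(Real.log d + max 0 (-Real.log c)))

/-- The factor in front of the iteration number. -/
noncomputable def iterationFactor (σ : ℝ) : ℝ :=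
  2048 * (8193 + (64 * σ ^ 2 + 2 * σ) ^ 2) + 32 * σ ^ 2 + 1

/-- The number of iterations. -/
noncomputable def iterationNumber (σ : ℝ) (d : ℕ) (L c δ : ℝ) : ℕ :=
  ⌈iterationFactor σ * (16 * d / c ^ 2 * Real.log (1 / δ) + d ^ 2 / c ^ 2 * logOverhead d L c)⌉₊

variable {σ : ℝ} {d N : ℕ} {L c δ : ℝ}

theorem log_add_max_nonneg : 0 ≤ Real.log d + max 0 (-Real.log c) :=
  add_nonneg (Real.log_natCast_nonneg d) (le_max_left _ _)

theorem one_le_logOverhead : 1 ≤ logOverhead d L c := by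
  have := log_add_max_nonneg (d := d) (c := c)
  have := sq_nonneg L
  unfold logOverhead; linarith

theorem truncBase_pos (hσ : 0 < σ) : 0 < truncBase σ d c := by
  unfold truncBase; positivity

theorem one_le_iterationFactor : 1 ≤ iterationFactor σ := by
  have h1 := sq_nonneg (64 * σ ^ 2 + 2 * σ)
  have h2 := sq_nonneg σ
  unfold iterationFactor; linarith

/-- The ratio `W_e / ε_e = 4 / c` is the same in all epochs; sharpness is what makes the precision
shrink with the box. -/
theorem iterationScale_epoch (hN : 2 ≤ N) (hc : 0 < c) (e : ℕ) :
    iterationScale d (boxWidth N e) (epochPrecision c N e) δ =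
      16 * d / c ^ 2 * Real.log (1 / δ) := by
  have : (0 : ℝ) < N := by exact_mod_cast (by omega : 0 < N)
  unfold iterationScale boxWidth epochPrecision
  field_simp
  ring

theorem truncationScale_epoch (hN : 2 ≤ N) (hc : 0 < c) (e T : ℕ) :
    truncationScale d (boxWidth N e) (epochPrecision c N e) T = √(Real.log (4 * d * T / c)) := by
  have : (0 : ℝ) < N := by exact_mod_cast (by omega : 0 < N)
  unfold truncationScale boxWidth epochPrecision
  congr 2
  field_simp

/-- The truncation bias is at most `c / (16 d)`. -/
theorem truncation_bias_le (hσ : 0 < σ) (hd : 1 ≤ d) (hc : 0 < c) {s : ℝ}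
    (hs : truncBase σ d c ≤ s) :
    2 / (s / (2 * σ ^ 2)) * Real.exp (-(s / (2 * σ ^ 2)) * s + σ ^ 2 * (s / (2 * σ ^ 2)) ^ 2) ≤
      c / (16 * d) := by
  have hd' : (0 : ℝ) < d := by exact_mod_cast hd
  set b := 64 * σ ^ 2 + 2 * σ with hb
  set w := Real.log d + max 0 (-Real.log c) with hw
  have hw0 : 0 ≤ w := log_add_max_nonneg
  have hb0 : 0 < b := by positivity
  have hsb : b * (1 + √w) ≤ s := hs
  have hs1 : b ≤ s := by nlinarith [Real.sqrt_nonneg w]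
  have hs0 : 0 < s := hb0.trans_le hs1
  -- The exponent is optimized by `l = s / (2σ²)`, with value `-s² / (4σ²)`. Of the constant in
  -- `truncBase`, the part `64σ²` controls this prefactor and the part `2σ` gives `s² / (4σ²) ≥ w`,
  -- hence `exp (-s² / (4σ²)) ≤ c / d`.
  have h1 : 2 / (s / (2 * σ ^ 2)) ≤ 1 / 16 := by
    rw [div_div_eq_mul_div, div_le_div_iff₀ hs0 (by norm_num)]
    linarith
  have h2 : -(s / (2 * σ ^ 2)) * s + σ ^ 2 * (s / (2 * σ ^ 2)) ^ 2 = -(s ^ 2 / (4 * σ ^ 2)) := by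
    field_simp; ring
  have h3 : w ≤ s ^ 2 / (4 * σ ^ 2) := by
    rw [le_div_iff₀ (by positivity)]
    have h4 : 2 * σ * √w ≤ s := by
      refine le_trans ?_ hsb
      have : 2 * σ ≤ b := by rw [hb]; nlinarith [sq_nonneg σ]
      nlinarith [Real.sqrt_nonneg w]
    calc w * (4 * σ ^ 2) = (2 * σ * √w) ^ 2 := by rw [mul_pow, Real.sq_sqrt hw0]; ring
      _ ≤ s ^ 2 := pow_le_pow_left₀ (by positivity) h4 2
  have h5 : Real.exp (-(s ^ 2 / (4 * σ ^ 2))) ≤ c / d := by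
    rw [← Real.exp_log (div_pos hc hd')]
    refine Real.exp_le_exp.2 ?_
    rw [Real.log_div hc.ne' hd'.ne']
    have := le_max_right 0 (-Real.log c)
    linarith
  rw [h2]
  calc _ ≤ 1 / 16 * (c / d) := mul_le_mul h1 h5 (Real.exp_nonneg _) (by norm_num)
    _ = _ := by field_simp

theorem le_iterationNumber : iterationFactor σ *
    (16 * d / c ^ 2 * Real.log (1 / δ) + d ^ 2 / c ^ 2 * logOverhead d L c) ≤
      iterationNumber σ d L c δ := Nat.le_ceil _

theorem scale_nonneg (hδ : 0 < δ) (hδ1 : δ ≤ 1) :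
    0 ≤ 16 * d / c ^ 2 * Real.log (1 / δ) :=
  mul_nonneg (by positivity) (Real.log_nonneg (by rw [le_div_iff₀ hδ]; linarith))

theorem overhead_nonneg : 0 ≤ d ^ 2 / c ^ 2 * logOverhead d L c :=
  mul_nonneg (by positivity) (zero_le_one.trans one_le_logOverhead)

theorem iterationNumber_le (hδ : 0 < δ) (hδ1 : δ ≤ 1) : (iterationNumber σ d L c δ : ℝ) ≤
    iterationFactor σ * (16 * d / c ^ 2 * Real.log (1 / δ)) +
      (iterationFactor σ * (d ^ 2 / c ^ 2 * logOverhead d L c) + 1) := by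
  have h := one_le_iterationFactor (σ := σ)
  have := (Nat.ceil_lt_add_one (mul_nonneg (zero_le_one.trans h)
    (add_nonneg (scale_nonneg (d := d) (c := c) hδ hδ1) (overhead_nonneg (d := d) (L := L) (c := c))))).le
  unfold iterationNumber
  linarith

theorem iterationNumber_pos (hd : 1 ≤ d) (hc : 0 < c) (hδ : 0 < δ) (hδ1 : δ ≤ 1) :
    0 < iterationNumber σ d L c δ := by
  have hd' : (0 : ℝ) < d := by exact_mod_cast hd
  refine Nat.ceil_pos.2 (mul_pos (zero_lt_one.trans_le one_le_iterationFactor) ?_)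
  exact add_pos_of_nonneg_of_pos (scale_nonneg hδ hδ1)
    (mul_pos (by positivity) (zero_lt_one.trans_le one_le_logOverhead))

theorem scale_le_iterationNumber (hδ : 0 < δ) (hδ1 : δ ≤ 1) :
    512 * σ ^ 2 * d / c ^ 2 * Real.log (1 / δ) ≤ iterationNumber σ d L c δ ∧
      16 * d / c ^ 2 * Real.log (1 / δ) ≤ iterationNumber σ d L c δ := by
  have h := le_iterationNumber (σ := σ) (d := d) (L := L) (c := c) (δ := δ)
  have h1 := one_le_iterationFactor (σ := σ)
  have h2 := scale_nonneg (d := d) (c := c) hδ hδ1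
  have h3 := overhead_nonneg (d := d) (c := c) (L := L)
  have h4 : 32 * σ ^ 2 ≤ iterationFactor σ := by
    unfold iterationFactor
    linarith [sq_nonneg (64 * σ ^ 2 + 2 * σ)]
  have h5 := mul_nonneg (zero_le_one.trans h1) h3
  have h6 := mul_le_mul_of_nonneg_right h4 h2
  have h7 := mul_le_mul_of_nonneg_right h1 h2
  constructor
  · have : 512 * σ ^ 2 * d / c ^ 2 * Real.log (1 / δ) =
      32 * σ ^ 2 * (16 * d / c ^ 2 * Real.log (1 / δ)) := by ring
    linarith
  · linarith

/-- The iteration number controls the regret of the truncated subgradient method. -/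
theorem truncation_le_sqrt_iterationNumber (hσ : 0 < σ) (hd : 1 ≤ d) (hc : 0 < c)
    (hδ : 0 < δ) (hδ1 : δ ≤ 1) :
    16 * d * (L + (truncBase σ d c + √(Real.log (4 * d * iterationNumber σ d L c δ / c)))) ≤
      c * √(iterationNumber σ d L c δ : ℝ) := by
  have hd' : (0 : ℝ) < d := by exact_mod_cast hd
  have hT0 : (0 : ℝ) < iterationNumber σ d L c δ := by
    exact_mod_cast iterationNumber_pos (σ := σ) (L := L) hd hc hδ hδ1
  have hT := le_iterationNumber (σ := σ) (d := d) (L := L) (c := c) (δ := δ)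
  set T : ℝ := (iterationNumber σ d L c δ : ℝ) with hTdef
  set b := 64 * σ ^ 2 + 2 * σ with hb
  set w := Real.log d + max 0 (-Real.log c) with hw
  set Q := logOverhead d L c with hQ
  have hw0 : 0 ≤ w := log_add_max_nonneg
  have hQ1 : 1 ≤ Q := one_le_logOverhead
  have hQw : Q = 1 + L ^ 2 + w := rfl
  -- `log x ≤ x / A - 1 + log A` with `A = 8192 d³ / c³`. This `A` makes the part linear in `T` use
  -- up exactly half of the available `c² T` (see `hfrac`).
  have hts : √(Real.log (4 * d * T / c)) ^ 2 ≤ 4 * d * T / c / (8192 * d ^ 3 / c ^ 3) + 8192 * Q := by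
    have hA : 0 < 8192 * (d : ℝ) ^ 3 / c ^ 3 := by positivity
    have hlogA : Real.log (8192 * d ^ 3 / c ^ 3) ≤ 8191 + 3 * w := by
      rw [Real.log_div (by positivity) (by positivity), Real.log_mul (by norm_num) (by positivity),
        Real.log_pow, Real.log_pow]
      have h1 : Real.log 8192 ≤ 8191 :=
        (Real.log_le_sub_one_of_pos (by norm_num)).trans (by norm_num)
      have h2 := le_max_right 0 (-Real.log c)
      push_cast
      linarith
    have hlog : Real.log (4 * d * T / c) ≤
        4 * d * T / c / (8192 * d ^ 3 / c ^ 3) + 8192 * Q := by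
      have h1 : Real.log (4 * d * T / c) = Real.log (4 * d * T / c / (8192 * d ^ 3 / c ^ 3)) +
          Real.log (8192 * d ^ 3 / c ^ 3) := by
        rw [← Real.log_mul (by positivity) hA.ne', div_mul_cancel₀ _ hA.ne']
      have h2 := Real.log_le_sub_one_of_pos
        (show 0 < 4 * d * T / c / (8192 * d ^ 3 / c ^ 3) by positivity)
      have h3 := sq_nonneg L
      rw [h1]; linarith
    rcases le_total 0 (Real.log (4 * d * T / c)) with h | h
    · rw [Real.sq_sqrt h]; exact hlog
    · rw [Real.sqrt_eq_zero_of_nonpos h, zero_pow two_ne_zero]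
      positivity
  set ts := √(Real.log (4 * d * T / c)) with htsdef
  have hts0 : 0 ≤ ts := Real.sqrt_nonneg _
  have htb : truncBase σ d c = b * (1 + √w) := rfl
  have hb0 : 0 < b := by positivity
  have hsw := Real.sq_sqrt hw0
  have hMsq : (L + (b * (1 + √w) + ts)) ^ 2 ≤ 4 * (L ^ 2 + b ^ 2 + b ^ 2 * w + ts ^ 2) := by
    have e : b ^ 2 * w = (b * √w) ^ 2 := by rw [mul_pow, hsw]
    rw [e]
    nlinarith [sq_nonneg (L - b), sq_nonneg (L - b * √w), sq_nonneg (L - ts),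
      sq_nonneg (b - b * √w), sq_nonneg (b - ts), sq_nonneg (b * √w - ts)]
  have hfrac : 1024 * d ^ 2 * (4 * d * T / c / (8192 * d ^ 3 / c ^ 3)) = c ^ 2 * T / 2 := by
    field_simp; norm_num
  -- The other half of `c² T` covers the terms free of `T`: `8192 Q` from the logarithm and `(1 +
  -- b²) Q` from `L` and the base level. This dictates the first summand of `iterationFactor`.
  have hlow : 2048 * (8193 + b ^ 2) * (d ^ 2 * Q) ≤ c ^ 2 * T := by
    have h1 : 2048 * (8193 + b ^ 2) ≤ iterationFactor σ := by
      unfold iterationFactor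
      linarith [sq_nonneg σ]
    have h2 : iterationFactor σ * (d ^ 2 / c ^ 2 * Q) ≤ T := by
      have := mul_nonneg (zero_le_one.trans (one_le_iterationFactor (σ := σ)))
        (scale_nonneg (d := d) (c := c) hδ hδ1)
      linarith
    have h3 := mul_le_mul_of_nonneg_right h1 (show 0 ≤ d ^ 2 / c ^ 2 * Q by positivity)
    have h4 := mul_le_mul_of_nonneg_left (h3.trans h2) (sq_nonneg c)
    refine le_trans (le_of_eq ?_) h4
    field_simp
  have hsq : (16 * d * (L + (b * (1 + √w) + ts))) ^ 2 ≤ c ^ 2 * T := by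
    have h1 := mul_le_mul_of_nonneg_left hMsq (show 0 ≤ 256 * (d : ℝ) ^ 2 by positivity)
    have h2 := mul_le_mul_of_nonneg_left hts (show 0 ≤ 1024 * (d : ℝ) ^ 2 by positivity)
    have h3 : L ^ 2 + b ^ 2 + b ^ 2 * w ≤ (1 + b ^ 2) * Q := by
      rw [hQw]; nlinarith [sq_nonneg L, sq_nonneg b, mul_nonneg (sq_nonneg b) (sq_nonneg L)]
    have h4 := mul_le_mul_of_nonneg_left h3 (show 0 ≤ 1024 * (d : ℝ) ^ 2 by positivity)
    rw [mul_add, hfrac] at h2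
    linarith
  rw [htb, ← Real.sqrt_sq (show 0 ≤ c by positivity), ← Real.sqrt_mul (sq_nonneg c)]
  exact Real.le_sqrt_of_sq_le hsq

/-! ### The cost -/

theorem half_le_log (hN : 2 ≤ N) : (1 / 2 : ℝ) ≤ Real.log N := by
  have h1 : Real.log 2 ≤ Real.log N := Real.log_le_log (by norm_num) (by exact_mod_cast hN)
  linarith [Real.log_two_gt_d9]

/-- `E = (⌈log₂ N⌉ - 1) + 2` is at most `3 log N / log 2`, because `2 ^ (⌈log₂ N⌉ - 1) < N` and `log
2 ≤ log N`. -/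
theorem numEpochs_le (hN : 2 ≤ N) : (numEpochs N : ℝ) ≤ 5 * Real.log N := by
  have hl2 := Real.log_two_gt_d9
  have h2N : Real.log 2 ≤ Real.log N := Real.log_le_log (by norm_num) (by exact_mod_cast hN)
  have h1 : (2 : ℝ) ^ (Nat.clog 2 N - 1) < N := by
    exact_mod_cast Nat.pow_pred_clog_lt_self (by norm_num) (by omega)
  have h2 := Real.log_lt_log (by positivity) h1
  rw [Real.log_pow] at h2
  have h3 : 1 ≤ Nat.clog 2 N := Nat.clog_pos (by norm_num) hN
  rw [Nat.cast_sub h3] at h2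
  have h4 : (numEpochs N : ℝ) = Nat.clog 2 N + 1 := by simp [numEpochs]
  rw [h4]
  have h5 : (1 : ℝ) ≤ Nat.clog 2 N := by exact_mod_cast h3
  push_cast at h2
  nlinarith

/-- The price of sharing `δ` among the epochs. The crude bound `2E ≤ N²` suffices, as `log N` is
absorbed by the part of the cost that does not depend on `δ`. -/
theorem log_two_mul_numEpochs_le (hN : 2 ≤ N) :
    Real.log (2 * numEpochs N) ≤ 2 * Real.log N := by
  have h1 : numEpochs N ≤ N := by
    have : Nat.clog 2 N ≤ N - 1 := Nat.clog_le_of_le_pow (by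
      have := Nat.lt_two_pow_self (n := N - 1)
      omega)
    unfold numEpochs; omega
  have h2 : 2 * numEpochs N ≤ N ^ 2 := by nlinarith
  have h3 : (2 * numEpochs N : ℝ) ≤ (N : ℝ) ^ 2 := by exact_mod_cast h2
  have h4 : (0 : ℝ) < 2 * numEpochs N := by
    have : 0 < numEpochs N := by simp [numEpochs]
    positivity
  have := Real.log_le_log h4 h3
  rwa [Real.log_pow] at this

/-- The part of the cost bound that does not depend on `δ`. -/
noncomputable def costRemainder (σ : ℝ) (d N : ℕ) (L c : ℝ) : ℝ :=
  d ^ 3 * Real.log N / c ^ 2 * (320 * iterationFactor σ * Real.log N +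
    (10 * iterationFactor σ + 7680 * σ ^ 2) * logOverhead d L c) + 14 * d * Real.log N

theorem costRemainder_nonneg : 0 ≤ costRemainder σ d N L c := by
  have h1 := Real.log_natCast_nonneg N
  have h2 := zero_le_one.trans (one_le_iterationFactor (σ := σ))
  have h3 := zero_le_one.trans (one_le_logOverhead (d := d) (L := L) (c := c))
  unfold costRemainder
  positivity

/-- The number of simulations of the adaptive stochastic subgradient method. -/
theorem simulations_le (hd : 1 ≤ d) (hN : 2 ≤ N) (hδ : 0 < δ) (hδ1 : δ < 1) :
    ((numEpochs N * (iterationNumber σ d L c (δ / (2 * numEpochs N)) * (2 * d)) +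
      roundingReplications σ d (c / 2) δ * (d + 1) : ℕ) : ℝ) ≤
      (160 * iterationFactor σ + 512 * σ ^ 2) * leadingCost d N c δ + costRemainder σ d N L c := by
  have hE1 : (1 : ℝ) ≤ numEpochs N := by
    have : 1 ≤ numEpochs N := by simp [numEpochs]
    exact_mod_cast this
  have hE := numEpochs_le hN
  have hlE := log_two_mul_numEpochs_le hN
  have hq := half_le_log hN
  have hd1 : (1 : ℝ) ≤ d := by exact_mod_cast hd
  have hQ := one_le_logOverhead (d := d) (L := L) (c := c)
  have ha := one_le_iterationFactor (σ := σ)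
  have hl0 : 0 ≤ Real.log (1 / δ) := Real.log_nonneg (by rw [le_div_iff₀ hδ]; linarith)
  have hδ' : 0 < δ / (2 * numEpochs N) := by positivity
  have hδ'1 : δ / (2 * numEpochs N) ≤ 1 := by rw [div_le_one (by positivity)]; linarith
  have hT := iterationNumber_le (σ := σ) (d := d) (L := L) (c := c) hδ' hδ'1
  have hlog1 : Real.log (1 / (δ / (2 * numEpochs N))) ≤ Real.log (1 / δ) + 2 * Real.log N := by
    rw [one_div_div, div_eq_mul_one_div, Real.log_mul (by positivity) (by positivity)]
    linarith
  have hlog2 : Real.log (8 * (d + 1) / δ) ≤ Real.log (1 / δ) + 15 * logOverhead d L c := by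
    rw [div_eq_mul_one_div, Real.log_mul (by positivity) (by positivity)]
    have h1 : Real.log (8 * (d + 1)) ≤ Real.log (16 * d) :=
      Real.log_le_log (by positivity) (by linarith)
    rw [Real.log_mul (x := 16) (by norm_num) (by positivity)] at h1
    have h2 : Real.log 16 ≤ 15 :=
      (Real.log_le_sub_one_of_pos (by norm_num)).trans (by norm_num)
    have h3 : Real.log d ≤ 15 * (logOverhead d L c - 1) := by
      have := Real.log_natCast_nonneg d
      have := le_max_left 0 (-Real.log c)
      have := sq_nonneg L
      unfold logOverhead; linarith
    linarith
  have hn : (roundingReplications σ d (c / 2) δ : ℝ) ≤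
      128 * σ ^ 2 / c ^ 2 * (Real.log (1 / δ) + 15 * logOverhead d L c) + 1 := by
    have hpos : 0 ≤ Real.log (8 * (d + 1) / δ) :=
      Real.log_nonneg (by rw [le_div_iff₀ hδ]; linarith)
    have h1 := (Nat.ceil_lt_add_one (a := 32 * σ ^ 2 / (c / 2) ^ 2 * Real.log (8 * (d + 1) / δ))
      (mul_nonneg (by positivity) hpos)).le
    have h2 : 32 * σ ^ 2 / (c / 2) ^ 2 = 128 * σ ^ 2 / c ^ 2 := by
      rw [div_pow, div_div_eq_mul_div]; ring
    have h3 := mul_le_mul_of_nonneg_left hlog2 (show 0 ≤ 128 * σ ^ 2 / c ^ 2 by positivity)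
    unfold roundingReplications
    rw [h2] at h1 ⊢
    linarith
  set q := Real.log N
  set ℓ := Real.log (1 / δ)
  set Q := logOverhead d L c
  set A := iterationFactor σ
  set E : ℝ := (numEpochs N : ℝ)
  set T : ℝ := (iterationNumber σ d L c (δ / (2 * numEpochs N)) : ℝ)
  set n : ℝ := (roundingReplications σ d (c / 2) δ : ℝ)
  have hA0 : 0 ≤ A := zero_le_one.trans ha
  have hQ0 : 0 ≤ Q := zero_le_one.trans hQ
  have hq0 : 0 ≤ q := by linarith
  have hd0 : (0 : ℝ) ≤ d := by linarith
  have hT0 : 0 ≤ T := Nat.cast_nonneg _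
  have hn0 : 0 ≤ n := Nat.cast_nonneg _
  have hT2 : T ≤ A * (16 * d / c ^ 2 * (ℓ + 2 * q)) + (A * (d ^ 2 / c ^ 2 * Q) + 1) := by
    have h1 : 16 * d / c ^ 2 * Real.log (1 / (δ / (2 * numEpochs N))) ≤
        16 * d / c ^ 2 * (ℓ + 2 * q) := mul_le_mul_of_nonneg_left hlog1 (by positivity)
    have h2 := mul_le_mul_of_nonneg_left h1 hA0
    linarith
  push_cast
  change E * (T * (2 * d)) + n * (d + 1) ≤ _
  have hd2 : (d : ℝ) ≤ d ^ 2 := by nlinarith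
  have hd23 : (d : ℝ) ^ 2 ≤ d ^ 3 := by nlinarith
  have step1 : E * (T * (2 * d)) ≤ 5 * q *
      ((A * (16 * d / c ^ 2 * (ℓ + 2 * q)) + (A * (d ^ 2 / c ^ 2 * Q) + 1)) * (2 * d)) := by
    gcongr
  have step2 : n * (d + 1) ≤ (128 * σ ^ 2 / c ^ 2 * (ℓ + 15 * Q) + 1) * (2 * d * (2 * q)) := by
    -- The rounding stage carries no factor `log N`; one is inserted using `log N ≥ 1/2`.
    have : (d : ℝ) + 1 ≤ 2 * d * (2 * q) := by nlinarith
    exact mul_le_mul hn this (by positivity) (by positivity)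
  have e1 : 5 * q *
      ((A * (16 * d / c ^ 2 * (ℓ + 2 * q)) + (A * (d ^ 2 / c ^ 2 * Q) + 1)) * (2 * d)) =
      160 * A * (d ^ 2 * (q / c ^ 2 * ℓ)) + 320 * A * (d ^ 2 * (q / c ^ 2 * q)) +
        d ^ 3 * (q / c ^ 2) * (10 * A * Q) + 10 * d * q := by ring
  have e2 : (128 * σ ^ 2 / c ^ 2 * (ℓ + 15 * Q) + 1) * (2 * d * (2 * q)) =
      512 * σ ^ 2 * (d * (q / c ^ 2 * ℓ)) + d * (q / c ^ 2 * (7680 * σ ^ 2 * Q)) + 4 * d * q := by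
    ring
  have f1 : 512 * σ ^ 2 * (d * (q / c ^ 2 * ℓ)) ≤ 512 * σ ^ 2 * (d ^ 2 * (q / c ^ 2 * ℓ)) := by
    gcongr
  have f2 : d * (q / c ^ 2 * (7680 * σ ^ 2 * Q)) ≤ d ^ 3 * (q / c ^ 2 * (7680 * σ ^ 2 * Q)) := by
    gcongr; exact hd2.trans hd23
  have f3 : 320 * A * (d ^ 2 * (q / c ^ 2 * q)) ≤ 320 * A * (d ^ 3 * (q / c ^ 2 * q)) := by
    gcongr
  have g1 : (160 * A + 512 * σ ^ 2) * leadingCost d N c δ + costRemainder σ d N L c =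
      160 * A * (d ^ 2 * (q / c ^ 2 * ℓ)) + 512 * σ ^ 2 * (d ^ 2 * (q / c ^ 2 * ℓ)) +
      320 * A * (d ^ 3 * (q / c ^ 2 * q)) + d ^ 3 * (q / c ^ 2) * (10 * A * Q) +
      d ^ 3 * (q / c ^ 2 * (7680 * σ ^ 2 * Q)) + 14 * d * q := by
    change (160 * A + 512 * σ ^ 2) * (d ^ 2 * q / c ^ 2 * ℓ) +
      (d ^ 3 * q / c ^ 2 * (320 * A * q + (10 * A + 7680 * σ ^ 2) * Q) + 14 * d * q) = _
    ring
  rw [g1]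
  linarith

theorem leadingCost_nonneg (hδ : 0 < δ) (hδ1 : δ < 1) : 0 ≤ leadingCost d N c δ := by
  have h1 := Real.log_natCast_nonneg N
  have h2 : 0 ≤ Real.log (1 / δ) := Real.log_nonneg (by rw [le_div_iff₀ hδ]; linarith)
  unfold leadingCost
  positivity

/-- For large `c` the logarithm `log (d² N / c³)` may be negative. Because `c ≤ L`, the term `L²`
outweighs it, and their sum dominates `log N`, the overhead and `c²` up to constants. -/
theorem costRemainder_le (hd : 1 ≤ d) (hN : 2 ≤ N) (hc : 0 < c) (hcL : c ≤ L) :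
    costRemainder σ d N L c ≤ (360 * iterationFactor σ + 30720 * σ ^ 2 + 56) *
      (fullCost d N L c δ - leadingCost d N c δ) := by
  have hq := half_le_log hN
  have hd1 : (1 : ℝ) ≤ d := by exact_mod_cast hd
  have hN0 : (0 : ℝ) < N := by exact_mod_cast (by omega : 0 < N)
  have hL : 0 < L := hc.trans_le hcL
  have ha := one_le_iterationFactor (σ := σ)
  have hQ := one_le_logOverhead (d := d) (L := L) (c := c)
  set A := iterationFactor σ
  have hld := Real.log_natCast_nonneg d
  set Λ := Real.log (d ^ 2 * N / c ^ 3) + L ^ 2 with hΛ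
  -- For `c ≥ 1`, `3 log c ≤ 3 log L ≤ 3 L² / 4` by `log u ≤ u - 1` at `u = L² / 2`, so a quarter of
  -- `L²` survives.
  have hΛlow : 2 * Real.log d + Real.log N + 3 * max 0 (-Real.log c) + L ^ 2 / 4 ≤ Λ := by
    rw [hΛ, Real.log_div (by positivity) (by positivity), Real.log_mul (by positivity) hN0.ne',
      Real.log_pow, Real.log_pow]
    push_cast
    rcases le_total 0 (-Real.log c) with h | h
    · rw [max_eq_right h]
      linarith [sq_nonneg L]
    · rw [max_eq_left h]
      have h1 : Real.log c ≤ Real.log L := Real.log_le_log hc hcL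
      have h2 := Real.log_le_sub_one_of_pos (show 0 < L ^ 2 / 2 by positivity)
      rw [Real.log_div (by positivity) (by norm_num), Real.log_pow] at h2
      push_cast at h2
      linarith [Real.log_two_lt_d9]
  have hm := le_max_left 0 (-Real.log c)
  have hL2 := sq_nonneg L
  have hqΛ : Real.log N ≤ Λ := by linarith
  have hQΛ : logOverhead d L c ≤ 4 * Λ := by unfold logOverhead; linarith
  have hcΛ : c ^ 2 ≤ 4 * Λ := by nlinarith
  have hfull : fullCost d N L c δ - leadingCost d N c δ = d ^ 3 * Real.log N / c ^ 2 * Λ := by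
    unfold fullCost; rw [hΛ]; ring
  rw [hfull]
  set q := Real.log N
  set Q := logOverhead d L c
  have hq0 : 0 ≤ q := by linarith
  have hΛ0 : 0 ≤ Λ := by linarith
  have hA0 : 0 ≤ A := zero_le_one.trans ha
  have h1 : 14 * d * q ≤ d ^ 3 * q / c ^ 2 * (14 * (4 * Λ)) := by
    calc 14 * d * q ≤ 14 * d ^ 3 * q := by
          have : (d : ℝ) ≤ d ^ 3 := by nlinarith [sq_nonneg (d : ℝ)]
          gcongr
      _ = d ^ 3 * q / c ^ 2 * (14 * c ^ 2) := by field_simp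
      _ ≤ _ := by gcongr
  have h2 : d ^ 3 * q / c ^ 2 * (320 * A * q + (10 * A + 7680 * σ ^ 2) * Q) ≤
      d ^ 3 * q / c ^ 2 * (320 * A * Λ + (10 * A + 7680 * σ ^ 2) * (4 * Λ)) := by
    gcongr
  change d ^ 3 * q / c ^ 2 * (320 * A * q + (10 * A + 7680 * σ ^ 2) * Q) + 14 * d * q ≤ _
  linarith

/-- The indifference zone parameter of a nonempty model class is at most the Lipschitz constant. -/
theorem SimModel.IsOptimalWithGap.le_lipschitz {S : SimModel.{u} d N} (hd : 1 ≤ d) (hN : 2 ≤ N)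
    {a : Grid d N} (ha : S.IsOptimalWithGap c a) (hL : S.IsLipschitz L) : c ≤ L := by
  have hex : ∀ i, ∃ z : Set.Icc (1 : ℤ) N, (z : ℤ) ≠ a i ∧ |(z : ℤ) - (a i : ℤ)| ≤ 1 := by
    intro i
    have h := (a i).2
    simp only [Set.mem_Icc] at h
    by_cases h1 : (a i : ℤ) = 1
    · exact ⟨⟨2, by simp only [Set.mem_Icc]; omega⟩, by simp [h1], by simp [h1]⟩
    · refine ⟨⟨(a i : ℤ) - 1, by simp only [Set.mem_Icc]; omega⟩, ?_, ?_⟩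
      · simp
      · simp
  choose y hy1 hy2 using hex
  have hne : y ≠ a := fun h => hy1 ⟨0, hd⟩ (by rw [h])
  have h1 := ha y hne
  have h2 := (le_abs_self _).trans (hL y a hy2)
  linarith

/-- The truncation level. -/
noncomputable def truncationLevel (σ : ℝ) (d : ℕ) (L c δ : ℝ) : ℝ :=
  L + (truncBase σ d c + √(Real.log (4 * d * iterationNumber σ d L c δ / c)))

/-- The constant in the cost bounds. -/
noncomputable def costFactor (σ : ℝ) : ℝ := 360 * iterationFactor σ + 30720 * σ ^ 2 + 56

theorem one_le_costFactor : 1 ≤ costFactor σ := by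
  have := one_le_iterationFactor (σ := σ)
  have := sq_nonneg σ
  unfold costFactor; linarith

end Parameters

/-! ### The tuned algorithm: guarantee and cost -/

section Guarantee

variable {σ : ℝ≥0} {d N : ℕ} {L c δ : ℝ}

theorem epochFailure_pos (hδ : 0 < δ) : 0 < δ / (2 * numEpochs N) := by
  have : 0 < numEpochs N := by simp [numEpochs]
  positivity

theorem epochFailure_le_one (hδ1 : δ < 1) : δ / (2 * numEpochs N) ≤ 1 := by
  have : 1 ≤ numEpochs N := by simp [numEpochs]
  have : (1 : ℝ) ≤ numEpochs N := by exact_mod_cast this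
  rw [div_le_one (by positivity)]
  linarith

/-- The adaptive stochastic subgradient method with the parameters chosen above. -/
noncomputable abbrev tunedSSGD (σ : ℝ≥0) (d : ℕ) (hN : 2 ≤ N) (L c δ : ℝ) :
    SimAlgorithm (Grid d N) :=
  adaptiveSSGD (d := d) hN σ c δ (fun _ => iterationNumber σ d L c (δ / (2 * numEpochs N)))
    (fun _ => truncationLevel σ d L c (δ / (2 * numEpochs N)))

theorem isPCSIZAlgorithm_tunedSSGD (hσ : 0 < σ) (hd : 1 ≤ d) (hN : 2 ≤ N) (hL : 0 ≤ L)
    (hc : 0 < c) (hδ : 0 < δ) (hδ1 : δ < 1) :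
    IsPCSIZAlgorithm c δ (modelClass.{u} d N σ L c) (tunedSSGD σ d hN L c δ) := by
  have hσ' : (0 : ℝ) < σ := by exact_mod_cast hσ
  have hd' : (0 : ℝ) < d := by exact_mod_cast hd
  have hδ' := epochFailure_pos (N := N) hδ
  have hδ'1 := epochFailure_le_one (N := N) hδ1
  have hb0 := truncBase_pos (d := d) (c := c) hσ'
  have hts0 := Real.sqrt_nonneg
    (Real.log (4 * d * iterationNumber σ d L c (δ / (2 * numEpochs N)) / c))
  exact isPCSIZ_adaptiveSSGD hN hd hσ hL hc (by linarith)
    (div_pos (add_pos_of_pos_of_nonneg hb0 hts0) (by positivity : 0 < 2 * (σ : ℝ) ^ 2))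
    (truncation_bias_le hσ' hd hc (by linarith))
    (iterationNumber_pos hd hc hδ' hδ'1) hδ hδ1
    (truncation_le_sqrt_iterationNumber hσ' hd hc hδ' hδ'1)
    (le_of_eq (by field_simp)) (scale_le_iterationNumber hδ' hδ'1).1

/-- Membership of a model in the class matters only through the inequality `c ≤ L` that it forces;
the cost itself does not depend on the model or the sample. -/
theorem cost_tunedSSGD_le (hd : 1 ≤ d) (hN : 2 ≤ N) (hc : 0 < c) (hδ : 0 < δ) (hδ1 : δ < 1)
    {S : SimModel.{u} d N} (hS : S ∈ modelClass d N σ L c) (ω : S.Sample) :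
    ((tunedSSGD σ d hN L c δ).cost (S.outcome ω) : ℝ≥0∞) ≤
        ENNReal.ofReal (costFactor σ * fullCost d N L c δ) ∧
      ((tunedSSGD σ d hN L c δ).cost (S.outcome ω) : ℝ≥0∞) ≤
        ENNReal.ofReal (costFactor σ * leadingCost d N c δ + costRemainder σ d N L c) := by
  obtain ⟨_, _, hlip, a, ha⟩ := hS
  have hrem := costRemainder_le (σ := (σ : ℝ)) (δ := δ) hd hN hc
    (ha.le_lipschitz hd hN hlip)
  have hsim := simulations_le (σ := (σ : ℝ)) (L := L) (c := c) hd hN hδ hδ1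
  have hlead : (160 * iterationFactor σ + 512 * (σ : ℝ) ^ 2) * leadingCost d N c δ ≤
      costFactor σ * leadingCost d N c δ := by
    refine mul_le_mul_of_nonneg_right ?_ (leadingCost_nonneg hδ hδ1)
    have := one_le_iterationFactor (σ := (σ : ℝ))
    have := sq_nonneg (σ : ℝ)
    unfold costFactor; linarith
  change costRemainder σ d N L c ≤ costFactor σ * _ at hrem
  rw [tunedSSGD, adaptiveSSGD, (isUniform_adaptiveSSGD hN σ c δ _ _).cost_toAlgorithm,
    ENat.toENNReal_coe, ← ENNReal.ofReal_natCast]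
  constructor
  · exact ENNReal.ofReal_le_ofReal (hsim.trans (by linarith))
  · exact ENNReal.ofReal_le_ofReal (hsim.trans (by linarith))

/-- A pointwise bound survives integration against a probability measure. For an empty class the
supremum is `0`, so even a bound read as `0` is correct. -/
theorem expectedSimulationCost_le {A : SimAlgorithm (Grid d N)} {𝓜 : Set (SimModel.{u} d N)}
    (hA : IsPCSIZAlgorithm c δ 𝓜 A) {r : ℝ≥0∞}
    (hr : ∀ S ∈ 𝓜, ∀ ω, (A.cost (S.outcome ω) : ℝ≥0∞) ≤ r) : expectedSimulationCost c δ 𝓜 ≤ r := by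
  refine (iInf₂_le A hA).trans (iSup₂_le fun S hS => ?_)
  exact (lintegral_mono (hr S hS)).trans (by simp)

end Guarantee

theorem mainTheorem5 (σ : ℝ≥0) (hσ : 0 < σ) :
    ∃ C : ℝ, 0 < C ∧
      ∀ (d N : ℕ) (_ : 1 ≤ d) (hN : 2 ≤ N) (L c : ℝ) (_ : 0 ≤ L) (_ : 0 < c),
        ∃ C₃ : ℝ, ∀ δ : ℝ, 0 < δ → δ < 1 →
          (∃ (T : ℕ → ℕ) (M : ℕ → ℝ),
            (∀ e < numEpochs N,
              C⁻¹ * iterationScale d (boxWidth N e) (epochPrecision c N e)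
                  (δ / (2 * numEpochs N)) ≤ T e ∧
              (T e : ℝ) ≤ C * iterationScale d (boxWidth N e) (epochPrecision c N e)
                  (δ / (2 * numEpochs N)) + C₃ ∧
              0 < M e ∧
              C⁻¹ * truncationScale d (boxWidth N e) (epochPrecision c N e) (T e) ≤ M e ∧
              M e ≤ C * truncationScale d (boxWidth N e) (epochPrecision c N e) (T e) + C₃) ∧
            IsPCSIZAlgorithm c δ (modelClass d N σ L c)
              (adaptiveSSGD (d := d) hN σ c δ T M) ∧
            ∀ S ∈ modelClass d N σ L c, ∀ᵐ ω ∂S.prob,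
              ((adaptiveSSGD (d := d) hN σ c δ T M).cost (S.outcome ω) : ℝ≥0∞) ≤
                  ENNReal.ofReal (C * fullCost d N L c δ) ∧
              ((adaptiveSSGD (d := d) hN σ c δ T M).cost (S.outcome ω) : ℝ≥0∞) ≤
                  ENNReal.ofReal (C * leadingCost d N c δ + C₃)) ∧
          expectedSimulationCost c δ (modelClass d N σ L c) ≤
              ENNReal.ofReal (C * fullCost d N L c δ) ∧
          expectedSimulationCost c δ (modelClass d N σ L c) ≤
              ENNReal.ofReal (C * leadingCost d N c δ + C₃) := by
  have hσ' : (0 : ℝ) < σ := by exact_mod_cast hσ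
  have hC1 := one_le_costFactor (σ := (σ : ℝ))
  have hC0 := zero_lt_one.trans_le hC1
  refine ⟨costFactor σ, hC0, fun d N hd hN L c hL hc => ?_⟩
  have hA := one_le_iterationFactor (σ := (σ : ℝ))
  have hR0 := costRemainder_nonneg (σ := (σ : ℝ)) (d := d) (N := N) (L := L) (c := c)
  have hO : 0 ≤ iterationFactor σ * (d ^ 2 / c ^ 2 * logOverhead d L c) :=
    mul_nonneg (by linarith) overhead_nonneg
  have hb0 := truncBase_pos (d := d) (c := c) hσ'
  -- The sum of the additive constants for the iteration number, the truncation level and the cost,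
  -- all nonnegative and free of `δ`.
  set C₃ := iterationFactor σ * (d ^ 2 / c ^ 2 * logOverhead d L c) + 1 +
    (L + truncBase (σ : ℝ) d c) + costRemainder σ d N L c with hC₃
  have hmono : ∀ δ, ENNReal.ofReal (costFactor σ * leadingCost d N c δ + costRemainder σ d N L c) ≤
      ENNReal.ofReal (costFactor σ * leadingCost d N c δ + C₃) := fun δ =>
    ENNReal.ofReal_le_ofReal (by linarith)
  -- The witnesses `T` and `M`, constant in `e`, are read off from `tunedSSGD`. The summand `√(log
  -- (4dT/c))` of the truncation level is not needed for the bias bound; it provides the lower bound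
  -- demanded of `M e`.
  refine ⟨C₃, fun δ hδ hδ1 => ⟨⟨_, _, fun e _ => ?_,
    isPCSIZAlgorithm_tunedSSGD hσ hd hN hL hc hδ hδ1, fun S hS => ae_of_all _ fun ω =>
      ⟨(cost_tunedSSGD_le hd hN hc hδ hδ1 hS ω).1,
        (cost_tunedSSGD_le hd hN hc hδ hδ1 hS ω).2.trans (hmono δ)⟩⟩,
    expectedSimulationCost_le (isPCSIZAlgorithm_tunedSSGD hσ hd hN hL hc hδ hδ1) fun S hS ω =>
      (cost_tunedSSGD_le hd hN hc hδ hδ1 hS ω).1,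
    expectedSimulationCost_le (isPCSIZAlgorithm_tunedSSGD hσ hd hN hL hc hδ hδ1) fun S hS ω =>
      (cost_tunedSSGD_le hd hN hc hδ hδ1 hS ω).2.trans (hmono δ)⟩⟩
  have hδ' := epochFailure_pos (N := N) hδ
  have hδ'1 := epochFailure_le_one (N := N) hδ1
  have hscale := scale_nonneg (d := d) (c := c) hδ' hδ'1
  have hT := iterationNumber_le (σ := (σ : ℝ)) (d := d) (L := L) (c := c) hδ' hδ'1
  have hCinv := inv_le_one_of_one_le₀ hC1
  have hAC : iterationFactor σ ≤ costFactor σ := by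
    have := sq_nonneg (σ : ℝ)
    unfold costFactor; linarith
  have hCT := mul_le_mul_of_nonneg_right hAC hscale
  have hts0 := Real.sqrt_nonneg
    (Real.log (4 * d * iterationNumber σ d L c (δ / (2 * numEpochs N)) / c))
  have h2 := mul_le_of_le_one_left hts0 hCinv
  have h4 := le_mul_of_one_le_left hts0 hC1
  rw [iterationScale_epoch hN hc, truncationScale_epoch hN hc]
  unfold truncationLevel
  exact ⟨(mul_le_of_le_one_left hscale hCinv).trans (scale_le_iterationNumber hδ' hδ'1).2,
    by linarith, by linarith, by linarith, by linarith⟩
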